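/- Let $G$ be a (finite-dimensional) Lie group, for instance a compact one, let $\pi:P\to M$ be a smooth principal $G$-bundle over a smooth manifold $M$ (right action $p\mapsto pg=R_g(p)$), and let $T:G\to\mathrm{Aut}(V)$ be a faithful smooth unitary representation on a complex Hilbert space $V$ with $0<\dim V<\infty$. Let $\vartheta$ be a $DT(e)(\mathfrak g)$-valued connection form on $P$: a smooth one-form with values in the real subspace $DT(e)(\mathfrak g)\subset\mathcal B(V)$, with $\vartheta(\xi_{\mathfrak X})=DT(e)\mathfrak X$ on the fundamental vector fields $\xi_{\mathfrak X}$, $\mathfrak X\in\mathfrak g$, and $R_g^*\vartheta=T(g^{-1})\,\vartheta\,T(g)$ for $g\in G$. For a vector field $X$ on $M$ let $X^*$ be its horizontal lift; let $\Omega(\xi,\eta)=d\vartheta(\mathrm{hor}\,\xi,\mathrm{hor}\,\eta)$ be the curvature, with $d\vartheta(\xi,\eta)=\xi\vartheta(\eta)-\eta\vartheta(\xi)-\vartheta([\xi,\eta])$, and $\mathbf DF(\xi)=dF(\mathrm{hor}\,\xi)$ for $F:P\to\mathcal B(V)$. Let $C^\infty_G(P,DT(e)(\mathfrak g))$ be the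 space of smooth $F:P\to DT(e)(\mathfrak g)$ with $F(pg)=T(g^{-1})F(p)T(g)$. Let $\mathcal E_G^0$ be the space of smooth $G$-invariant vector fields $\xi$ on $P$ with $\mathcal L_\xi\vartheta=0$, let $\mathcal H_G^0=D\pi(\mathcal E_G^0)$, and let $\mathcal F_G^0$ be the set of pairs $(F,X)\in C^\infty_G(P,DT(e)(\mathfrak g))\times\mathcal H_G^0$ with $\Omega(X^*,\cdot)=\mathbf DF$, with the bracket $$\{\!\{(F,X),(K,Y)\}\!\}=\bigl(-\Omega(X^*,Y^*)+[F,K],\,[X,Y]\bigr).$$ Let $\mathbb V=(P\times V)/G$ be the associated vector bundle, with classes $[(p,v)]=[(pg,T(g^{-1})v)]$, and $C^\infty(M,\mathbb V)$ its space of smooth sections. For a section $s(\pi(p))=[(p,f(p))]$ put $(\nabla_Xs)(\pi(p))=[(p,(X^*f)(p))]$ and $(\tilde Fs)(\pi(p))=[(p,F(p)f(p))]$. Then $\nabla_X s$ is a well-defined smooth section for every smooth vector field $X$ on $M$ and every $s\in C^\infty(M,\mathbb V)$; $\mathcal F_G^0$ is a real vector space closed under $\{\!\{\cdot,\cdot\}\!\}$;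 and $$Q:\mathcal F_G^0\to\mathrm{End}\bigl(C^\infty(M,\mathbb V)\bigr),\qquad Q_{(F,X)}=-(\nabla_X+\tilde F),$$ is a well-defined injective real-linear map with $$[Q_{(F,X)},Q_{(K,Y)}]=-\,Q_{\{\!\{(F,X),(K,Y)\}\!\}}\qquad\text{for all }(F,X),(K,Y)\in\mathcal F_G^0,$$ where $[\cdot,\cdot]$ is the commutator of operators; equivalently, $(F,X)\mapsto\nabla_X+\tilde F$ carries $\{\!\{\cdot,\cdot\}\!\}$ to the commutator. If $\Omega$ is non-singular, i.e. a tangent vector of $M$ whose horizontal lifts are annihilated by $\Omega$ vanishes, then $X$ is determined by $F$ for $(F,X)\in\mathcal F_G^0$. Whenever $X=:X_F$ is determined by $F$ on $\mathcal F_G^0$, put $Q_F=Q_{(F,X_F)}$ and $\{F,K\}=-\Omega(X_F^*,X_K^*)+[F,K]$ for $F,K\in\mathrm{pr}_1(\mathcal F_G^0)$; then $\{F,K\}\in\mathrm{pr}_1(\mathcal F_G^0)$ and $$[Q_F,Q_K]=-\,Q_{\{F,K\}}.$$ -/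

import Mathlib

open scoped Manifold ContDiff
open MulOpposite (op)

noncomputable section

namespace GaugePrequantization

/-! ## Vector fields -/

/-- Vector fields (not necessarily smooth) on a manifold `N` modelled on `E`. -/
abbrev VField (E N : Type*) [NormedAddCommGroup E] [NormedSpace ℝ E] [TopologicalSpace N]
    [ChartedSpace E N] : Type _ :=
  ∀ x : N, TangentSpace 𝓘(ℝ, E) x

/-- Smoothness of a vector field, as a map into the tangent bundle. -/
def IsSmoothField {E N : Type*} [NormedAddCommGroup E] [NormedSpace ℝ E] [TopologicalSpace N]
    [ChartedSpace E N] [IsManifold 𝓘(ℝ, E) ∞ N] (X : VField E N) : Prop :=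
  ContMDiff 𝓘(ℝ, E) 𝓘(ℝ, E).tangent ∞ (fun x => (⟨x, X x⟩ : TangentBundle 𝓘(ℝ, E) N))

/-! ## Principal bundles -/

/-- A smooth (right) principal `G`-bundle `proj : P → M`.  The right action of `G` on `P` is
written `op g • p`, i.e. `p · g`.  Locally over `M`, the bundle is `G`-equivariantly diffeomorphic,
over `M`, to the product `U × G` with `G` acting by right translations. -/
structure PrincipalBundle (EP EM EG P M G : Type*)
    [NormedAddCommGroup EP] [NormedSpace ℝ EP] [NormedAddCommGroup EM] [NormedSpace ℝ EM]
    [NormedAddCommGroup EG] [NormedSpace ℝ EG]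
    [TopologicalSpace P] [ChartedSpace EP P] [TopologicalSpace M] [ChartedSpace EM M]
    [TopologicalSpace G] [ChartedSpace EG G] [Group G] [MulAction Gᵐᵒᵖ P] where
  /-- the bundle projection -/
  proj : P → M
  contMDiff_act : ContMDiff (𝓘(ℝ, EP).prod 𝓘(ℝ, EG)) 𝓘(ℝ, EP) ∞ (fun q : P × G => op q.2 • q.1)
  proj_act : ∀ (p : P) (g : G), proj (op g • p) = proj p
  locallyTrivial : ∀ m : M, ∃ (U : Set M) (φ : OpenPartialHomeomorph P (M × G)),
    IsOpen U ∧ m ∈ U ∧ φ.source = proj ⁻¹' U ∧ φ.target = U ×ˢ Set.univ ∧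
    ContMDiffOn 𝓘(ℝ, EP) (𝓘(ℝ, EM).prod 𝓘(ℝ, EG)) ∞ φ φ.source ∧
    ContMDiffOn (𝓘(ℝ, EM).prod 𝓘(ℝ, EG)) 𝓘(ℝ, EP) ∞ φ.symm φ.target ∧
    ∀ p ∈ φ.source, (φ p).1 = proj p ∧ ∀ g : G, (φ (op g • p)).2 = (φ p).2 * g

section Main

variable {EP EM EG P M G V : Type*}
  [NormedAddCommGroup EP] [NormedSpace ℝ EP] [NormedAddCommGroup EM] [NormedSpace ℝ EM]
  [NormedAddCommGroup EG] [NormedSpace ℝ EG]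
  [TopologicalSpace P] [ChartedSpace EP P] [TopologicalSpace M] [ChartedSpace EM M]
  [TopologicalSpace G] [ChartedSpace EG G] [Group G] [MulAction Gᵐᵒᵖ P]
  [NormedAddCommGroup V] [InnerProductSpace ℂ V]

namespace PrincipalBundle

variable (B : PrincipalBundle EP EM EG P M G)

theorem proj_surjective : Function.Surjective B.proj := by
  intro m
  obtain ⟨U, φ, -, hm, hs, ht, -, -, h⟩ := B.locallyTrivial m
  have hmem : ((m, 1) : M × G) ∈ φ.target := by rw [ht]; exact ⟨hm, trivial⟩
  refine ⟨φ.symm (m, 1), ?_⟩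
  rw [← (h _ (φ.map_target hmem)).1, φ.right_inv hmem]

/-- The structure group acts simply transitively on the fibres. -/
theorem existsUnique_act {p q : P} (h : B.proj p = B.proj q) : ∃! g : G, q = op g • p := by
  obtain ⟨U, φ, -, hm, hs, ht, -, -, hφ⟩ := B.locallyTrivial (B.proj p)
  have hp : p ∈ φ.source := by rw [hs]; exact hm
  have hq : q ∈ φ.source := by rw [hs]; change B.proj q ∈ U; rw [← h]; exact hm
  have hpg : ∀ g : G, op g • p ∈ φ.source := fun g => by
    rw [hs]; change B.proj _ ∈ U; rw [B.proj_act]; exact hm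
  refine ⟨(φ p).2⁻¹ * (φ q).2, ?_, ?_⟩
  · apply φ.injOn hq (hpg _)
    refine Prod.ext ?_ ?_
    · rw [(hφ _ hq).1, (hφ _ (hpg _)).1, B.proj_act, h]
    · rw [(hφ _ hp).2]; group
  · rintro g rfl
    rw [(hφ _ hp).2]; group

/-- A point of `P` over `m`. -/
def pt (m : M) : P := (B.proj_surjective m).choose

theorem proj_pt (m : M) : B.proj (B.pt m) = m := (B.proj_surjective m).choose_spec

end PrincipalBundle

/-! ## The representation and its derivative -/

/-- The operator `T(g)`, for a unitary representation `T : G → Aut(V)`. -/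
def repOp (T : G →* (V ≃ₗᵢ[ℂ] V)) (g : G) : V →L[ℂ] V :=
  ((T g).toContinuousLinearEquiv : V →L[ℂ] V)

variable (EG) in
/-- The derivative `DT(e) : 𝔤 = T_e G → 𝓑(V)`. -/
def dRep (T : G →* (V ≃ₗᵢ[ℂ] V)) : TangentSpace 𝓘(ℝ, EG) (1 : G) →L[ℝ] (V →L[ℂ] V) :=
  mfderiv 𝓘(ℝ, EG) 𝓘(ℝ, V →L[ℂ] V) (repOp T) 1

variable (EG) in
/-- The real subspace `DT(e)(𝔤)` of `𝓑(V)`. -/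
def repLie (T : G →* (V ≃ₗᵢ[ℂ] V)) : Submodule ℝ (V →L[ℂ] V) :=
  LinearMap.range (dRep EG T : TangentSpace 𝓘(ℝ, EG) (1 : G) →ₗ[ℝ] (V →L[ℂ] V))

/-! ## Connection forms, horizontal lifts, curvature -/

variable (EP P V) in
/-- `𝓑(V)`-valued differential one-forms on `P` (not necessarily smooth). -/
abbrev OneForm : Type _ := ∀ p : P, TangentSpace 𝓘(ℝ, EP) p →L[ℝ] (V →L[ℂ] V)

/-- `θ` is a `DT(e)(𝔤)`-valued connection form on the principal bundle `B`. -/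
structure IsConnectionForm [IsManifold 𝓘(ℝ, EP) ∞ P]
    (B : PrincipalBundle EP EM EG P M G) (T : G →* (V ≃ₗᵢ[ℂ] V)) (θ : OneForm EP P V) :
    Prop where
  smooth : ContMDiff 𝓘(ℝ, EP).tangent 𝓘(ℝ, V →L[ℂ] V) ∞
    (fun z : TangentBundle 𝓘(ℝ, EP) P => θ z.1 z.2)
  mem_repLie : ∀ (p : P) (u : TangentSpace 𝓘(ℝ, EP) p), θ p u ∈ repLie EG T
  /-- on the fundamental vector field generated by `x`, the form takes the value `DT(e) x` -/
  fundamental : ∀ (p : P) (x : TangentSpace 𝓘(ℝ, EG) (1 : G)),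
    θ (op (1 : G) • p) (mfderiv 𝓘(ℝ, EG) 𝓘(ℝ, EP) (fun g : G => op g • p) 1 x) = dRep EG T x
  equivariant : ∀ (p : P) (g : G) (u : TangentSpace 𝓘(ℝ, EP) p),
    θ (op g • p) (mfderiv 𝓘(ℝ, EP) 𝓘(ℝ, EP) (fun q : P => op g • q) p u) =
      repOp T g⁻¹ * θ p u * repOp T g

open Classical in
/-- The horizontal lift of `x ∈ T_{π(p)} M` to `T_p P`: the (unique, for a connection form `θ`)
vector `u` with `θ_p(u) = 0` and `Dπ(u) = x`. -/
def hlift (B : PrincipalBundle EP EM EG P M G) (θ : OneForm EP P V) (p : P)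
    (x : TangentSpace 𝓘(ℝ, EM) (B.proj p)) : TangentSpace 𝓘(ℝ, EP) p :=
  if h : ∃ u : TangentSpace 𝓘(ℝ, EP) p,
      θ p u = 0 ∧ mfderiv 𝓘(ℝ, EP) 𝓘(ℝ, EM) B.proj p u = x
  then h.choose else 0

/-- The horizontal lift `X^*` of a vector field `X` on `M`. -/
def hliftField (B : PrincipalBundle EP EM EG P M G) (θ : OneForm EP P V) (X : VField EM M) :
    VField EP P :=
  fun p => hlift B θ p (X (B.proj p))

/-- The projection of `T_p P` onto its horizontal subspace. -/
def horPart (B : PrincipalBundle EP EM EG P M G) (θ : OneForm EP P V) (p : P)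
    (u : TangentSpace 𝓘(ℝ, EP) p) : TangentSpace 𝓘(ℝ, EP) p :=
  hlift B θ p (mfderiv 𝓘(ℝ, EP) 𝓘(ℝ, EM) B.proj p u)

/-- The derivative `Z f` of a function with values in a real normed space along a vector field. -/
def fieldDeriv {W : Type*} [NormedAddCommGroup W] [NormedSpace ℝ W] (Z : VField EP P) (f : P → W)
    (p : P) : W :=
  mfderiv 𝓘(ℝ, EP) 𝓘(ℝ, W) f p (Z p)

/-- Exterior derivative of a one-form, evaluated on vector fields:
`dθ(Z, W) = Z θ(W) - W θ(Z) - θ([Z, W])`. -/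
def extD (θ : OneForm EP P V) (Z W : VField EP P) (p : P) : V →L[ℂ] V :=
  fieldDeriv Z (fun q => θ q (W q)) p - fieldDeriv W (fun q => θ q (Z q)) p
    - θ p (VectorField.mlieBracket 𝓘(ℝ, EP) Z W p)

/-- Lie derivative of a one-form, evaluated on a vector field:
`(𝓛_ξ θ)(Z) = ξ θ(Z) - θ([ξ, Z])`. -/
def lieD (θ : OneForm EP P V) (ξ Z : VField EP P) (p : P) : V →L[ℂ] V :=
  fieldDeriv ξ (fun q => θ q (Z q)) p - θ p (VectorField.mlieBracket 𝓘(ℝ, EP) ξ Z p)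

/-- The curvature form `Ω = Dθ`, i.e. `Ω(Z, W) = dθ(hor Z, hor W)`.  The normalization of `d` is the
one of `extD`; in the convention where `d` of a one-form carries an extra factor `1/2`, this is the
form usually written `2Ω`, and its contraction with `Z` is the interior product `Z ⌟ Ω`. -/
def curv (B : PrincipalBundle EP EM EG P M G) (θ : OneForm EP P V) (Z W : VField EP P) (p : P) :
    V →L[ℂ] V :=
  extD θ (fun q => horPart B θ q (Z q)) (fun q => horPart B θ q (W q)) p

/-- The covariant differential `DF(Z) = dF(hor Z)` of a `𝓑(V)`-valued function. -/
def covDiff (B : PrincipalBundle EP EM EG P M G) (θ : OneForm EP P V) (F : P → (V →L[ℂ] V))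
    (Z : VField EP P) (p : P) : V →L[ℂ] V :=
  fieldDeriv (fun q => horPart B θ q (Z q)) F p

/-! ## The spaces `C^∞_G(P, DT(e)(𝔤))`, `𝓔_G^0`, `𝓗_G^0`, `𝓕_G^0` -/

/-- Membership in `C^∞_G(P, DT(e)(𝔤))`: smooth `DT(e)(𝔤)`-valued functions on `P` with
`F(pg) = T(g⁻¹) F(p) T(g)`. -/
structure IsGaugeFun (EP EG : Type*) [NormedAddCommGroup EP] [NormedSpace ℝ EP]
    [NormedAddCommGroup EG] [NormedSpace ℝ EG] [ChartedSpace EP P] [ChartedSpace EG G]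
    (T : G →* (V ≃ₗᵢ[ℂ] V)) (F : P → (V →L[ℂ] V)) : Prop where
  smooth : ContMDiff 𝓘(ℝ, EP) 𝓘(ℝ, V →L[ℂ] V) ∞ F
  mem_repLie : ∀ p, F p ∈ repLie EG T
  equivariant : ∀ (p : P) (g : G), F (op g • p) = repOp T g⁻¹ * F p * repOp T g

variable (G) in
/-- Membership in `𝓔_G^0`: smooth vector fields on `P` which are invariant under the structure group
and annihilate `θ` under the Lie derivative. -/
structure IsInfAut [IsManifold 𝓘(ℝ, EP) ∞ P] (θ : OneForm EP P V) (ξ : VField EP P) : Prop where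
  smooth : IsSmoothField ξ
  invariant : ∀ (p : P) (g : G),
    ξ (op g • p) = mfderiv 𝓘(ℝ, EP) 𝓘(ℝ, EP) (fun q : P => op g • q) p (ξ p)
  lieD_eq_zero : ∀ Z : VField EP P, IsSmoothField Z → ∀ p, lieD θ ξ Z p = 0

/-- Membership in `𝓗_G^0 = Dπ(𝓔_G^0)`. -/
def IsHamField [IsManifold 𝓘(ℝ, EP) ∞ P] [IsManifold 𝓘(ℝ, EM) ∞ M]
    (B : PrincipalBundle EP EM EG P M G) (θ : OneForm EP P V) (X : VField EM M) : Prop :=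
  IsSmoothField X ∧ ∃ ξ : VField EP P, IsInfAut G θ ξ ∧
    ∀ p, mfderiv 𝓘(ℝ, EP) 𝓘(ℝ, EM) B.proj p (ξ p) = X (B.proj p)

/-- The set `𝓕_G^0` of pairs `(F, X) ∈ C^∞_G(P, DT(e)(𝔤)) × 𝓗_G^0` with `X^* ⌟ Ω = DF`. -/
def hamPairs [IsManifold 𝓘(ℝ, EP) ∞ P] [IsManifold 𝓘(ℝ, EM) ∞ M]
    (B : PrincipalBundle EP EM EG P M G) (T : G →* (V ≃ₗᵢ[ℂ] V)) (θ : OneForm EP P V) :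
    Set ((P → (V →L[ℂ] V)) × VField EM M) :=
  {a | IsGaugeFun EP EG T a.1 ∧ IsHamField B θ a.2 ∧
    ∀ W : VField EP P, IsSmoothField W → ∀ p,
      curv B θ (hliftField B θ a.2) W p = covDiff B θ a.1 W p}

/-- The bracket
`{{(F, X), (G, Y)}} = (-Ω(X^*, Y^*) + [F, G], [X, Y])`. -/
def hamBracket (B : PrincipalBundle EP EM EG P M G) (θ : OneForm EP P V)
    (a b : (P → (V →L[ℂ] V)) × VField EM M) : (P → (V →L[ℂ] V)) × VField EM M :=
  (fun p => - curv B θ (hliftField B θ a.2) (hliftField B θ b.2) p + ⁅a.1 p, b.1 p⁆,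
    VectorField.mlieBracket 𝓘(ℝ, EM) a.2 b.2)

/-- The curvature is non-singular: a tangent vector of `M` whose horizontal lift is annihilated by
`Ω` vanishes. -/
def CurvNonsingular [IsManifold 𝓘(ℝ, EM) ∞ M]
    (B : PrincipalBundle EP EM EG P M G) (θ : OneForm EP P V) : Prop :=
  ∀ X : VField EM M, IsSmoothField X → ∀ p : P,
    (∀ Y : VField EM M, IsSmoothField Y → curv B θ (hliftField B θ X) (hliftField B θ Y) p = 0) →
    X (B.proj p) = 0

open Classical in
/-- A Hamiltonian field `X_F` of a function `F ∈ pr₁(𝓕_G^0)`: a field `X` with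
`(F, X) ∈ 𝓕_G^0`.  It is only used where there is just one. -/
def hamField [IsManifold 𝓘(ℝ, EP) ∞ P] [IsManifold 𝓘(ℝ, EM) ∞ M]
    (B : PrincipalBundle EP EM EG P M G) (T : G →* (V ≃ₗᵢ[ℂ] V)) (θ : OneForm EP P V)
    (F : P → (V →L[ℂ] V)) : VField EM M :=
  if h : ∃ X, (F, X) ∈ hamPairs B T θ then h.choose else 0

/-- The bracket `{F, G} = -Ω(X_F^*, X_G^*) + [F, G]`. -/
def funBracket [IsManifold 𝓘(ℝ, EP) ∞ P] [IsManifold 𝓘(ℝ, EM) ∞ M]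
    (B : PrincipalBundle EP EM EG P M G) (T : G →* (V ≃ₗᵢ[ℂ] V)) (θ : OneForm EP P V)
    (F K : P → (V →L[ℂ] V)) : P → (V →L[ℂ] V) :=
  fun p => - curv B θ (hliftField B θ (hamField B T θ F)) (hliftField B θ (hamField B T θ K)) p
    + ⁅F p, K p⁆

/-! ## The associated vector bundle `𝕍 = (P × V)/G` -/

variable (B : PrincipalBundle EP EM EG P M G) (T : G →* (V ≃ₗᵢ[ℂ] V))

/-- The orbit relation `(p, v) ∼ (pg, T(g⁻¹)v)` on pairs with `p` over `m`. -/
def assocSetoid (m : M) : Setoid ({p : P // B.proj p = m} × V) where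
  r a b := ∃ g : G, (b.1 : P) = op g • (a.1 : P) ∧ b.2 = T g⁻¹ a.2
  iseqv :=
    { refl := fun a => ⟨1, by simp, by simp⟩
      symm := by
        rintro a b ⟨g, h1, h2⟩
        refine ⟨g⁻¹, ?_, ?_⟩
        · rw [h1, ← mul_smul, ← MulOpposite.op_mul]; simp
        · rw [h2]; simp
      trans := by
        rintro a b c ⟨g, h1, h2⟩ ⟨k, h3, h4⟩
        refine ⟨g * k, ?_, ?_⟩
        · rw [h3, h1, ← mul_smul, ← MulOpposite.op_mul]
        · rw [h4, h2, mul_inv_rev, map_mul]; rfl }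

/-- The fibre `𝕍_m` of the associated bundle: the classes `[(p, v)]` with `π(p) = m`. -/
def AssocFiber (m : M) : Type _ := Quotient (assocSetoid B T m)

namespace AssocFiber

/-- The class `[(p, v)]` in the fibre over `m = π(p)`. -/
def mk {m : M} (p : P) (h : B.proj p = m) (v : V) : AssocFiber B T m :=
  Quotient.mk (assocSetoid B T m) (⟨p, h⟩, v)

theorem mk_act {m : M} (p : P) (h : B.proj p = m) (g : G) (v : V) :
    mk B T (op g • p) ((B.proj_act p g).trans h) (T g⁻¹ v) = mk B T p h v :=
  (Quotient.sound (s := assocSetoid B T m) ⟨g, rfl, rfl⟩).symm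

theorem mk_bijective {m : M} (p : P) (h : B.proj p = m) :
    Function.Bijective (mk B T p h) := by
  constructor
  · intro v w hvw
    obtain ⟨g, h1, h2⟩ := Quotient.exact (s := assocSetoid B T m) hvw
    have hg : g = 1 := (B.existsUnique_act (rfl : B.proj p = B.proj p)).unique h1 (by simp)
    subst hg
    simpa using h2.symm
  · intro z
    refine Quotient.inductionOn z ?_
    rintro ⟨⟨q, hq⟩, w⟩
    obtain ⟨g, hg, -⟩ := B.existsUnique_act (hq.trans h.symm)
    exact ⟨T g⁻¹ w, (Quotient.sound (s := assocSetoid B T m) ⟨g, hg, rfl⟩).symm⟩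

/-- Each `p ∈ P` over `m` identifies `V` with the fibre `𝕍_m`, through `v ↦ [(p, v)]`. -/
def frame {m : M} (p : P) (h : B.proj p = m) : V ≃ AssocFiber B T m :=
  Equiv.ofBijective (mk B T p h) (mk_bijective B T p h)

instance instAddCommGroup (m : M) : AddCommGroup (AssocFiber B T m) :=
  (frame B T (B.pt m) (B.proj_pt m)).symm.addCommGroup

instance instModule (m : M) : Module ℂ (AssocFiber B T m) :=
  (frame B T (B.pt m) (B.proj_pt m)).symm.module ℂ

/-- The vector space structure of the fibre makes all the maps `v ↦ [(p, v)]` linear. -/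
theorem mk_add_smul {m : M} (p : P) (h : B.proj p = m) (c : ℂ) (v w : V) :
    mk B T p h (v + c • w) = mk B T p h v + c • mk B T p h w := by
  obtain ⟨g, hg, -⟩ := B.existsUnique_act (h.trans (B.proj_pt m).symm)
  have key : ∀ u : V, mk B T p h u = frame B T (B.pt m) (B.proj_pt m) (T g⁻¹ u) := fun u =>
    Quotient.sound (s := assocSetoid B T m) ⟨g, hg, rfl⟩
  have hadd : ∀ a b : V, frame B T (B.pt m) (B.proj_pt m) (a + c • b) =
      frame B T (B.pt m) (B.proj_pt m) a + c • frame B T (B.pt m) (B.proj_pt m) b := by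
    intro a b
    change _ = (frame B T (B.pt m) (B.proj_pt m)) ((frame B T (B.pt m) (B.proj_pt m)).symm _ +
      (frame B T (B.pt m) (B.proj_pt m)).symm ((frame B T (B.pt m) (B.proj_pt m))
        (c • (frame B T (B.pt m) (B.proj_pt m)).symm _)))
    simp
  rw [key, key, key, map_add, map_smul, hadd]

end AssocFiber

/-- Sections (not necessarily smooth) of the associated bundle. -/
abbrev AssocSection : Type _ := ∀ m : M, AssocFiber B T m

variable {B T}

/-- The equivariant function `f : P → V` of a section `s`: `s(π(p)) = [(p, f(p))]`. -/
def AssocSection.toFun (s : AssocSection B T) (p : P) : V :=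
  (AssocFiber.frame B T p rfl).symm (s (B.proj p))

theorem AssocSection.mk_toFun (s : AssocSection B T) (p : P) :
    AssocFiber.mk B T p rfl (s.toFun p) = s (B.proj p) :=
  (AssocFiber.frame B T p rfl).apply_symm_apply (s (B.proj p))

theorem AssocSection.toFun_eq_iff (s : AssocSection B T) (p : P) (v : V) :
    s.toFun p = v ↔ s (B.proj p) = AssocFiber.mk B T p rfl v :=
  (AssocFiber.frame B T p rfl).symm_apply_eq

theorem AssocSection.toFun_add_smul (s t : AssocSection B T) (c : ℂ) (p : P) :
    AssocSection.toFun (s + c • t) p = s.toFun p + c • t.toFun p := by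
  rw [AssocSection.toFun_eq_iff, AssocFiber.mk_add_smul, s.mk_toFun, t.mk_toFun]
  rfl

/-- A section `s` of the associated bundle is smooth if, in each of the local trivializations
`U × V ≃ 𝕍|_U`, `(m, v) ↦ [(σ(m), v)]` given by the smooth local sections `σ : U → P`, it is
`m ↦ (m, f(m))` with `f` smooth. -/
def AssocSection.IsSmooth (s : AssocSection B T) : Prop :=
  ∀ (U : Set M) (σ : M → P), IsOpen U → ContMDiffOn 𝓘(ℝ, EM) 𝓘(ℝ, EP) ∞ σ U →
    (∀ m ∈ U, B.proj (σ m) = m) →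
    ContMDiffOn 𝓘(ℝ, EM) 𝓘(ℝ, V) ∞ (fun m => s.toFun (σ m)) U

variable (B T)

/-- The complex vector space `C^∞(M, 𝕍)` of smooth sections of the associated bundle. -/
def SmoothSections : Submodule ℂ (AssocSection B T) where
  carrier := {s | s.IsSmooth}
  add_mem' := by
    intro s t hs ht U σ hU hσ hp
    have h : (fun m => AssocSection.toFun (s + t) (σ m)) =
        fun m => s.toFun (σ m) + t.toFun (σ m) := by
      funext m
      simpa using AssocSection.toFun_add_smul s t 1 (σ m)
    rw [h]
    exact (hs U σ hU hσ hp).add (ht U σ hU hσ hp)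
  zero_mem' := by
    intro U σ hU hσ hp
    have h : (fun m => AssocSection.toFun (0 : AssocSection B T) (σ m)) = fun _ => (0 : V) := by
      funext m
      simpa using AssocSection.toFun_add_smul (0 : AssocSection B T) 0 (-1) (σ m)
    rw [h]
    exact contMDiffOn_const
  smul_mem' := by
    intro c s hs U σ hU hσ hp
    have h0 : ∀ p, AssocSection.toFun (0 : AssocSection B T) p = 0 := fun p => by
      simpa using AssocSection.toFun_add_smul (0 : AssocSection B T) 0 (-1) p
    have h : (fun m => AssocSection.toFun (c • s) (σ m)) = fun m => c • s.toFun (σ m) := by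
      funext m
      have := AssocSection.toFun_add_smul (0 : AssocSection B T) s c (σ m)
      rwa [zero_add, h0, zero_add] at this
    rw [h]
    exact ((c • ContinuousLinearMap.id ℝ V).contMDiff (n := ∞)).comp_contMDiffOn (hs U σ hU hσ hp)

variable {B T}

/-- The covariant derivative `∇_X s` of a section: `(∇_X s)(π(p)) = [(p, (X^* f)(p))]`, where `f` is
the equivariant function of `s`.  The point `p` over `m` does not matter, since `X^*` and `f` are
equivariant. -/
def nabla (θ : OneForm EP P V) (X : VField EM M) (s : AssocSection B T) : AssocSection B T :=
  fun m => AssocFiber.mk B T (B.pt m) (B.proj_pt m)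
    (fieldDeriv (hliftField B θ X) s.toFun (B.pt m))

/-- The action of a function `F : P → 𝓑(V)` on sections: `F̃[(p, v)] = [(p, F(p)v)]`.  By
equivariance of `F`, the point `p` over `m` does not matter. -/
def tildeOp (F : P → (V →L[ℂ] V)) (s : AssocSection B T) : AssocSection B T :=
  fun m => AssocFiber.mk B T (B.pt m) (B.proj_pt m) (F (B.pt m) (s.toFun (B.pt m)))

theorem tildeOp_apply {F : P → (V →L[ℂ] V)}
    (hF : ∀ (p : P) (g : G), F (op g • p) = repOp T g⁻¹ * F p * repOp T g)
    (s : AssocSection B T) (p : P) (v : V) (hv : s (B.proj p) = AssocFiber.mk B T p rfl v) :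
    tildeOp F s (B.proj p) = AssocFiber.mk B T p rfl (F p v) := by
  obtain ⟨g, hg, -⟩ := B.existsUnique_act (B.proj_pt (B.proj p)).symm
  have h1 : s.toFun (B.pt (B.proj p)) = T g⁻¹ v := by
    apply (AssocFiber.mk_bijective B T (B.pt (B.proj p)) (B.proj_pt (B.proj p))).1
    have h2 := hv.trans (Quotient.sound (s := assocSetoid B T (B.proj p))
      (a := (⟨p, rfl⟩, v)) (b := (⟨B.pt (B.proj p), B.proj_pt _⟩, T g⁻¹ v)) ⟨g, hg, rfl⟩)
    refine Eq.trans ?_ h2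
    have h3 : ∀ (q : P) (m : M) (h : B.proj q = m),
        AssocFiber.mk B T q h (s.toFun q) = s m := by
      rintro q _ rfl
      exact s.mk_toFun q
    exact h3 _ _ _
  have h4 : F (B.pt (B.proj p)) (T g⁻¹ v) = T g⁻¹ (F p v) := by
    rw [hg, hF]
    have : repOp T g (T g⁻¹ v) = v := by simp [repOp]
    simp only [mul_apply_eq_comp, this]
    rfl
  unfold tildeOp
  rw [h1, h4]
  exact (Quotient.sound (s := assocSetoid B T (B.proj p)) ⟨g, hg, rfl⟩).symm

end Main

end GaugePrequantization

end

open GaugePrequantization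

/-! A section of the associated bundle is the same thing as an equivariant function `f : P → V`, and
in this picture `Q_{(F,X)}` is the operator `f ↦ -(X^*f + Ff)` (`quantFun`). Everything rests on the
infinitesimal form of equivariance: a vertical vector `u` acts by `u f = -θ(u) f` on equivariant
functions (`mfderiv_vertical_equivariant`) and by `u K = -[θ(u), K]` on gauge functions
(`mfderiv_vertical_conj`).

Commutator: `[X^*, Y^*] - [X, Y]^*` is vertical and `θ` takes the value `-Ω(X^*, Y^*)` on it, so
`X^*Y^*f - Y^*X^*f = [X,Y]^*f + Ω(X^*,Y^*)f`. The product rule contributes `(X^*K - Y^*F)f`, which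
the condition `Ω(X^*,·) = DF` turns into `-2Ω(X^*,Y^*)f`, and the zero-order parts contribute
`[F,K]f`. The sum has zero-order term `-Ω(X^*,Y^*) + [F,K]` (`quantFun_commutator`).

Closure under the bracket: if `ξ` is an infinitesimal automorphism over `X`, then `Ω(X^*,·) =
D(-θ(ξ))` (`curv_eq_covDiff_form`). Hence `F = -θ(ξ) + C` with `C` constant in horizontal
directions, and such a `C` commutes with the curvature, since horizontal brackets kill it while
their vertical part acts by a commutator. The bracket of `-θ(ξ)` and `-θ(η)` is `-θ([ξ,η])`, again a
moment function, and all terms containing `C` or `C'` are horizontally constant (`hamBracket_mem`).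

Injectivity: replacing `f` by `(h ∘ π) f` isolates `(Xh) f`, which forces `X = 0`, and then `F f =
0` for every equivariant `f` forces `F = 0`.

Smoothness of horizontal lifts underlies all of this. Faithfulness makes `DT(e)` injective, so a
linear left inverse recovers the Lie algebra element from a value of `θ`, and the horizontal
projection subtracts the corresponding fundamental vector, which depends smoothly on the data. -/

noncomputable section

namespace GaugePrequantization

open VectorField Set Filter Topology

/-! ### Derivatives along vector fields, computed in a chart -/

section Manifold

variable {E N W : Type*} [NormedAddCommGroup E] [NormedSpace ℝ E] [TopologicalSpace N]
  [ChartedSpace E N] [NormedAddCommGroup W] [NormedSpace ℝ W]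

/-- The representative of a vector field in the preferred chart at `x`. -/
def chartField (x : N) (X : VField E N) : E → E :=
  mpullbackWithin 𝓘(ℝ, E) 𝓘(ℝ, E) (extChartAt 𝓘(ℝ, E) x).symm X (range 𝓘(ℝ, E))

section

variable [IsManifold 𝓘(ℝ, E) ∞ N]

theorem mfderiv_extChartAt_field (x : N) (X : VField E N) {y : N}
    (hy : y ∈ (extChartAt 𝓘(ℝ, E) x).source) :
    mfderiv 𝓘(ℝ, E) 𝓘(ℝ, E) (extChartAt 𝓘(ℝ, E) x) y (X y) =
      chartField x X (extChartAt 𝓘(ℝ, E) x y) := by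
  have h1 := mfderivWithin_extChartAt_symm_comp_mfderiv_extChartAt' (I := 𝓘(ℝ, E)) hy
  have hl : (extChartAt 𝓘(ℝ, E) x).symm (extChartAt 𝓘(ℝ, E) x y) = y :=
    (extChartAt 𝓘(ℝ, E) x).left_inv hy
  have h2 := isInvertible_mfderivWithin_extChartAt_symm (I := 𝓘(ℝ, E))
    ((extChartAt 𝓘(ℝ, E) x).map_source hy)
  unfold chartField
  rw [mpullbackWithin_apply, hl]
  refine (h2.inverse_apply_eq.2 ?_).symm
  rw [hl]
  exact (congrArg (fun L => L (X y)) h1).symm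

/-- The manifold bracket is defined as the pullback of the bracket of the chart representatives; the
differential of the chart is invertible and undoes the pullback. -/
theorem mfderiv_extChartAt_mlieBracket (x : N) (X Y : VField E N) :
    mfderiv 𝓘(ℝ, E) 𝓘(ℝ, E) (extChartAt 𝓘(ℝ, E) x) x (mlieBracket 𝓘(ℝ, E) X Y x) =
      lieBracket ℝ (chartField x X) (chartField x Y) (extChartAt 𝓘(ℝ, E) x x) := by
  refine ((isInvertible_mfderiv_extChartAt (mem_extChartAt_source x)).self_apply_inverse _).trans ?_
  rw [← lieBracketWithin_univ]
  congr 1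
  rw [preimage_univ, univ_inter, show range 𝓘(ℝ, E) = univ by simp]

theorem mfderiv_eq_fderiv_chart {x y : N} {f : N → W} (u : TangentSpace 𝓘(ℝ, E) y)
    (hy : y ∈ (extChartAt 𝓘(ℝ, E) x).source) (hf : MDifferentiableAt 𝓘(ℝ, E) 𝓘(ℝ, W) f y) :
    mfderiv 𝓘(ℝ, E) 𝓘(ℝ, W) f y u =
      fderiv ℝ (f ∘ (extChartAt 𝓘(ℝ, E) x).symm) (extChartAt 𝓘(ℝ, E) x y)
        (mfderiv 𝓘(ℝ, E) 𝓘(ℝ, E) (extChartAt 𝓘(ℝ, E) x) y u) := by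
  have hl : (extChartAt 𝓘(ℝ, E) x).symm (extChartAt 𝓘(ℝ, E) x y) = y :=
    (extChartAt 𝓘(ℝ, E) x).left_inv hy
  have ht : extChartAt 𝓘(ℝ, E) x y ∈ (extChartAt 𝓘(ℝ, E) x).target :=
    (extChartAt 𝓘(ℝ, E) x).map_source hy
  have he : MDifferentiableAt 𝓘(ℝ, E) 𝓘(ℝ, E) (extChartAt 𝓘(ℝ, E) x) y :=
    mdifferentiableAt_extChartAt (by simpa using hy)
  have hs : MDifferentiableAt 𝓘(ℝ, E) 𝓘(ℝ, E) (extChartAt 𝓘(ℝ, E) x).symm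
      (extChartAt 𝓘(ℝ, E) x y) := by
    have := mdifferentiableWithinAt_extChartAt_symm (I := 𝓘(ℝ, E)) ht
    rwa [show range 𝓘(ℝ, E) = univ by simp, mdifferentiableWithinAt_univ] at this
  have hc : MDifferentiableAt 𝓘(ℝ, E) 𝓘(ℝ, W) (f ∘ (extChartAt 𝓘(ℝ, E) x).symm)
      (extChartAt 𝓘(ℝ, E) x y) :=
    MDifferentiableAt.comp _ (by rwa [hl]) hs
  have hev : (f ∘ (extChartAt 𝓘(ℝ, E) x).symm) ∘ extChartAt 𝓘(ℝ, E) x =ᶠ[𝓝 y] f := by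
    filter_upwards [(isOpen_extChartAt_source (I := 𝓘(ℝ, E)) x).mem_nhds hy] with z hz
    exact congrArg f ((extChartAt 𝓘(ℝ, E) x).left_inv hz)
  rw [← hev.mfderiv_eq, mfderiv_comp y hc he, ← mfderiv_eq_fderiv]
  rfl

theorem differentiableAt_chartField [CompleteSpace E] {x : N} {X : VField E N}
    (hX : MDifferentiableAt 𝓘(ℝ, E) 𝓘(ℝ, E).tangent
      (fun y => (⟨y, X y⟩ : TangentBundle 𝓘(ℝ, E) N)) x) :
    DifferentiableAt ℝ (chartField x X) (extChartAt 𝓘(ℝ, E) x x) := by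
  have h := MDifferentiableWithinAt.differentiableWithinAt_mpullbackWithin_vectorField
    (s := univ) hX.mdifferentiableWithinAt
  rw [preimage_univ, univ_inter, show range 𝓘(ℝ, E) = univ by simp] at h
  unfold chartField
  rw [show range 𝓘(ℝ, E) = univ by simp]
  exact differentiableWithinAt_univ.1 h

/-- The chart formula is needed on a neighbourhood, not only at `x`, because it is differentiated a
second time. Being `C^1` at a point spreads to nearby points, which is why the order is 1. -/
theorem fieldDeriv_eventuallyEq {x : N} {f : N → W} {X : VField E N}
    (hf : ContMDiffAt 𝓘(ℝ, E) 𝓘(ℝ, W) 1 f x) :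
    fieldDeriv X f =ᶠ[𝓝 x]
      (fun z => fderiv ℝ (f ∘ (extChartAt 𝓘(ℝ, E) x).symm) z (chartField x X z)) ∘
        extChartAt 𝓘(ℝ, E) x := by
  have h1 : ∀ᶠ y in 𝓝 x, ContMDiffAt 𝓘(ℝ, E) 𝓘(ℝ, W) 1 f y :=
    (contMDiffAt_iff_contMDiffAt_nhds (by simp)).1 hf
  filter_upwards [h1, extChartAt_source_mem_nhds (I := 𝓘(ℝ, E)) x] with y hy hys
  rw [fieldDeriv, mfderiv_eq_fderiv_chart _ hys (hy.mdifferentiableAt one_ne_zero),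
    mfderiv_extChartAt_field x X hys]
  rfl

theorem mdifferentiableAt_fieldDeriv [CompleteSpace E] {x : N} {f : N → W} {X : VField E N}
    (hf : ContMDiffAt 𝓘(ℝ, E) 𝓘(ℝ, W) 2 f x)
    (hX : MDifferentiableAt 𝓘(ℝ, E) 𝓘(ℝ, E).tangent
      (fun y => (⟨y, X y⟩ : TangentBundle 𝓘(ℝ, E) N)) x) :
    MDifferentiableAt 𝓘(ℝ, E) 𝓘(ℝ, W) (fieldDeriv X f) x := by
  have hfc : ContDiffAt ℝ 2 (f ∘ (extChartAt 𝓘(ℝ, E) x).symm) (extChartAt 𝓘(ℝ, E) x x) := by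
    have h := (contMDiffAt_iff.1 hf).2
    rw [show range 𝓘(ℝ, E) = univ by simp, contDiffWithinAt_univ] at h
    exact h
  have hd : DifferentiableAt ℝ (fun z =>
      fderiv ℝ (f ∘ (extChartAt 𝓘(ℝ, E) x).symm) z (chartField x X z))
      (extChartAt 𝓘(ℝ, E) x x) :=
    ((hfc.fderiv_right (m := 1) (by norm_num)).differentiableAt one_ne_zero).clm_apply
      (differentiableAt_chartField hX)
  exact (hd.mdifferentiableAt.comp x (mdifferentiableAt_extChartAt (by simp))).congr_of_eventuallyEq
    (fieldDeriv_eventuallyEq (hf.of_le (by norm_num)))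

/-- The derivative along a Lie bracket is the commutator of the derivatives. -/
theorem fieldDeriv_mlieBracket [CompleteSpace E] {x : N} {f : N → W} {X Y : VField E N}
    (hf : ContMDiffAt 𝓘(ℝ, E) 𝓘(ℝ, W) 2 f x)
    (hX : MDifferentiableAt 𝓘(ℝ, E) 𝓘(ℝ, E).tangent
      (fun y => (⟨y, X y⟩ : TangentBundle 𝓘(ℝ, E) N)) x)
    (hY : MDifferentiableAt 𝓘(ℝ, E) 𝓘(ℝ, E).tangent
      (fun y => (⟨y, Y y⟩ : TangentBundle 𝓘(ℝ, E) N)) x) :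
    fieldDeriv (mlieBracket 𝓘(ℝ, E) X Y) f x =
      fieldDeriv X (fieldDeriv Y f) x - fieldDeriv Y (fieldDeriv X f) x := by
  have hx := mem_extChartAt_source (I := 𝓘(ℝ, E)) x
  have hf1 : ContMDiffAt 𝓘(ℝ, E) 𝓘(ℝ, W) 1 f x := hf.of_le (by norm_num)
  have hfc : ContDiffAt ℝ 2 (f ∘ (extChartAt 𝓘(ℝ, E) x).symm) (extChartAt 𝓘(ℝ, E) x x) := by
    have h := (contMDiffAt_iff.1 hf).2
    rw [show range 𝓘(ℝ, E) = univ by simp, contDiffWithinAt_univ] at h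
    exact h
  -- In the chart at `x` an iterated derivative is the derivative of `z ↦ Df(z)(Y(z))` in the
  -- direction `X`. After this the claim is the flat one, where symmetry of the second derivative
  -- cancels the second-order terms.
  have key : ∀ {X Y : VField E N}, MDifferentiableAt 𝓘(ℝ, E) 𝓘(ℝ, E).tangent
      (fun y => (⟨y, Y y⟩ : TangentBundle 𝓘(ℝ, E) N)) x →
      fieldDeriv X (fieldDeriv Y f) x = fderiv ℝ (fun z =>
        fderiv ℝ (f ∘ (extChartAt 𝓘(ℝ, E) x).symm) z (chartField x Y z))
        (extChartAt 𝓘(ℝ, E) x x) (chartField x X (extChartAt 𝓘(ℝ, E) x x)) := by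
    intro X Y hY
    have hd : DifferentiableAt ℝ (fun z =>
        fderiv ℝ (f ∘ (extChartAt 𝓘(ℝ, E) x).symm) z (chartField x Y z))
        (extChartAt 𝓘(ℝ, E) x x) :=
      ((hfc.fderiv_right (m := 1) (by norm_num)).differentiableAt one_ne_zero).clm_apply
        (differentiableAt_chartField hY)
    rw [fieldDeriv, (fieldDeriv_eventuallyEq hf1).mfderiv_eq,
      mfderiv_comp x hd.mdifferentiableAt (mdifferentiableAt_extChartAt (by simp)),
      mfderiv_eq_fderiv]
    exact congrArg _ (mfderiv_extChartAt_field x X hx)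
  rw [key hX, key hY, fieldDeriv, mfderiv_eq_fderiv_chart _ hx
    (hf1.mdifferentiableAt one_ne_zero), mfderiv_extChartAt_mlieBracket]
  exact fderiv_apply_lieBracket hfc (by simp) (differentiableAt_chartField hY)
    (differentiableAt_chartField hX)

end
end Manifold

/-! ### Smooth fields, product rules, tensoriality and related fields -/

section Manifold

variable {E N W : Type*} [NormedAddCommGroup E] [NormedSpace ℝ E] [TopologicalSpace N]
  [ChartedSpace E N] [NormedAddCommGroup W] [NormedSpace ℝ W] [IsManifold 𝓘(ℝ, E) ∞ N]
  {X Y : VField E N}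

theorem IsSmoothField.mdifferentiableAt (hX : IsSmoothField X) (x : N) :
    MDifferentiableAt 𝓘(ℝ, E) 𝓘(ℝ, E).tangent
      (fun y => (⟨y, X y⟩ : TangentBundle 𝓘(ℝ, E) N)) x :=
  (ContMDiff.contMDiffAt hX).mdifferentiableAt (by simp)

theorem IsSmoothField.add (hX : IsSmoothField X) (hY : IsSmoothField Y) :
    IsSmoothField (X + Y) :=
  ContMDiff.add_section hX hY

theorem IsSmoothField.sub (hX : IsSmoothField X) (hY : IsSmoothField Y) :
    IsSmoothField (X - Y) :=
  ContMDiff.sub_section hX hY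

theorem IsSmoothField.const_smul (c : ℝ) (hX : IsSmoothField X) : IsSmoothField (c • X) :=
  ContMDiff.const_smul_section hX

theorem isSmoothField_zero : IsSmoothField (0 : VField E N) :=
  Bundle.contMDiff_zeroSection ℝ (TangentSpace 𝓘(ℝ, E) : N → Type _)

theorem IsSmoothField.mlieBracket [CompleteSpace E] (hX : IsSmoothField X)
    (hY : IsSmoothField Y) : IsSmoothField (mlieBracket 𝓘(ℝ, E) X Y) := by
  have : IsManifold 𝓘(ℝ, E) ((⊤ : ℕ∞) + 1) N := by simpa using ‹IsManifold 𝓘(ℝ, E) ∞ N›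
  have : IsManifold 𝓘(ℝ, E) (minSmoothness ℝ 2) N := by simpa using inferInstanceAs (IsManifold 𝓘(ℝ, E) 2 N)
  have : IsManifold 𝓘(ℝ, E) (minSmoothness ℝ 3) N := by simpa using inferInstanceAs (IsManifold 𝓘(ℝ, E) 3 N)
  exact ContDiff.mlieBracket_vectorField (m := ⊤) (n := ⊤) hX hY (by simp)

section

variable {E N W W₁ W₂ : Type*} [NormedAddCommGroup E] [NormedSpace ℝ E] [TopologicalSpace N]
  [ChartedSpace E N] [NormedAddCommGroup W] [NormedSpace ℝ W]
  [NormedAddCommGroup W₁] [NormedSpace ℝ W₁] [NormedAddCommGroup W₂] [NormedSpace ℝ W₂]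
  {X Y : VField E N} {x : N}

theorem hasMFDerivAt_bilin (L : W₁ →L[ℝ] W₂ →L[ℝ] W) {f : N → W₁} {g : N → W₂}
    (hf : MDifferentiableAt 𝓘(ℝ, E) 𝓘(ℝ, W₁) f x)
    (hg : MDifferentiableAt 𝓘(ℝ, E) 𝓘(ℝ, W₂) g x) :
    HasMFDerivAt 𝓘(ℝ, E) 𝓘(ℝ, W) (fun y => L (f y) (g y)) x
      (L.precompR E (f x) (mfderiv 𝓘(ℝ, E) 𝓘(ℝ, W₂) g x) +
        L.precompL E (mfderiv 𝓘(ℝ, E) 𝓘(ℝ, W₁) f x) (g x)) :=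
  ⟨(L.continuous.continuousAt.comp hf.continuousAt).clm_apply hg.continuousAt, by
    simpa only [mfld_simps] using!
      L.hasFDerivWithinAt_of_bilinear hf.hasMFDerivAt.2 hg.hasMFDerivAt.2⟩

theorem mfderiv_bilin_apply (L : W₁ →L[ℝ] W₂ →L[ℝ] W) {f : N → W₁} {g : N → W₂}
    (hf : MDifferentiableAt 𝓘(ℝ, E) 𝓘(ℝ, W₁) f x)
    (hg : MDifferentiableAt 𝓘(ℝ, E) 𝓘(ℝ, W₂) g x) (u : TangentSpace 𝓘(ℝ, E) x) :
    mfderiv 𝓘(ℝ, E) 𝓘(ℝ, W) (fun y => L (f y) (g y)) x u =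
      L (mfderiv 𝓘(ℝ, E) 𝓘(ℝ, W₁) f x u) (g x) + L (f x) (mfderiv 𝓘(ℝ, E) 𝓘(ℝ, W₂) g x u) := by
  rw [(hasMFDerivAt_bilin L hf hg).mfderiv]
  exact add_comm _ _

theorem mfderiv_clm_apply (L : W₁ →L[ℝ] W) {f : N → W₁}
    (hf : MDifferentiableAt 𝓘(ℝ, E) 𝓘(ℝ, W₁) f x) (u : TangentSpace 𝓘(ℝ, E) x) :
    mfderiv 𝓘(ℝ, E) 𝓘(ℝ, W) (fun y => L (f y)) x u = L (mfderiv 𝓘(ℝ, E) 𝓘(ℝ, W₁) f x u) := by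
  have h := mfderiv_comp x (L.differentiableAt.mdifferentiableAt (x := f x)) hf
  rw [mfderiv_eq_fderiv, L.fderiv] at h
  exact congrArg (fun A => A u) h

theorem fieldDeriv_bilin (L : W₁ →L[ℝ] W₂ →L[ℝ] W) {f : N → W₁} {g : N → W₂}
    (hf : MDifferentiableAt 𝓘(ℝ, E) 𝓘(ℝ, W₁) f x)
    (hg : MDifferentiableAt 𝓘(ℝ, E) 𝓘(ℝ, W₂) g x) :
    fieldDeriv X (fun y => L (f y) (g y)) x =
      L (fieldDeriv X f x) (g x) + L (f x) (fieldDeriv X g x) :=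
  mfderiv_bilin_apply L hf hg (X x)

theorem fieldDeriv_clm (L : W₁ →L[ℝ] W) {f : N → W₁}
    (hf : MDifferentiableAt 𝓘(ℝ, E) 𝓘(ℝ, W₁) f x) :
    fieldDeriv X (fun y => L (f y)) x = L (fieldDeriv X f x) :=
  mfderiv_clm_apply L hf (X x)

theorem fieldDeriv_const (c : W) : fieldDeriv X (fun _ => c) x = 0 := by
  rw [fieldDeriv, mfderiv_const]
  rfl

theorem fieldDeriv_add {f g : N → W} (hf : MDifferentiableAt 𝓘(ℝ, E) 𝓘(ℝ, W) f x)
    (hg : MDifferentiableAt 𝓘(ℝ, E) 𝓘(ℝ, W) g x) :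
    fieldDeriv X (f + g) x = fieldDeriv X f x + fieldDeriv X g x :=
  congrArg (fun A => A (X x)) (mfderiv_add hf hg)

theorem fieldDeriv_sub {f g : N → W} (hf : MDifferentiableAt 𝓘(ℝ, E) 𝓘(ℝ, W) f x)
    (hg : MDifferentiableAt 𝓘(ℝ, E) 𝓘(ℝ, W) g x) :
    fieldDeriv X (f - g) x = fieldDeriv X f x - fieldDeriv X g x :=
  congrArg (fun A => A (X x)) (mfderiv_sub hf hg)

theorem fieldDeriv_neg (f : N → W) : fieldDeriv X (-f) x = -fieldDeriv X f x :=
  congrArg (fun A : TangentSpace 𝓘(ℝ, E) x →L[ℝ] W => A (X x)) mfderiv_neg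

theorem fieldDeriv_add_left (f : N → W) :
    fieldDeriv (X + Y) f x = fieldDeriv X f x + fieldDeriv Y f x :=
  map_add (mfderiv 𝓘(ℝ, E) 𝓘(ℝ, W) f x) _ _

theorem fieldDeriv_sub_left (f : N → W) :
    fieldDeriv (X - Y) f x = fieldDeriv X f x - fieldDeriv Y f x :=
  map_sub (mfderiv 𝓘(ℝ, E) 𝓘(ℝ, W) f x) _ _

theorem fieldDeriv_smul_left (c : ℝ) (f : N → W) :
    fieldDeriv (c • X) f x = c • fieldDeriv X f x :=
  map_smul (mfderiv 𝓘(ℝ, E) 𝓘(ℝ, W) f x) _ _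

theorem fieldDeriv_congr_left (f : N → W) (h : X x = Y x) :
    fieldDeriv X f x = fieldDeriv Y f x := by
  rw [fieldDeriv, h, fieldDeriv]

theorem fieldDeriv_comp {E' N' : Type*} [NormedAddCommGroup E'] [NormedSpace ℝ E']
    [TopologicalSpace N'] [ChartedSpace E' N'] {f : N → N'} {h : N' → W} {X' : VField E' N'}
    (hh : MDifferentiableAt 𝓘(ℝ, E') 𝓘(ℝ, W) h (f x))
    (hf : MDifferentiableAt 𝓘(ℝ, E) 𝓘(ℝ, E') f x)
    (hX : mfderiv 𝓘(ℝ, E) 𝓘(ℝ, E') f x (X x) = X' (f x)) :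
    fieldDeriv X (h ∘ f) x = fieldDeriv X' h (f x) := by
  rw [fieldDeriv, mfderiv_comp x hh hf, fieldDeriv, ← hX]
  rfl

end

theorem IsSmoothField.contMDiff_fieldDeriv {f : N → W} (hX : IsSmoothField X)
    (hf : ContMDiff 𝓘(ℝ, E) 𝓘(ℝ, W) ∞ f) :
    ContMDiff 𝓘(ℝ, E) 𝓘(ℝ, W) ∞ (fieldDeriv X f) :=
  (contMDiff_snd_tangentBundle_modelSpace W 𝓘(ℝ, W)).comp
    ((hf.contMDiff_tangentMap (m := ∞) (by simp)).comp hX)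

/-- Evaluating a smooth one-form on a smooth field gives a smooth function. -/
theorem IsSmoothField.contMDiff_apply {α : ∀ x : N, TangentSpace 𝓘(ℝ, E) x →L[ℝ] W}
    (hα : ContMDiff 𝓘(ℝ, E).tangent 𝓘(ℝ, W) ∞ (fun z : TangentBundle 𝓘(ℝ, E) N => α z.1 z.2))
    (hX : IsSmoothField X) : ContMDiff 𝓘(ℝ, E) 𝓘(ℝ, W) ∞ (fun x => α x (X x)) :=
  ContMDiff.comp hα hX

/-- Smooth vector fields take arbitrary values at a point. -/
theorem exists_isSmoothField [FiniteDimensional ℝ E] [T2Space N] (x : N)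
    (u : TangentSpace 𝓘(ℝ, E) x) : ∃ X : VField E N, IsSmoothField X ∧ X x = u := by
  obtain ⟨s, hs, hsm⟩ := FiberBundle.exists_contMDiffOn_extend 𝓘(ℝ, E) E
    (V := (TangentSpace 𝓘(ℝ, E) : N → Type _)) (k := ∞) u
  obtain ⟨f, -, hf⟩ := (SmoothBumpFunction.nhds_basis_tsupport (I := 𝓘(ℝ, E)) x).mem_iff.1
    (interior_mem_nhds.2 hs)
  refine ⟨(f : N → ℝ) • FiberBundle.extend E u, ?_, ?_⟩
  · exact ContMDiffOn.smul_section_of_tsupport f.contMDiff.contMDiffOn isOpen_interior hf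
      (hsm.mono interior_subset)
  · change f x • FiberBundle.extend E u x = u
    rw [f.eq_one, FiberBundle.extend_apply_self, one_smul]

/-- Replacing `Y` by `fY` adds the same term `(Xf) α(Y)` to both sides, so their difference, minus
the Lie derivative `(𝓛_X α)(Y)`, is tensorial in `Y` and vanishes where `Y` does. -/
theorem form_mlieBracket_of_eq_zero [FiniteDimensional ℝ E]
    {α : ∀ x : N, TangentSpace 𝓘(ℝ, E) x →L[ℝ] W}
    (hα : ContMDiff 𝓘(ℝ, E).tangent 𝓘(ℝ, W) ∞ (fun z : TangentBundle 𝓘(ℝ, E) N => α z.1 z.2))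
    (hY : IsSmoothField Y) {x : N} (h0 : Y x = 0) :
    α x (mlieBracket 𝓘(ℝ, E) X Y x) = fieldDeriv X (fun y => α y (Y y)) x := by
  have hd : ∀ {Z : VField E N}, MDifferentiableAt 𝓘(ℝ, E) 𝓘(ℝ, E).tangent
      (fun y => (⟨y, Z y⟩ : TangentBundle 𝓘(ℝ, E) N)) x →
      MDifferentiableAt 𝓘(ℝ, E) 𝓘(ℝ, W) (fun y => α y (Z y)) x := fun {Z} hZ =>
    MDifferentiableAt.comp (g := fun z : TangentBundle 𝓘(ℝ, E) N => α z.1 z.2) x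
      ((hα _).mdifferentiableAt (by simp)) hZ
  have ht : TensorialAt 𝓘(ℝ, E) E (V := (TangentSpace 𝓘(ℝ, E) : N → Type _))
      (fun Z : VField E N => α x (mlieBracket 𝓘(ℝ, E) X Z x) -
        fieldDeriv X (fun y => α y (Z y)) x) x := by
    constructor
    · intro f Z hf hZ
      rw [mlieBracket_smul_right hf hZ]
      have h1 : (fun y => α y ((f • Z) y)) =
          fun y => ContinuousLinearMap.lsmul ℝ ℝ (f y) (α y (Z y)) := by
        funext y; simp
      rw [h1, fieldDeriv_bilin _ hf (hd hZ), map_add, map_smul, map_smul]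
      simp only [ContinuousLinearMap.lsmul_apply, smul_sub]
      change fieldDeriv X f x • _ + _ - _ = _
      abel
    · intro Z Z' hZ hZ'
      rw [mlieBracket_add_right hZ hZ']
      have h1 : (fun y => α y ((Z + Z') y)) = (fun y => α y (Z y)) + fun y => α y (Z' y) := by
        funext y; simp
      rw [h1, map_add, fieldDeriv_add (hd hZ) (hd hZ')]
      abel
  have h := ht.pointwise (σ := Y) (σ' := 0) (hY.mdifferentiableAt x)
    (isSmoothField_zero.mdifferentiableAt x) h0
  rw [ht.zero] at h
  exact sub_eq_zero.1 h

/-- The map `f` need not be a local diffeomorphism: it will be the bundle projection or a right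
translation. Both sides are tested on the chart `h` at `f x`, whose differential is injective:
brackets act as commutators, and relatedness gives `Z(h ∘ f) = (Z'h) ∘ f` near `x`. -/
theorem mfderiv_mlieBracket_of_related {E' N' : Type*} [NormedAddCommGroup E'] [NormedSpace ℝ E']
    [TopologicalSpace N'] [ChartedSpace E' N'] [IsManifold 𝓘(ℝ, E') ∞ N']
    [CompleteSpace E] [CompleteSpace E'] {f : N → N'} {X' Y' : VField E' N'}
    (hf : ContMDiff 𝓘(ℝ, E) 𝓘(ℝ, E') ∞ f)
    (hX : IsSmoothField X) (hY : IsSmoothField Y) (hX' : IsSmoothField X')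
    (hY' : IsSmoothField Y')
    (hXX' : ∀ x, mfderiv 𝓘(ℝ, E) 𝓘(ℝ, E') f x (X x) = X' (f x))
    (hYY' : ∀ x, mfderiv 𝓘(ℝ, E) 𝓘(ℝ, E') f x (Y x) = Y' (f x)) (x : N) :
    mfderiv 𝓘(ℝ, E) 𝓘(ℝ, E') f x (mlieBracket 𝓘(ℝ, E) X Y x) =
      mlieBracket 𝓘(ℝ, E') X' Y' (f x) := by
  let h : N' → E' := ⇑(extChartAt 𝓘(ℝ, E') (f x))
  have hhs : ContMDiffAt 𝓘(ℝ, E') 𝓘(ℝ, E') ∞ h (f x) := contMDiffAt_extChartAt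
  have hinj : Function.Injective (mfderiv 𝓘(ℝ, E') 𝓘(ℝ, E') h (f x)) :=
    (isInvertible_mfderiv_extChartAt (mem_extChartAt_source (f x))).injective
  have hfd : ∀ y, MDifferentiableAt 𝓘(ℝ, E) 𝓘(ℝ, E') f y := fun y =>
    (hf y).mdifferentiableAt (by simp)
  have hhe : ∀ᶠ y in 𝓝 x, ContMDiffAt 𝓘(ℝ, E') 𝓘(ℝ, E') 1 h (f y) :=
    hf.continuous.continuousAt.eventually
      ((contMDiffAt_iff_contMDiffAt_nhds (by simp)).1 (hhs.of_le (by simp)))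
  have hcomp : ∀ {Z : VField E N} {Z' : VField E' N'},
      (∀ x, mfderiv 𝓘(ℝ, E) 𝓘(ℝ, E') f x (Z x) = Z' (f x)) →
      fieldDeriv Z (h ∘ f) =ᶠ[𝓝 x] fieldDeriv Z' h ∘ f := by
    intro Z Z' hZ
    filter_upwards [hhe] with y hy
    exact fieldDeriv_comp (hy.mdifferentiableAt one_ne_zero) (hfd y) (hZ y)
  have two_le : (2 : ℕ∞ω) ≤ ∞ := ENat.LEInfty.out
  have hcomp2 : ∀ {Z Z₂ : VField E N} {Z' Z₂' : VField E' N'}, IsSmoothField Z₂' →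
      (∀ x, mfderiv 𝓘(ℝ, E) 𝓘(ℝ, E') f x (Z x) = Z' (f x)) →
      (∀ x, mfderiv 𝓘(ℝ, E) 𝓘(ℝ, E') f x (Z₂ x) = Z₂' (f x)) →
      fieldDeriv Z (fieldDeriv Z₂ (h ∘ f)) x = fieldDeriv Z' (fieldDeriv Z₂' h) (f x) := by
    intro Z Z₂ Z' Z₂' hs hZ hZ₂
    rw [fieldDeriv, (hcomp hZ₂).mfderiv_eq]
    exact fieldDeriv_comp (mdifferentiableAt_fieldDeriv (hhs.of_le two_le)
      (hs.mdifferentiableAt _)) (hfd x) (hZ x)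
  apply hinj
  have h1 := fieldDeriv_mlieBracket (f := h ∘ f) ((hhs.comp x (hf x)).of_le two_le)
    (hX.mdifferentiableAt x) (hY.mdifferentiableAt x)
  have h2 := fieldDeriv_mlieBracket (f := h) (hhs.of_le two_le)
    (hX'.mdifferentiableAt (f x)) (hY'.mdifferentiableAt (f x))
  rw [hcomp2 hY' hXX' hYY', hcomp2 hX' hYY' hXX', ← h2, fieldDeriv,
    mfderiv_comp x (hhs.mdifferentiableAt (by simp)) (hfd x)] at h1
  exact h1

end Manifold

/-- A linear projection `L` onto `S` satisfies `L ∘ f = f`, so the derivative equals its own image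
under `L`. -/
theorem mfderiv_mem_of_forall_mem {E N W : Type*} [NormedAddCommGroup E] [NormedSpace ℝ E]
    [TopologicalSpace N] [ChartedSpace E N] [NormedAddCommGroup W] [NormedSpace ℝ W]
    [FiniteDimensional ℝ W] (S : Submodule ℝ W) {f : N → W} {x : N}
    (hf : MDifferentiableAt 𝓘(ℝ, E) 𝓘(ℝ, W) f x) (hS : ∀ y, f y ∈ S)
    (u : TangentSpace 𝓘(ℝ, E) x) : (mfderiv 𝓘(ℝ, E) 𝓘(ℝ, W) f x u : W) ∈ S := by
  obtain ⟨q, hq⟩ := S.exists_isCompl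
  let L : W →L[ℝ] W := LinearMap.toContinuousLinearMap (S.subtype ∘ₗ S.projectionOnto q hq)
  have hL : ∀ w, L w ∈ S := fun w => (S.projectionOnto q hq w).2
  have hLS : ∀ w ∈ S, L w = w := fun w hw => by
    change ((S.projectionOnto q hq w : S) : W) = w
    exact congrArg _ (Submodule.projectionOnto_apply_left hq ⟨w, hw⟩)
  have h := mfderiv_clm_apply L hf u
  have h2 : (fun y => L (f y)) = f := funext fun y => hLS _ (hS y)
  rw [h2] at h
  have hmem : ∀ w w' : W, w = L w' → w ∈ S := fun w w' hw => hw ▸ hL w'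
  exact hmem _ _ h

/-- All tangent spaces are copies of the model space, so a vector can be moved between points that
are equal but not definitionally so, such as `op 1 • p` and `p`, without a cast. -/
theorem mfderiv_apply_congr {E H N E' H' N' : Type*} [NormedAddCommGroup E] [NormedSpace ℝ E]
    [TopologicalSpace H] {I : ModelWithCorners ℝ E H} [TopologicalSpace N] [ChartedSpace H N]
    [NormedAddCommGroup E'] [NormedSpace ℝ E'] [TopologicalSpace H'] {I' : ModelWithCorners ℝ E' H'}
    [TopologicalSpace N'] [ChartedSpace H' N'] (f : N → N') {x y : N} (h : x = y) (u : E) :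
    (mfderiv I I' f x u : E') = mfderiv I I' f y u := by
  subst h; rfl

/-! ### The representation, its differential and the image of the Lie algebra -/

section Representation

variable {EG G V : Type*} [NormedAddCommGroup EG] [NormedSpace ℝ EG]
  [TopologicalSpace G] [ChartedSpace EG G] [Group G]
  [NormedAddCommGroup V] [InnerProductSpace ℂ V] {T : G →* (V ≃ₗᵢ[ℂ] V)}

theorem repOp_one (T : G →* (V ≃ₗᵢ[ℂ] V)) : repOp T 1 = 1 := by
  ext v; simp [repOp]

theorem repOp_mul (T : G →* (V ≃ₗᵢ[ℂ] V)) (g h : G) :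
    repOp T (g * h) = repOp T g * repOp T h := by
  ext v; simp [repOp]

theorem repOp_inv_mul (T : G →* (V ≃ₗᵢ[ℂ] V)) (g : G) : repOp T g⁻¹ * repOp T g = 1 := by
  rw [← repOp_mul, inv_mul_cancel, repOp_one]

theorem repOp_mul_inv (T : G →* (V ≃ₗᵢ[ℂ] V)) (g : G) : repOp T g * repOp T g⁻¹ = 1 := by
  rw [← repOp_mul, mul_inv_cancel, repOp_one]

theorem repOp_injective (hT : Function.Injective T) : Function.Injective (repOp T) := by
  intro g h hgh
  apply hT
  ext v
  exact congrArg (fun A => A v) hgh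

variable [LieGroup 𝓘(ℝ, EG) ∞ G]

theorem mdifferentiableAt_repOp (hT : ContMDiff 𝓘(ℝ, EG) 𝓘(ℝ, V →L[ℂ] V) ∞ (repOp T)) (g : G) :
    MDifferentiableAt 𝓘(ℝ, EG) 𝓘(ℝ, V →L[ℂ] V) (repOp T) g :=
  (hT g).mdifferentiableAt (by simp)

theorem mfderiv_repOp_mulInvariantVectorField
    (hT : ContMDiff 𝓘(ℝ, EG) 𝓘(ℝ, V →L[ℂ] V) ∞ (repOp T)) (x : GroupLieAlgebra 𝓘(ℝ, EG) G)
    (g : G) : mfderiv 𝓘(ℝ, EG) 𝓘(ℝ, V →L[ℂ] V) (repOp T) g (mulInvariantVectorField x g) =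
      repOp T g * dRep EG T x := by
  have hm : MDifferentiableAt 𝓘(ℝ, EG) 𝓘(ℝ, EG) (fun h : G => g * h) 1 :=
    (contMDiff_mul_left (n := ∞)).mdifferentiable (by simp) _
  have h1 := mfderiv_comp 1 (mdifferentiableAt_repOp hT (g * 1)) hm
  have h2 : repOp T ∘ (fun h : G => g * h) =
      fun h => ContinuousLinearMap.mul ℝ (V →L[ℂ] V) (repOp T g) (repOp T h) := by
    funext h; exact repOp_mul T g h
  have h3 := mfderiv_clm_apply (ContinuousLinearMap.mul ℝ (V →L[ℂ] V) (repOp T g))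
    (mdifferentiableAt_repOp hT 1) x
  rw [← h2, h1] at h3
  refine Eq.trans ?_ h3
  exact mfderiv_apply_congr _ (mul_one g).symm _

/-- If `DT(e)x = 0`, then `T` is constant along an integral curve `γ` of the left-invariant field of
`x`, because `(T ∘ γ)' = T(γ) DT(e)x = 0`. Faithfulness makes `γ` itself constant, so its initial
velocity `x` is zero. A curve on a small interval suffices, and no exponential map is needed. -/
theorem dRep_injective [FiniteDimensional ℝ EG]
    (hT : ContMDiff 𝓘(ℝ, EG) 𝓘(ℝ, V →L[ℂ] V) ∞ (repOp T)) (hinj : Function.Injective T) :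
    Function.Injective (dRep EG T) := by
  rw [injective_iff_map_eq_zero]
  intro x hx
  have : LieGroup 𝓘(ℝ, EG) (minSmoothness ℝ 3) G := by
    simpa using LieGroup.of_le (I := 𝓘(ℝ, EG)) (G := G) (m := 3) (n := ∞) ENat.LEInfty.out
  have hv := contMDiffAt_mulInvariantVectorField (I := 𝓘(ℝ, EG)) (G := G) x (g := 1)
  obtain ⟨γ, hγ0, hγ⟩ := exists_isMIntegralCurveAt_of_contMDiffAt_boundaryless (0 : ℝ)
    (hv.of_le (by simp))
  obtain ⟨ε, hε, hball⟩ := Metric.eventually_nhds_iff_ball.1 hγ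
  have hderiv : ∀ t ∈ Metric.ball (0 : ℝ) ε, HasFDerivAt (fun t => repOp T (γ t))
      (0 : ℝ →L[ℝ] (V →L[ℂ] V)) t := by
    intro t ht
    have h := ((mdifferentiableAt_repOp hT (γ t)).hasMFDerivAt.comp t (hball t ht)).hasFDerivAt
    refine h.congr_fderiv ?_
    ext1
    refine (congrArg (mfderiv 𝓘(ℝ, EG) 𝓘(ℝ, V →L[ℂ] V) (repOp T) (γ t))
      (one_smul ℝ (mulInvariantVectorField x (γ t)))).trans ?_
    rw [mfderiv_repOp_mulInvariantVectorField hT, hx, mul_zero]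
    rfl
  have hconst : ∀ t ∈ Metric.ball (0 : ℝ) ε, γ t = 1 := by
    intro t ht
    apply repOp_injective hinj
    have := (convex_ball (0 : ℝ) ε).is_const_of_fderivWithin_eq_zero (𝕜 := ℝ)
      (f := fun t => repOp T (γ t))
      (fun t ht => (hderiv t ht).differentiableAt.differentiableWithinAt) (fun t ht => by
        rw [fderivWithin_of_isOpen Metric.isOpen_ball ht, (hderiv t ht).fderiv]) ht (Metric.mem_ball_self hε)
    simpa [hγ0] using this
  have hev : γ =ᶠ[𝓝 0] fun _ => (1 : G) :=
    Filter.mem_of_superset (Metric.ball_mem_nhds 0 hε) hconst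
  have h0 := hball 0 (Metric.mem_ball_self hε)
  have h1 := h0.mfderiv
  rw [hev.mfderiv_eq, mfderiv_const] at h1
  have h2 : (0 : EG) = (1 : ℝ) • mulInvariantVectorField x (γ 0) :=
    congrArg (fun A => A (1 : ℝ)) h1
  have h3 : mulInvariantVectorField (I := 𝓘(ℝ, EG)) x (1 : G) = x := by
    have h4 : (fun h : G => 1 * h) = id := funext one_mul
    unfold mulInvariantVectorField
    rw [h4]
    exact congrArg (fun A => A x) (mfderiv_id (I := 𝓘(ℝ, EG)) (x := (1 : G)))
  rw [hγ0, one_smul, h3] at h2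
  exact h2.symm

/-- Recovers the Lie algebra element behind a value of `θ` by a continuous linear map defined on all
of `𝓑(V)`; this is what makes the horizontal projection visibly smooth. -/
theorem exists_dRep_leftInverse [FiniteDimensional ℝ EG] [FiniteDimensional ℂ V]
    (hT : ContMDiff 𝓘(ℝ, EG) 𝓘(ℝ, V →L[ℂ] V) ∞ (repOp T)) (hinj : Function.Injective T) :
    ∃ S : (V →L[ℂ] V) →L[ℝ] EG, ∀ x : TangentSpace 𝓘(ℝ, EG) (1 : G), S (dRep EG T x) = x := by
  let D : EG →L[ℝ] (V →L[ℂ] V) := dRep EG T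
  obtain ⟨S, hS⟩ := LinearMap.exists_leftInverse_of_injective
    (D : EG →ₗ[ℝ] (V →L[ℂ] V)) (LinearMap.ker_eq_bot.2 (dRep_injective hT hinj))
  exact ⟨LinearMap.toContinuousLinearMap S, fun x => congrArg (fun A => A x) hS⟩

theorem mdifferentiableAt_repOp_inv (hT : ContMDiff 𝓘(ℝ, EG) 𝓘(ℝ, V →L[ℂ] V) ∞ (repOp T))
    (g : G) : MDifferentiableAt 𝓘(ℝ, EG) 𝓘(ℝ, V →L[ℂ] V) (fun g => repOp T g⁻¹) g :=
  ((hT.comp (contMDiff_inv 𝓘(ℝ, EG) ∞)) g).mdifferentiableAt (by simp)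

/-- Differentiate `T(g⁻¹) T(g) = 1` at the identity. -/
theorem mfderiv_repOp_inv (hT : ContMDiff 𝓘(ℝ, EG) 𝓘(ℝ, V →L[ℂ] V) ∞ (repOp T))
    (x : TangentSpace 𝓘(ℝ, EG) (1 : G)) :
    mfderiv 𝓘(ℝ, EG) 𝓘(ℝ, V →L[ℂ] V) (fun g => repOp T g⁻¹) 1 x = -dRep EG T x := by
  have h := mfderiv_bilin_apply (ContinuousLinearMap.mul ℝ (V →L[ℂ] V))
    (mdifferentiableAt_repOp_inv hT 1) (mdifferentiableAt_repOp hT 1) x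
  have h1 : (fun g => ContinuousLinearMap.mul ℝ (V →L[ℂ] V) (repOp T g⁻¹) (repOp T g)) =
      fun _ : G => 1 := funext fun g => repOp_inv_mul T g
  rw [h1] at h
  simp only [mfderiv_const, inv_one, repOp_one] at h
  change 0 = _ * 1 + 1 * dRep EG T x at h
  have key : ∀ a b : V →L[ℂ] V, 0 = a * 1 + 1 * b → a = -b := fun a b hab => by
    rw [mul_one, one_mul] at hab
    exact eq_neg_of_add_eq_zero_left hab.symm
  exact key _ _ h

theorem mfderiv_repOp_inv_apply (hT : ContMDiff 𝓘(ℝ, EG) 𝓘(ℝ, V →L[ℂ] V) ∞ (repOp T))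
    (x : TangentSpace 𝓘(ℝ, EG) (1 : G)) (v : V) :
    mfderiv 𝓘(ℝ, EG) 𝓘(ℝ, V) (fun g => repOp T g⁻¹ v) 1 x = -(dRep EG T x) v := by
  let L : (V →L[ℂ] V) →L[ℝ] V := (ContinuousLinearMap.apply ℂ V v).restrictScalars ℝ
  refine (mfderiv_clm_apply L (mdifferentiableAt_repOp_inv hT 1) x).trans ?_
  rw [mfderiv_repOp_inv hT x]
  rfl

theorem mdifferentiableAt_repOp_conj (hT : ContMDiff 𝓘(ℝ, EG) 𝓘(ℝ, V →L[ℂ] V) ∞ (repOp T))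
    (A : V →L[ℂ] V) (g : G) :
    MDifferentiableAt 𝓘(ℝ, EG) 𝓘(ℝ, V →L[ℂ] V) (fun g => repOp T g⁻¹ * A * repOp T g) g :=
  (MDifferentiableAt.mul (mdifferentiableAt_repOp_inv hT g) mdifferentiableAt_const).mul
    (mdifferentiableAt_repOp hT g)

theorem mfderiv_repOp_conj (hT : ContMDiff 𝓘(ℝ, EG) 𝓘(ℝ, V →L[ℂ] V) ∞ (repOp T))
    (x : TangentSpace 𝓘(ℝ, EG) (1 : G)) (A : V →L[ℂ] V) :
    mfderiv 𝓘(ℝ, EG) 𝓘(ℝ, V →L[ℂ] V) (fun g => repOp T g⁻¹ * A * repOp T g) 1 x =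
      -⁅dRep EG T x, A⁆ := by
  have h1 := mfderiv_clm_apply ((ContinuousLinearMap.mul ℝ (V →L[ℂ] V)).flip A)
    (mdifferentiableAt_repOp_inv hT 1) x
  have h := mfderiv_bilin_apply (ContinuousLinearMap.mul ℝ (V →L[ℂ] V))
    (MDifferentiableAt.mul (mdifferentiableAt_repOp_inv hT 1) (mdifferentiableAt_const (c := A)))
    (mdifferentiableAt_repOp hT 1) x
  refine h.trans ?_
  have h2 : mfderiv 𝓘(ℝ, EG) 𝓘(ℝ, V →L[ℂ] V) ((fun g : G => repOp T g⁻¹) * fun _ => A) 1 x =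
      -dRep EG T x * A := by
    refine h1.trans ?_
    rw [mfderiv_repOp_inv hT x]
    rfl
  rw [h2]
  simp only [Pi.mul_apply, ContinuousLinearMap.mul_apply', inv_one, repOp_one,
    mul_one, one_mul]
  change -dRep EG T x * A + A * dRep EG T x = _
  rw [Ring.lie_def]
  noncomm_ring

/-- The preimage of the conjugated operator is `Ad(g⁻¹)x`, the derivative of `h ↦ g⁻¹hg` at the
identity. -/
theorem conj_mem_repLie (hT : ContMDiff 𝓘(ℝ, EG) 𝓘(ℝ, V →L[ℂ] V) ∞ (repOp T)) (g : G)
    {A : V →L[ℂ] V} (hA : A ∈ repLie EG T) : repOp T g⁻¹ * A * repOp T g ∈ repLie EG T := by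
  obtain ⟨x, rfl⟩ := hA
  have hc : MDifferentiableAt 𝓘(ℝ, EG) 𝓘(ℝ, EG) (fun h : G => g⁻¹ * h * g) 1 :=
    (((contMDiff_mul_right (a := g) (n := ∞)).comp (contMDiff_mul_left (a := g⁻¹)
      (n := ∞))) 1).mdifferentiableAt (by simp)
  refine ⟨mfderiv 𝓘(ℝ, EG) 𝓘(ℝ, EG) (fun h : G => g⁻¹ * h * g) 1 x, ?_⟩
  have h1 := mfderiv_comp 1 (mdifferentiableAt_repOp hT _) hc
  have h2 : repOp T ∘ (fun h : G => g⁻¹ * h * g) = fun h =>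
      ContinuousLinearMap.mulLeftRight ℝ (V →L[ℂ] V) (repOp T g⁻¹) (repOp T g) (repOp T h) := by
    funext h
    simp [repOp_mul]
  have h3 := mfderiv_clm_apply
    (ContinuousLinearMap.mulLeftRight ℝ (V →L[ℂ] V) (repOp T g⁻¹) (repOp T g))
    (mdifferentiableAt_repOp hT 1) x
  rw [← h2, h1, ContinuousLinearMap.mulLeftRight_apply] at h3
  refine Eq.trans ?_ h3
  exact mfderiv_apply_congr _ (by simp) _

/-- The map `g ↦ T(g⁻¹) C T(g)` stays in the subspace, hence so does its derivative `-[DT(e)x, C]`;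
the Lie bracket of the Lie algebra itself never enters. -/
theorem lie_mem_repLie [FiniteDimensional ℂ V]
    (hT : ContMDiff 𝓘(ℝ, EG) 𝓘(ℝ, V →L[ℂ] V) ∞ (repOp T))
    {A C : V →L[ℂ] V} (hA : A ∈ repLie EG T) (hC : C ∈ repLie EG T) : ⁅A, C⁆ ∈ repLie EG T := by
  obtain ⟨x, rfl⟩ := hA
  have h := mfderiv_mem_of_forall_mem (repLie EG T)
    (f := fun g => repOp T g⁻¹ * C * repOp T g) (x := (1 : G)) (mdifferentiableAt_repOp_conj hT C 1)
    (fun g => conj_mem_repLie hT g hC) x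
  rw [mfderiv_repOp_conj hT] at h
  simpa using (repLie EG T).neg_mem h

end Representation

/-! ### Local sections, fundamental vectors and local lifts -/

section Bundle

variable {EP EM EG P M G V : Type*}
  [NormedAddCommGroup EP] [NormedSpace ℝ EP] [NormedAddCommGroup EM] [NormedSpace ℝ EM]
  [NormedAddCommGroup EG] [NormedSpace ℝ EG]
  [TopologicalSpace P] [ChartedSpace EP P] [TopologicalSpace M] [ChartedSpace EM M]
  [TopologicalSpace G] [ChartedSpace EG G] [Group G] [MulAction Gᵐᵒᵖ P]
  [NormedAddCommGroup V] [InnerProductSpace ℂ V]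
  [IsManifold 𝓘(ℝ, EP) ∞ P] [IsManifold 𝓘(ℝ, EM) ∞ M] [LieGroup 𝓘(ℝ, EG) ∞ G]
  {B : PrincipalBundle EP EM EG P M G}

/-- A smooth local section `σ` of a principal bundle over `U`, normalized by `σ (π p) = p`,
with the resulting smooth map `γ : π⁻¹ U → G` such that `q = σ(π(q)) · γ(q)`. -/
structure IsLocalSection (B : PrincipalBundle EP EM EG P M G) (p : P) (U : Set M) (σ : M → P)
    (γ : P → G) : Prop where
  isOpen : IsOpen U
  mem : B.proj p ∈ U
  smooth_section : ContMDiffOn 𝓘(ℝ, EM) 𝓘(ℝ, EP) ∞ σ U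
  smooth_group : ContMDiffOn 𝓘(ℝ, EP) 𝓘(ℝ, EG) ∞ γ (B.proj ⁻¹' U)
  proj_section : ∀ x ∈ U, B.proj (σ x) = x
  act_section : ∀ q, B.proj q ∈ U → op (γ q) • σ (B.proj q) = q
  group_act : ∀ q g, B.proj q ∈ U → γ (op g • q) = γ q * g
  section_proj : σ (B.proj p) = p
  group_eq_one : γ p = 1

namespace PrincipalBundle

theorem contMDiff_proj (B : PrincipalBundle EP EM EG P M G) :
    ContMDiff 𝓘(ℝ, EP) 𝓘(ℝ, EM) ∞ B.proj := by
  intro p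
  obtain ⟨U, φ, hU, hm, hs, ht, hφ, -, h⟩ := B.locallyTrivial (B.proj p)
  have hp : p ∈ φ.source := by rw [hs]; exact hm
  have h1 : ContMDiffAt 𝓘(ℝ, EP) 𝓘(ℝ, EM) ∞ (fun q => (φ q).1) p :=
    contMDiffAt_fst.comp p ((hφ p hp).contMDiffAt (φ.open_source.mem_nhds hp))
  refine h1.congr_of_eventuallyEq ?_
  filter_upwards [φ.open_source.mem_nhds hp] with q hq
  exact (h q hq).1.symm

theorem mdifferentiableAt_proj (B : PrincipalBundle EP EM EG P M G) (p : P) :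
    MDifferentiableAt 𝓘(ℝ, EP) 𝓘(ℝ, EM) B.proj p :=
  (B.contMDiff_proj p).mdifferentiableAt (by simp)

theorem contMDiff_rightTranslation (B : PrincipalBundle EP EM EG P M G) (g : G) :
    ContMDiff 𝓘(ℝ, EP) 𝓘(ℝ, EP) ∞ (fun p : P => op g • p) :=
  B.contMDiff_act.comp (contMDiff_id.prodMk contMDiff_const)

theorem contMDiff_orbitMap (B : PrincipalBundle EP EM EG P M G) (p : P) :
    ContMDiff 𝓘(ℝ, EG) 𝓘(ℝ, EP) ∞ (fun g : G => op g • p) :=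
  B.contMDiff_act.comp (contMDiff_const.prodMk contMDiff_id)

theorem exists_isLocalSection (B : PrincipalBundle EP EM EG P M G) (p : P) :
    ∃ U σ γ, IsLocalSection B p U σ γ := by
  obtain ⟨U, φ, hU, hm, hs, ht, hφ, hφs, h⟩ := B.locallyTrivial (B.proj p)
  have hsrc : ∀ {q}, B.proj q ∈ U → q ∈ φ.source := fun {q} hq => by rw [hs]; exact hq
  have htgt : ∀ {x} (g : G), x ∈ U → (x, g) ∈ φ.target := fun g hx => by
    rw [ht]; exact ⟨hx, trivial⟩
  have hproj : ∀ {x} (g : G), x ∈ U → B.proj (φ.symm (x, g)) = x := fun g hx => by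
    rw [← (h _ (φ.map_target (htgt g hx))).1, φ.right_inv (htgt g hx)]
  -- The section through `p` has constant group coordinate `a`, that of `p`; this gives the
  -- normalizations `σ(π p) = p` and `γ p = 1`.
  set a := (φ p).2 with ha
  have hact : ∀ q, B.proj q ∈ U → op (a⁻¹ * (φ q).2) • φ.symm (B.proj q, a) = q := by
    intro q hq
    have h1 : φ.symm (B.proj q, a) ∈ φ.source := φ.map_target (htgt a hq)
    have h2 : op (a⁻¹ * (φ q).2) • φ.symm (B.proj q, a) ∈ φ.source :=
      hsrc (by rw [B.proj_act, hproj a hq]; exact hq)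
    apply φ.injOn h2 (hsrc hq)
    refine Prod.ext ?_ ?_
    · rw [(h _ h2).1, (h _ (hsrc hq)).1, B.proj_act, hproj a hq]
    · rw [(h _ h1).2, φ.right_inv (htgt a hq)]
      group
  refine ⟨U, fun x => φ.symm (x, a), fun q => a⁻¹ * (φ q).2, hU, hm, ?_, ?_,
    fun x hx => hproj a hx, hact, ?_, ?_, ?_⟩
  · exact hφs.comp (contMDiff_id.prodMk contMDiff_const).contMDiffOn (fun x hx => htgt a hx)
  · rw [hs] at hφ
    exact (contMDiff_mul_left (a := a⁻¹)).comp_contMDiffOn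
      (contMDiff_snd.comp_contMDiffOn hφ)
  · intro q g hq
    rw [(h q (hsrc hq)).2, mul_assoc]
  · have := hact p hm
    simpa [ha] using this
  · simp [ha]

end PrincipalBundle

namespace IsLocalSection

variable {p : P} {U : Set M} {σ : M → P} {γ : P → G} (h : IsLocalSection B p U σ γ)
include h

theorem isOpen_preimage : IsOpen (B.proj ⁻¹' U) := h.isOpen.preimage B.contMDiff_proj.continuous

theorem contMDiffAt_section {x : M} (hx : x ∈ U) : ContMDiffAt 𝓘(ℝ, EM) 𝓘(ℝ, EP) ∞ σ x :=
  (h.smooth_section x hx).contMDiffAt (h.isOpen.mem_nhds hx)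

theorem contMDiffAt_group {q : P} (hq : B.proj q ∈ U) : ContMDiffAt 𝓘(ℝ, EP) 𝓘(ℝ, EG) ∞ γ q :=
  (h.smooth_group q hq).contMDiffAt (h.isOpen_preimage.mem_nhds hq)

theorem mfderiv_proj_section {x : M} (hx : x ∈ U) (u : TangentSpace 𝓘(ℝ, EM) x) :
    mfderiv 𝓘(ℝ, EP) 𝓘(ℝ, EM) B.proj (σ x) (mfderiv 𝓘(ℝ, EM) 𝓘(ℝ, EP) σ x u) = u := by
  have hev : B.proj ∘ σ =ᶠ[𝓝 x] id := by
    filter_upwards [h.isOpen.mem_nhds hx] with y hy using h.proj_section y hy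
  have h1 := mfderiv_comp x (B.mdifferentiableAt_proj (σ x))
    ((h.contMDiffAt_section hx).mdifferentiableAt (by simp))
  rw [hev.mfderiv_eq, mfderiv_id] at h1
  exact (congrArg (fun A => A u) h1).symm

end IsLocalSection

/-- The value at `p` of the fundamental vector field generated by `x ∈ 𝔤`. -/
def fundVec (EP : Type*) {EG P G : Type*} [NormedAddCommGroup EP] [NormedSpace ℝ EP]
    [NormedAddCommGroup EG] [NormedSpace ℝ EG] [TopologicalSpace P] [ChartedSpace EP P]
    [TopologicalSpace G] [ChartedSpace EG G] [Group G] [MulAction Gᵐᵒᵖ P] (p : P)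
    (x : TangentSpace 𝓘(ℝ, EG) (1 : G)) : TangentSpace 𝓘(ℝ, EP) p :=
  (mfderiv 𝓘(ℝ, EG) 𝓘(ℝ, EP) (fun g : G => op g • p) 1 x : EP)

theorem mfderiv_act_apply (B : PrincipalBundle EP EM EG P M G) (p : P) (g : G) (u : EP) (x : EG) :
    (mfderiv (𝓘(ℝ, EP).prod 𝓘(ℝ, EG)) 𝓘(ℝ, EP) (fun q : P × G => op q.2 • q.1) (p, g)
      ((u, x) : EP × EG) : EP) =
    (mfderiv 𝓘(ℝ, EP) 𝓘(ℝ, EP) (fun q : P => op g • q) p u : EP) +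
      (mfderiv 𝓘(ℝ, EG) 𝓘(ℝ, EP) (fun h : G => op h • p) g x : EP) :=
  mfderiv_prod_eq_add_apply ((B.contMDiff_act (p, g)).mdifferentiableAt (by simp))

theorem mfderiv_proj_rightTranslation (B : PrincipalBundle EP EM EG P M G) (p : P) (g : G)
    (u : TangentSpace 𝓘(ℝ, EP) p) :
    (mfderiv 𝓘(ℝ, EP) 𝓘(ℝ, EM) B.proj (op g • p)
      (mfderiv 𝓘(ℝ, EP) 𝓘(ℝ, EP) (fun q : P => op g • q) p u) : EM) =
    mfderiv 𝓘(ℝ, EP) 𝓘(ℝ, EM) B.proj p u := by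
  have h1 := mfderiv_comp p (B.mdifferentiableAt_proj (op g • p))
    ((B.contMDiff_rightTranslation g p).mdifferentiableAt (by simp))
  have h2 : B.proj ∘ (fun q : P => op g • q) = B.proj := funext fun q => B.proj_act q g
  rw [h2] at h1
  exact (congrArg (fun A => A u) h1).symm

theorem mfderiv_proj_fundVec (B : PrincipalBundle EP EM EG P M G) (p : P)
    (x : TangentSpace 𝓘(ℝ, EG) (1 : G)) :
    mfderiv 𝓘(ℝ, EP) 𝓘(ℝ, EM) B.proj p (fundVec EP p x) = 0 := by
  have h1 := mfderiv_comp 1 (B.mdifferentiableAt_proj (op (1 : G) • p))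
    ((B.contMDiff_orbitMap p 1).mdifferentiableAt (by simp))
  have h2 : B.proj ∘ (fun g : G => op g • p) = fun _ => B.proj p :=
    funext fun g => B.proj_act p g
  rw [h2, mfderiv_const] at h1
  exact (mfderiv_apply_congr B.proj (show p = op (1 : G) • p by simp) _).trans (congrArg (fun A => A x) h1).symm

/-- Differentiate `q = σ(π(q)) · γ(q)` along `u`: the `σ` term dies because `u` is vertical, and
what is left is the fundamental vector of `dγ(u)`. -/
theorem exists_eq_fundVec (B : PrincipalBundle EP EM EG P M G) {p : P}
    {u : TangentSpace 𝓘(ℝ, EP) p} (hu : mfderiv 𝓘(ℝ, EP) 𝓘(ℝ, EM) B.proj p u = 0) :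
    ∃ x : TangentSpace 𝓘(ℝ, EG) (1 : G), u = fundVec EP p x := by
  obtain ⟨U, σ, γ, h⟩ := B.exists_isLocalSection p
  have hσ : MDifferentiableAt 𝓘(ℝ, EP) 𝓘(ℝ, EP) (σ ∘ B.proj) p :=
    ((h.contMDiffAt_section h.mem).mdifferentiableAt (by simp)).comp p (B.mdifferentiableAt_proj p)
  have hγ : MDifferentiableAt 𝓘(ℝ, EP) 𝓘(ℝ, EG) γ p :=
    (h.contMDiffAt_group h.mem).mdifferentiableAt (by simp)
  have hσu : mfderiv 𝓘(ℝ, EP) 𝓘(ℝ, EP) (σ ∘ B.proj) p u = 0 := by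
    rw [mfderiv_comp p ((h.contMDiffAt_section h.mem).mdifferentiableAt (by simp))
      (B.mdifferentiableAt_proj p)]
    exact (congrArg (mfderiv 𝓘(ℝ, EM) 𝓘(ℝ, EP) σ (B.proj p)) hu).trans (map_zero _)
  have hev : (fun q : P × G => op q.2 • q.1) ∘ (fun q => ((σ ∘ B.proj) q, γ q)) =ᶠ[𝓝 p] id := by
    filter_upwards [h.isOpen_preimage.mem_nhds h.mem] with q hq using h.act_section q hq
  have h1 := mfderiv_comp p ((B.contMDiff_act ((σ ∘ B.proj) p, γ p)).mdifferentiableAt (by simp))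
    (hσ.prodMk hγ)
  rw [hev.mfderiv_eq, mfderiv_id, hσ.mfderiv_prod hγ] at h1
  refine ⟨(mfderiv 𝓘(ℝ, EP) 𝓘(ℝ, EG) γ p u : EG), ?_⟩
  have h2 := congrArg (fun A => A u) h1
  refine h2.trans ?_
  refine (mfderiv_apply_congr _ (show ((σ ∘ B.proj) p, γ p) = (p, 1) from
    Prod.ext h.section_proj h.group_eq_one) _).trans ?_
  refine (mfderiv_act_apply B p 1 (mfderiv 𝓘(ℝ, EP) 𝓘(ℝ, EP) (σ ∘ B.proj) p u)
    (mfderiv 𝓘(ℝ, EP) 𝓘(ℝ, EG) γ p u)).trans ?_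
  rw [hσu]
  refine (congrArg (· + _) (map_zero (mfderiv 𝓘(ℝ, EP) 𝓘(ℝ, EP) (fun q : P => op (1 : G) • q) p))).trans ?_
  exact zero_add _

theorem tangentBundle_mk_congr {E N : Type*} [NormedAddCommGroup E] [NormedSpace ℝ E]
    [TopologicalSpace N] [ChartedSpace E N] {x y : N} (h : x = y) {u v : E} (huv : u = v) :
    (⟨x, u⟩ : TangentBundle 𝓘(ℝ, E) N) = ⟨y, v⟩ := by
  subst h huv; rfl

/-- The fundamental vector of `a(q)` at `q` is the tangent map of the action applied to `(0, a(q))`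
over `(q, 1)`, a composition of smooth maps. -/
theorem contMDiffAt_fundVec (B : PrincipalBundle EP EM EG P M G) {a : P → EG} {p : P}
    (ha : ContMDiffAt 𝓘(ℝ, EP) 𝓘(ℝ, EG) ∞ a p) :
    ContMDiffAt 𝓘(ℝ, EP) 𝓘(ℝ, EP).tangent ∞
      (fun q => (⟨q, fundVec (G := G) EP q (a q)⟩ :
        TangentBundle 𝓘(ℝ, EP) P)) p := by
  have h1 : ContMDiffAt 𝓘(ℝ, EP) 𝓘(ℝ, EG).tangent ∞
      (fun q => (⟨1, a q⟩ : TangentBundle 𝓘(ℝ, EG) G)) p := by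
    refine Bundle.contMDiffAt_totalSpace.2 ⟨contMDiffAt_const, ?_⟩
    -- The base point is constantly the identity, so in one trivialization the fibre coordinate is a
    -- fixed linear map applied to `a`.
    let e := trivializationAt EG (TangentSpace 𝓘(ℝ, EG) : G → Type _) 1
    let L : EG →L[ℝ] EG := e.continuousLinearMapAt ℝ 1
    refine (L.contMDiff.contMDiffAt.comp p ha).congr_of_eventuallyEq (Eventually.of_forall fun q => ?_)
    exact (congrFun (e.coe_linearMapAt_of_mem (R := ℝ)
      (FiberBundle.mem_baseSet_trivializationAt' (1 : G))) (a q)).symm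
  have h0 : ContMDiffAt 𝓘(ℝ, EP) 𝓘(ℝ, EP).tangent ∞
      (fun q => (⟨q, 0⟩ : TangentBundle 𝓘(ℝ, EP) P)) p :=
    Bundle.contMDiff_zeroSection ℝ (TangentSpace 𝓘(ℝ, EP) : P → Type _) p
  have h2 := (((B.contMDiff_act.contMDiff_tangentMap (m := ∞) (by simp)).comp
    (contMDiff_equivTangentBundleProd_symm (n := ∞) (I := 𝓘(ℝ, EP)) (I' := 𝓘(ℝ, EG))
      (M := P) (M' := G))).contMDiffAt).comp p (h0.prodMk h1)
  refine h2.congr_of_eventuallyEq (Eventually.of_forall fun q => ?_)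
  refine tangentBundle_mk_congr (by simp) ?_
  refine Eq.symm ((mfderiv_act_apply B q 1 0 (a q)).trans ?_)
  refine (congrArg (· + _) (map_zero (mfderiv 𝓘(ℝ, EP) 𝓘(ℝ, EP)
    (fun q : P => op (1 : G) • q) q))).trans ?_
  exact zero_add _

/-- Vector fields on the base lift locally to smooth fields. -/
theorem exists_local_lift (B : PrincipalBundle EP EM EG P M G) {X : VField EM M}
    (hX : IsSmoothField X) (p : P) : ∃ Z : VField EP P,
      ContMDiffAt 𝓘(ℝ, EP) 𝓘(ℝ, EP).tangent ∞
        (fun q => (⟨q, Z q⟩ : TangentBundle 𝓘(ℝ, EP) P)) p ∧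
      ∀ᶠ q in 𝓝 p, mfderiv 𝓘(ℝ, EP) 𝓘(ℝ, EM) B.proj q (Z q) = X (B.proj q) := by
  obtain ⟨U, σ, γ, h⟩ := B.exists_isLocalSection p
  -- Lift `X` along the section by `dσ`, then carry the result to `q` by right translation with
  -- `γ(q)`, which does not change its projection.
  let Z : VField EP P := fun q => (mfderiv 𝓘(ℝ, EP) 𝓘(ℝ, EP) (fun r : P => op (γ q) • r)
    (σ (B.proj q)) (mfderiv 𝓘(ℝ, EM) 𝓘(ℝ, EP) σ (B.proj q) (X (B.proj q))) : EP)
  refine ⟨Z, ?_, ?_⟩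
  · have h1 : ContMDiffAt 𝓘(ℝ, EP) 𝓘(ℝ, EP).tangent ∞
        (fun q => tangentMap 𝓘(ℝ, EM) 𝓘(ℝ, EP) σ ⟨B.proj q, X (B.proj q)⟩) p := by
      have h3 : ContMDiffOn 𝓘(ℝ, EP) 𝓘(ℝ, EP).tangent ∞
        (fun q => tangentMapWithin 𝓘(ℝ, EM) 𝓘(ℝ, EP) σ U ⟨B.proj q, X (B.proj q)⟩)
          (B.proj ⁻¹' U) :=
        (h.smooth_section.contMDiffOn_tangentMapWithin (m := ∞) (by simp)
          h.isOpen.uniqueMDiffOn).comp (ContMDiff.comp hX B.contMDiff_proj).contMDiffOn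
          (fun q hq => hq)
      refine (h3.contMDiffAt (h.isOpen_preimage.mem_nhds h.mem)).congr_of_eventuallyEq ?_
      filter_upwards [h.isOpen_preimage.mem_nhds h.mem] with q hq
      rw [tangentMapWithin, tangentMap, mfderivWithin_of_isOpen h.isOpen hq]
    have h0 : ContMDiffAt 𝓘(ℝ, EP) 𝓘(ℝ, EG).tangent ∞
        (fun q => (⟨γ q, 0⟩ : TangentBundle 𝓘(ℝ, EG) G)) p :=
      (Bundle.contMDiff_zeroSection ℝ (TangentSpace 𝓘(ℝ, EG) : G → Type _)).contMDiffAt.comp p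
        (h.contMDiffAt_group h.mem)
    have h2 := (((B.contMDiff_act.contMDiff_tangentMap (m := ∞) (by simp)).comp
      (contMDiff_equivTangentBundleProd_symm (n := ∞) (I := 𝓘(ℝ, EP)) (I' := 𝓘(ℝ, EG))
        (M := P) (M' := G))).contMDiffAt).comp p (h1.prodMk h0)
    refine h2.congr_of_eventuallyEq ?_
    filter_upwards [h.isOpen_preimage.mem_nhds h.mem] with q hq
    refine tangentBundle_mk_congr (h.act_section q hq).symm ?_
    refine Eq.symm ((mfderiv_act_apply B (σ (B.proj q)) (γ q)
      (mfderiv 𝓘(ℝ, EM) 𝓘(ℝ, EP) σ (B.proj q) (X (B.proj q))) 0).trans ?_)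
    refine (congrArg (_ + ·) (map_zero (mfderiv 𝓘(ℝ, EG) 𝓘(ℝ, EP)
      (fun g : G => op g • σ (B.proj q)) (γ q)))).trans ?_
    exact add_zero _
  · filter_upwards [h.isOpen_preimage.mem_nhds h.mem] with q hq
    refine (mfderiv_apply_congr B.proj (h.act_section q hq).symm _).trans ?_
    refine (mfderiv_proj_rightTranslation B (σ (B.proj q)) (γ q) _).trans ?_
    exact h.mfderiv_proj_section hq _

end Bundle

/-! ### Horizontal lifts, vertical derivatives and curvature -/

section Connection

variable {EP EM EG P M G V : Type*}
  [NormedAddCommGroup EP] [NormedSpace ℝ EP] [NormedAddCommGroup EM] [NormedSpace ℝ EM]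
  [NormedAddCommGroup EG] [NormedSpace ℝ EG] [FiniteDimensional ℝ EG]
  [TopologicalSpace P] [ChartedSpace EP P] [TopologicalSpace M] [ChartedSpace EM M]
  [TopologicalSpace G] [ChartedSpace EG G] [Group G] [MulAction Gᵐᵒᵖ P]
  [NormedAddCommGroup V] [InnerProductSpace ℂ V] [FiniteDimensional ℂ V]
  [IsManifold 𝓘(ℝ, EP) ∞ P] [IsManifold 𝓘(ℝ, EM) ∞ M] [LieGroup 𝓘(ℝ, EG) ∞ G]
  {B : PrincipalBundle EP EM EG P M G} {T : G →* (V ≃ₗᵢ[ℂ] V)} {θ : OneForm EP P V}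

theorem form_congr (θ : OneForm EP P V) {p q : P} (h : p = q) (u : EP) :
    θ p (u : TangentSpace 𝓘(ℝ, EP) p) = θ q (u : TangentSpace 𝓘(ℝ, EP) q) := by
  subst h; rfl

variable (hT : ContMDiff 𝓘(ℝ, EG) 𝓘(ℝ, V →L[ℂ] V) ∞ (repOp T)) (hinj : Function.Injective T)
  (hθ : IsConnectionForm B T θ)

include hθ in
theorem form_fundVec (p : P) (x : TangentSpace 𝓘(ℝ, EG) (1 : G)) :
    θ p (fundVec EP p x) = dRep EG T x :=
  (form_congr θ (show p = op (1 : G) • p by simp) _).trans (hθ.fundamental p x)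

include hT hinj hθ in
theorem eq_zero_of_vertical_of_form {p : P} {u : TangentSpace 𝓘(ℝ, EP) p}
    (hu : mfderiv 𝓘(ℝ, EP) 𝓘(ℝ, EM) B.proj p u = 0) (hu' : θ p u = 0) : u = 0 := by
  obtain ⟨x, rfl⟩ := exists_eq_fundVec B hu
  rw [form_fundVec hθ] at hu'
  rw [(injective_iff_map_eq_zero _).1 (dRep_injective hT hinj) x hu']
  exact map_zero (mfderiv 𝓘(ℝ, EG) 𝓘(ℝ, EP) (fun g : G => op g • p) 1)

theorem exists_mfderiv_proj_eq (B : PrincipalBundle EP EM EG P M G) (p : P)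
    (x : TangentSpace 𝓘(ℝ, EM) (B.proj p)) :
    ∃ u : TangentSpace 𝓘(ℝ, EP) p, mfderiv 𝓘(ℝ, EP) 𝓘(ℝ, EM) B.proj p u = x := by
  obtain ⟨U, σ, γ, h⟩ := B.exists_isLocalSection p
  refine ⟨(mfderiv 𝓘(ℝ, EM) 𝓘(ℝ, EP) σ (B.proj p) x : EP), ?_⟩
  exact (mfderiv_apply_congr B.proj h.section_proj.symm _).trans (h.mfderiv_proj_section h.mem x)

include hθ in
theorem hlift_spec (p : P) (x : TangentSpace 𝓘(ℝ, EM) (B.proj p)) :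
    θ p (hlift B θ p x) = 0 ∧ mfderiv 𝓘(ℝ, EP) 𝓘(ℝ, EM) B.proj p (hlift B θ p x) = x := by
  have h : ∃ u : TangentSpace 𝓘(ℝ, EP) p,
      θ p u = 0 ∧ mfderiv 𝓘(ℝ, EP) 𝓘(ℝ, EM) B.proj p u = x := by
    obtain ⟨u, hu⟩ := exists_mfderiv_proj_eq B p x
    obtain ⟨y, hy⟩ := hθ.mem_repLie p u
    -- Any lift becomes horizontal after subtracting the fundamental vector with the same `θ`-value;
    -- one exists because `θ` takes values in `DT(e)(𝔤)`.
    refine ⟨u - fundVec EP p y, ?_, ?_⟩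
    · rw [map_sub, form_fundVec hθ, sub_eq_zero]
      exact hy.symm
    · rw [map_sub, hu, mfderiv_proj_fundVec, sub_zero]
  rw [hlift, dif_pos h]
  exact h.choose_spec

include hT hinj hθ in
-- Uniqueness of horizontal lifts: two of them differ by a vertical vector killed by `θ`, and such a
-- vector is zero since `DT(e)` is injective.
theorem eq_hlift {p : P} {u : TangentSpace 𝓘(ℝ, EP) p} (hu : θ p u = 0) :
    u = hlift B θ p (mfderiv 𝓘(ℝ, EP) 𝓘(ℝ, EM) B.proj p u) := by
  have h := hlift_spec hθ p (mfderiv 𝓘(ℝ, EP) 𝓘(ℝ, EM) B.proj p u)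
  rw [← sub_eq_zero]
  refine eq_zero_of_vertical_of_form hT hinj hθ ?_ ?_
  · rw [map_sub, h.2, sub_self]
  · rw [map_sub, h.1, hu, sub_zero]

include hθ in
theorem form_horPart (p : P) (u : TangentSpace 𝓘(ℝ, EP) p) : θ p (horPart B θ p u) = 0 :=
  (hlift_spec hθ p _).1

include hθ in
theorem mfderiv_proj_horPart (p : P) (u : TangentSpace 𝓘(ℝ, EP) p) :
    mfderiv 𝓘(ℝ, EP) 𝓘(ℝ, EM) B.proj p (horPart B θ p u) =
      mfderiv 𝓘(ℝ, EP) 𝓘(ℝ, EM) B.proj p u :=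
  (hlift_spec hθ p _).2

include hθ in
theorem form_hliftField (X : VField EM M) (p : P) : θ p (hliftField B θ X p) = 0 :=
  (hlift_spec hθ p _).1

include hθ in
theorem mfderiv_proj_hliftField (X : VField EM M) (p : P) :
    mfderiv 𝓘(ℝ, EP) 𝓘(ℝ, EM) B.proj p (hliftField B θ X p) = X (B.proj p) :=
  (hlift_spec hθ p _).2

include hT hinj hθ in
theorem eq_hliftField {X : VField EM M} {p : P} {u : TangentSpace 𝓘(ℝ, EP) p} (hu : θ p u = 0)
    (hX : mfderiv 𝓘(ℝ, EP) 𝓘(ℝ, EM) B.proj p u = X (B.proj p)) : u = hliftField B θ X p :=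
  (eq_hlift hT hinj hθ hu).trans (congrArg _ hX)

include hT hinj hθ in
theorem horPart_hliftField (X : VField EM M) (p : P) :
    horPart B θ p (hliftField B θ X p) = hliftField B θ X p :=
  (eq_hlift hT hinj hθ (form_hliftField hθ X p)).symm

include hT hinj hθ in
theorem hliftField_add_smul (c : ℝ) (X Y : VField EM M) :
    hliftField B θ (X + c • Y) = hliftField B θ X + c • hliftField B θ Y := by
  funext p
  refine (eq_hliftField hT hinj hθ ?_ ?_).symm
  · change θ p (hliftField B θ X p + c • hliftField B θ Y p) = 0
    rw [map_add, map_smul, form_hliftField hθ, form_hliftField hθ, smul_zero, add_zero]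
  · change mfderiv 𝓘(ℝ, EP) 𝓘(ℝ, EM) B.proj p (hliftField B θ X p + c • hliftField B θ Y p) =
      X (B.proj p) + c • Y (B.proj p)
    rw [map_add, map_smul, mfderiv_proj_hliftField hθ, mfderiv_proj_hliftField hθ]

include hT hinj hθ in
theorem horPart_eq_sub {S : (V →L[ℂ] V) →L[ℝ] EG}
    (hS : ∀ x : TangentSpace 𝓘(ℝ, EG) (1 : G), S (dRep EG T x) = x) (p : P)
    (u : TangentSpace 𝓘(ℝ, EP) p) :
    horPart B θ p u = u - fundVec (G := G) EP p (S (θ p u)) := by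
  obtain ⟨y, hy⟩ := hθ.mem_repLie p u
  have hy' : S (θ p u) = y := by rw [← hy]; exact hS y
  have h1 : θ p (u - fundVec (G := G) EP p y) = 0 := by
    rw [map_sub, form_fundVec hθ, sub_eq_zero]
    exact hy.symm
  have h2 := eq_hlift hT hinj hθ h1
  rw [map_sub, mfderiv_proj_fundVec, sub_zero] at h2
  rw [hy']
  exact h2.symm

include hT hinj hθ in
theorem contMDiffAt_horPart {W : VField EP P} {p : P}
    (hW : ContMDiffAt 𝓘(ℝ, EP) 𝓘(ℝ, EP).tangent ∞
      (fun q => (⟨q, W q⟩ : TangentBundle 𝓘(ℝ, EP) P)) p) :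
    ContMDiffAt 𝓘(ℝ, EP) 𝓘(ℝ, EP).tangent ∞
      (fun q => (⟨q, horPart B θ q (W q)⟩ : TangentBundle 𝓘(ℝ, EP) P)) p := by
  obtain ⟨S, hS⟩ := exists_dRep_leftInverse hT hinj
  have h1 : ContMDiffAt 𝓘(ℝ, EP) 𝓘(ℝ, EG) ∞ (fun q => S (θ q (W q))) p :=
    S.contMDiff.contMDiffAt.comp p (ContMDiffAt.comp p (hθ.smooth _) hW)
  have h2 := ContMDiffAt.sub_section hW (contMDiffAt_fundVec B h1)
  have h3 : (fun q => horPart B θ q (W q)) =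
      W - fun q => fundVec (G := G) EP q (S (θ q (W q))) := by
    funext q
    exact horPart_eq_sub hT hinj hθ hS q (W q)
  simpa only [← h3] using h2

include hT hinj hθ in
theorem isSmoothField_horPart {W : VField EP P} (hW : IsSmoothField W) :
    IsSmoothField (fun q => horPart B θ q (W q)) :=
  fun p => contMDiffAt_horPart hT hinj hθ (hW p)

include hT hinj hθ in
-- Near each point `X^*` is the horizontal projection of any smooth local lift of `X`.
theorem isSmoothField_hliftField {X : VField EM M} (hX : IsSmoothField X) :
    IsSmoothField (hliftField B θ X) := by
  intro p
  obtain ⟨Z, hZ, hZX⟩ := exists_local_lift B hX p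
  refine (contMDiffAt_horPart hT hinj hθ hZ).congr_of_eventuallyEq ?_
  filter_upwards [hZX] with q hq
  refine tangentBundle_mk_congr rfl ?_
  exact (congrArg (hlift B θ q) hq).symm

/-- Invariance of a vector field on the total space under the structure group. -/
def IsInvariantField (G : Type*) {EP P : Type*} [NormedAddCommGroup EP] [NormedSpace ℝ EP]
    [TopologicalSpace P] [ChartedSpace EP P] [Group G] [MulAction Gᵐᵒᵖ P] (ξ : VField EP P) : Prop :=
  ∀ (p : P) (g : G), ξ (op g • p) = mfderiv 𝓘(ℝ, EP) 𝓘(ℝ, EP) (fun q : P => op g • q) p (ξ p)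

include hT hinj hθ in
-- A right translate of `X^*` is again horizontal and over `X`, so uniqueness identifies it with
-- `X^*`.
theorem isInvariantField_hliftField (X : VField EM M) :
    IsInvariantField G (hliftField B θ X) := by
  intro p g
  refine (eq_hliftField hT hinj hθ ?_ ?_).symm
  · rw [hθ.equivariant, form_hliftField hθ, mul_zero, zero_mul]
  · refine (mfderiv_proj_rightTranslation B p g _).trans ?_
    refine (mfderiv_proj_hliftField hθ X p).trans ?_
    have key : ∀ {m m' : M}, m = m' → (X m : EM) = X m' := by rintro m _ rfl; rfl
    exact key (B.proj_act p g).symm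

theorem IsInvariantField.mlieBracket [CompleteSpace EP] (B : PrincipalBundle EP EM EG P M G)
    {ξ η : VField EP P} (hξ : IsInvariantField G ξ) (hη : IsInvariantField G η)
    (hξs : IsSmoothField ξ) (hηs : IsSmoothField η) :
    IsInvariantField G (mlieBracket 𝓘(ℝ, EP) ξ η) := fun p g =>
  (mfderiv_mlieBracket_of_related (B.contMDiff_rightTranslation g) hξs hηs hξs hηs
    (fun q => (hξ q g).symm) (fun q => (hη q g).symm) p).symm

theorem IsInvariantField.fieldDeriv_act {W : Type*} [NormedAddCommGroup W] [NormedSpace ℝ W]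
    (B : PrincipalBundle EP EM EG P M G) {ξ : VField EP P} (hξ : IsInvariantField G ξ)
    {f : P → W} (hf : ∀ p, MDifferentiableAt 𝓘(ℝ, EP) 𝓘(ℝ, W) f p) (g : G) (L : W →L[ℝ] W)
    (hL : ∀ p, f (op g • p) = L (f p)) (p : P) :
    fieldDeriv ξ f (op g • p) = L (fieldDeriv ξ f p) := by
  rw [← fieldDeriv_clm L (hf p), ← funext hL]
  exact (fieldDeriv_comp (hf (op g • p))
    ((B.contMDiff_rightTranslation g p).mdifferentiableAt (by simp)) (hξ p g).symm).symm

include hT hθ in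
-- A vertical vector is the velocity of an orbit map, along which `f` is `g ↦ T(g⁻¹) f(p)`; the sign
-- comes from the inverse. Equivariance is only used on the orbit of `p`.
theorem mfderiv_vertical_equivariant {f : P → V} {p : P}
    (hf : MDifferentiableAt 𝓘(ℝ, EP) 𝓘(ℝ, V) f p)
    (hfe : ∀ g, f (op g • p) = repOp T g⁻¹ (f p)) {u : TangentSpace 𝓘(ℝ, EP) p}
    (hu : mfderiv 𝓘(ℝ, EP) 𝓘(ℝ, EM) B.proj p u = 0) :
    (mfderiv 𝓘(ℝ, EP) 𝓘(ℝ, V) f p u : V) = -(θ p u (f p)) := by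
  obtain ⟨x, rfl⟩ := exists_eq_fundVec B hu
  have h1 : op (1 : G) • p = p := by simp
  have h2 := mfderiv_comp 1 (by rw [h1]; exact hf : MDifferentiableAt 𝓘(ℝ, EP) 𝓘(ℝ, V) f
    (op (1 : G) • p)) ((B.contMDiff_orbitMap p 1).mdifferentiableAt (by simp))
  have h3 : f ∘ (fun g : G => op g • p) = fun g => repOp T g⁻¹ (f p) := funext hfe
  rw [h3] at h2
  rw [form_fundVec hθ]
  refine Eq.trans ?_ (mfderiv_repOp_inv_apply hT x (f p))
  exact (mfderiv_apply_congr f h1.symm _).trans (congrArg (fun A => A x) h2).symm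

include hT hθ in
theorem mfderiv_vertical_conj {K : P → (V →L[ℂ] V)} {p : P}
    (hK : MDifferentiableAt 𝓘(ℝ, EP) 𝓘(ℝ, V →L[ℂ] V) K p)
    (hKe : ∀ g, K (op g • p) = repOp T g⁻¹ * K p * repOp T g) {u : TangentSpace 𝓘(ℝ, EP) p}
    (hu : mfderiv 𝓘(ℝ, EP) 𝓘(ℝ, EM) B.proj p u = 0) :
    (mfderiv 𝓘(ℝ, EP) 𝓘(ℝ, V →L[ℂ] V) K p u : V →L[ℂ] V) = -⁅θ p u, K p⁆ := by
  obtain ⟨x, rfl⟩ := exists_eq_fundVec B hu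
  have h1 : op (1 : G) • p = p := by simp
  have h2 := mfderiv_comp 1 (by rw [h1]; exact hK : MDifferentiableAt 𝓘(ℝ, EP) 𝓘(ℝ, V →L[ℂ] V) K
    (op (1 : G) • p)) ((B.contMDiff_orbitMap p 1).mdifferentiableAt (by simp))
  have h3 : K ∘ (fun g : G => op g • p) = fun g => repOp T g⁻¹ * K p * repOp T g := funext hKe
  rw [h3] at h2
  rw [form_fundVec hθ]
  refine Eq.trans ?_ (mfderiv_repOp_conj hT x (K p))
  exact (mfderiv_apply_congr K h1.symm _).trans (congrArg (fun A => A x) h2).symm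

include hθ in
-- The two derivative terms of `dθ` vanish because `θ` is identically zero on horizontal fields.
theorem curv_eq (Z W : VField EP P) (p : P) :
    curv B θ Z W p = -θ p (mlieBracket 𝓘(ℝ, EP) (fun q => horPart B θ q (Z q))
      (fun q => horPart B θ q (W q)) p) := by
  have h : ∀ Z : VField EP P, (fun q => θ q (horPart B θ q (Z q))) = fun _ => 0 := fun Z =>
    funext fun q => form_horPart hθ q (Z q)
  rw [curv, extD, h, h]
  rw [fieldDeriv_const, fieldDeriv_const, sub_zero, zero_sub]

end Connection

/-! ### Equivariant test functions and the moment map identity -/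

section TestFunctions

variable {EP EM EG P M G V : Type*}
  [NormedAddCommGroup EP] [NormedSpace ℝ EP] [FiniteDimensional ℝ EP]
  [NormedAddCommGroup EM] [NormedSpace ℝ EM] [FiniteDimensional ℝ EM]
  [NormedAddCommGroup EG] [NormedSpace ℝ EG] [FiniteDimensional ℝ EG]
  [TopologicalSpace P] [T2Space P] [ChartedSpace EP P]
  [TopologicalSpace M] [T2Space M] [ChartedSpace EM M]
  [TopologicalSpace G] [ChartedSpace EG G] [Group G] [MulAction Gᵐᵒᵖ P]
  [NormedAddCommGroup V] [InnerProductSpace ℂ V] [FiniteDimensional ℂ V]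
  [IsManifold 𝓘(ℝ, EP) ∞ P] [IsManifold 𝓘(ℝ, EM) ∞ M] [LieGroup 𝓘(ℝ, EG) ∞ G]
  {B : PrincipalBundle EP EM EG P M G} {T : G →* (V ≃ₗᵢ[ℂ] V)} {θ : OneForm EP P V}

/-- Smooth equivariant functions `f : P → V`, `f(pg) = T(g⁻¹) f(p)`. -/
structure IsEquivFun (EP : Type*) {P G V : Type*} [NormedAddCommGroup EP] [NormedSpace ℝ EP]
    [TopologicalSpace P] [ChartedSpace EP P] [Group G] [MulAction Gᵐᵒᵖ P]
    [NormedAddCommGroup V] [InnerProductSpace ℂ V] (T : G →* (V ≃ₗᵢ[ℂ] V)) (f : P → V) :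
    Prop where
  smooth : ContMDiff 𝓘(ℝ, EP) 𝓘(ℝ, V) ∞ f
  act : ∀ p g, f (op g • p) = repOp T g⁻¹ (f p)

theorem IsEquivFun.mdifferentiableAt {f : P → V} (hf : IsEquivFun EP T f) (p : P) :
    MDifferentiableAt 𝓘(ℝ, EP) 𝓘(ℝ, V) f p :=
  (hf.smooth p).mdifferentiableAt (by simp)

theorem IsGaugeFun.mdifferentiableAt {F : P → (V →L[ℂ] V)} (hF : IsGaugeFun EP EG T F) (p : P) :
    MDifferentiableAt 𝓘(ℝ, EP) 𝓘(ℝ, V →L[ℂ] V) F p :=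
  (hF.smooth p).mdifferentiableAt (by simp)

theorem IsEquivFun.fieldDeriv (B : PrincipalBundle EP EM EG P M G) {f : P → V}
    (hf : IsEquivFun EP T f) {ξ : VField EP P} (hξ : IsSmoothField ξ) (hi : IsInvariantField G ξ) :
    IsEquivFun EP T (fieldDeriv ξ f) where
  smooth := hξ.contMDiff_fieldDeriv hf.smooth
  act p g := hi.fieldDeriv_act B hf.mdifferentiableAt g ((repOp T g⁻¹).restrictScalars ℝ)
    (fun q => hf.act q g) p

/-- On the trivialized part take `σ(x)·g ↦ χ(x) T(g⁻¹)v` with a bump function `χ` on the base, and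
extend by zero. Such functions take every value at `p`, so an operator identity at `p` may be tested
on them. -/
theorem exists_isEquivFun (B : PrincipalBundle EP EM EG P M G)
    (hT : ContMDiff 𝓘(ℝ, EG) 𝓘(ℝ, V →L[ℂ] V) ∞ (repOp T)) (p : P) (v : V) :
    ∃ f : P → V, IsEquivFun EP T f ∧ f p = v := by
  classical
  obtain ⟨U, σ, γ, h⟩ := B.exists_isLocalSection p
  obtain ⟨χ, -, hχ⟩ := (SmoothBumpFunction.nhds_basis_tsupport (I := 𝓘(ℝ, EM)) (B.proj p)).mem_iff.1
    (h.isOpen.mem_nhds h.mem)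
  refine ⟨fun q => if B.proj q ∈ U then χ (B.proj q) • repOp T (γ q)⁻¹ v else 0, ⟨?_, ?_⟩, ?_⟩
  · intro q
    by_cases hq : B.proj q ∈ U
    · have h1 : ContMDiffAt 𝓘(ℝ, EP) 𝓘(ℝ, ℝ) ∞ (fun q => χ (B.proj q)) q :=
        (χ.contMDiff.comp B.contMDiff_proj) q
      have h2 : ContMDiffAt 𝓘(ℝ, EP) 𝓘(ℝ, V →L[ℂ] V) ∞ (fun q => repOp T (γ q)⁻¹) q :=
        (hT.comp (contMDiff_inv 𝓘(ℝ, EG) ∞)).contMDiffAt.comp q (h.contMDiffAt_group hq)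
      have h3 : ContMDiffAt 𝓘(ℝ, EP) 𝓘(ℝ, V) ∞ (fun q => repOp T (γ q)⁻¹ v) q :=
        ((ContinuousLinearMap.apply ℂ V v).restrictScalars ℝ).contMDiff.contMDiffAt.comp q h2
      refine (h1.smul h3).congr_of_eventuallyEq ?_
      filter_upwards [h.isOpen_preimage.mem_nhds hq] with r hr
      exact if_pos hr
    · have h1 : B.proj q ∉ tsupport χ := fun hc => hq (hχ hc)
      have h2 : (B.proj ⁻¹' (tsupport χ)ᶜ) ∈ 𝓝 q :=
        ((isClosed_tsupport χ).isOpen_compl.preimage B.contMDiff_proj.continuous).mem_nhds h1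
      refine (contMDiffAt_const (c := (0 : V))).congr_of_eventuallyEq ?_
      filter_upwards [h2] with r hr
      simp [image_eq_zero_of_notMem_tsupport hr]
  · intro q g
    simp only [B.proj_act]
    split_ifs with hq
    · rw [h.group_act q g hq, mul_inv_rev, repOp_mul, ContinuousLinearMap.map_smul_of_tower]
      rfl
    · simp
  · simp [h.mem, h.group_eq_one, repOp_one]

theorem eq_zero_of_forall_isEquivFun (B : PrincipalBundle EP EM EG P M G)
    (hT : ContMDiff 𝓘(ℝ, EG) 𝓘(ℝ, V →L[ℂ] V) ∞ (repOp T)) {p : P} {A : V →L[ℂ] V}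
    (h : ∀ f : P → V, IsEquivFun EP T f → A (f p) = 0) : A = 0 := by
  ext v
  obtain ⟨f, hf, rfl⟩ := exists_isEquivFun B hT p v
  exact h f hf

variable (hT : ContMDiff 𝓘(ℝ, EG) 𝓘(ℝ, V →L[ℂ] V) ∞ (repOp T)) (hinj : Function.Injective T)
  (hθ : IsConnectionForm B T θ)

theorem IsConnectionForm.contMDiff_apply (hθ : IsConnectionForm B T θ) {ξ : VField EP P}
    (hξ : IsSmoothField ξ) :
    ContMDiff 𝓘(ℝ, EP) 𝓘(ℝ, V →L[ℂ] V) ∞ (fun q => θ q (ξ q)) :=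
  hξ.contMDiff_apply hθ.smooth

theorem IsConnectionForm.mdifferentiableAt_apply (hθ : IsConnectionForm B T θ) {ξ : VField EP P}
    (hξ : IsSmoothField ξ) (p : P) :
    MDifferentiableAt 𝓘(ℝ, EP) 𝓘(ℝ, V →L[ℂ] V) (fun q => θ q (ξ q)) p :=
  (hθ.contMDiff_apply hξ p).mdifferentiableAt (by simp)

theorem fieldDeriv_apply {F : P → (V →L[ℂ] V)} {f : P → V} {ξ : VField EP P} {p : P}
    (hF : MDifferentiableAt 𝓘(ℝ, EP) 𝓘(ℝ, V →L[ℂ] V) F p)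
    (hf : MDifferentiableAt 𝓘(ℝ, EP) 𝓘(ℝ, V) f p) :
    fieldDeriv ξ (fun q => F q (f q)) p = fieldDeriv ξ F p (f p) + F p (fieldDeriv ξ f p) :=
  fieldDeriv_bilin (ContinuousLinearMap.restrictScalarsL ℂ V V ℝ ℝ) hF hf

include hT hinj hθ in
-- Apply `[ζ, Y^*]` to an equivariant `f` in two ways. The bracket is vertical, since `ζ` is related
-- to `0`, so it gives `-θ([ζ,Y^*]) f`. As a commutator it gives `-θ(ζ) Y^*f + Y^*(θ(ζ) f) =
-- (Y^*θ(ζ)) f`, because `Y^*f` is equivariant too.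
theorem form_mlieBracket_vertical_hliftField {ζ : VField EP P} (hζ : IsSmoothField ζ)
    (hv : ∀ q, mfderiv 𝓘(ℝ, EP) 𝓘(ℝ, EM) B.proj q (ζ q) = 0) {Y : VField EM M}
    (hY : IsSmoothField Y) (p : P) :
    θ p (mlieBracket 𝓘(ℝ, EP) ζ (hliftField B θ Y) p) =
      -fieldDeriv (hliftField B θ Y) (fun q => θ q (ζ q)) p := by
  have hYs := isSmoothField_hliftField hT hinj hθ hY
  have hvert : mfderiv 𝓘(ℝ, EP) 𝓘(ℝ, EM) B.proj p
      (mlieBracket 𝓘(ℝ, EP) ζ (hliftField B θ Y) p) = 0 := by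
    rw [mfderiv_mlieBracket_of_related B.contMDiff_proj hζ hYs isSmoothField_zero hY hv
      (mfderiv_proj_hliftField hθ Y) p, mlieBracket_zero_left]
    rfl
  rw [← sub_eq_zero]
  refine eq_zero_of_forall_isEquivFun B hT (p := p) fun f hf => ?_
  have h1 := fieldDeriv_mlieBracket ((hf.smooth p).of_le ENat.LEInfty.out)
    (hζ.mdifferentiableAt p) (hYs.mdifferentiableAt p)
  have hYf := hf.fieldDeriv B hYs (isInvariantField_hliftField hT hinj hθ Y)
  have h2 : fieldDeriv ζ f = -fun q => θ q (ζ q) (f q) := funext fun q =>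
    mfderiv_vertical_equivariant hT hθ (hf.mdifferentiableAt q) (hf.act q) (hv q)
  rw [h2, fieldDeriv_neg, fieldDeriv_apply (hθ.mdifferentiableAt_apply hζ p)
    (hf.mdifferentiableAt p)] at h1
  have h3 : fieldDeriv ζ (fieldDeriv (hliftField B θ Y) f) p = _ :=
    mfderiv_vertical_equivariant hT hθ (hYf.mdifferentiableAt p) (hYf.act p) (hv p)
  have h4 : fieldDeriv (mlieBracket 𝓘(ℝ, EP) ζ (hliftField B θ Y)) f p = _ :=
    mfderiv_vertical_equivariant hT hθ (hf.mdifferentiableAt p) (hf.act p) hvert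
  rw [h3, h4] at h1
  rw [sub_neg_eq_add, add_apply]
  have h5 := congrArg Neg.neg h1
  rw [neg_neg] at h5
  rw [h5]
  abel

include hT hinj hθ in
theorem form_mlieBracket_vertical_horizontal {ζ : VField EP P} (hζ : IsSmoothField ζ)
    (hv : ∀ q, mfderiv 𝓘(ℝ, EP) 𝓘(ℝ, EM) B.proj q (ζ q) = 0) {H : VField EP P}
    (hH : IsSmoothField H) (hh : ∀ q, θ q (H q) = 0) (p : P) :
    θ p (mlieBracket 𝓘(ℝ, EP) ζ H p) = -fieldDeriv H (fun q => θ q (ζ q)) p := by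
  -- Compare `H` with a lift `Y^*` that agrees with it at `p`. The difference is horizontal and
  -- vanishes at `p`, so it contributes nothing to `θ` of the bracket.
  obtain ⟨Y, hY, hYp⟩ := exists_isSmoothField (B.proj p)
    (mfderiv 𝓘(ℝ, EP) 𝓘(ℝ, EM) B.proj p (H p))
  have hYs := isSmoothField_hliftField hT hinj hθ hY
  have hp : H p = hliftField B θ Y p := eq_hliftField hT hinj hθ (hh p) hYp.symm
  have h0 : (H - hliftField B θ Y) p = 0 := sub_eq_zero.2 hp
  have hz : (fun q => θ q ((H - hliftField B θ Y) q)) = fun _ => 0 := by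
    funext q
    change θ q (H q - hliftField B θ Y q) = 0
    rw [map_sub, hh, form_hliftField hθ, sub_zero]
  have h1 := form_mlieBracket_of_eq_zero (X := ζ) hθ.smooth (hH.sub hYs) h0
  rw [hz, fieldDeriv_const] at h1
  have h2 := mlieBracket_add_right (V := ζ) (hYs.mdifferentiableAt p)
    ((hH.sub hYs).mdifferentiableAt p)
  rw [add_sub_cancel] at h2
  rw [h2, map_add, h1, add_zero, form_mlieBracket_vertical_hliftField hT hinj hθ hζ hv hY]
  exact congrArg Neg.neg (fieldDeriv_congr_left _ hp.symm)

theorem IsInfAut.isInvariantField {ξ : VField EP P} (hξ : IsInfAut G θ ξ) :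
    IsInvariantField G ξ := hξ.invariant

theorem IsInfAut.form_mlieBracket {ξ Z : VField EP P} (hξ : IsInfAut G θ ξ)
    (hZ : IsSmoothField Z) (p : P) :
    θ p (mlieBracket 𝓘(ℝ, EP) ξ Z p) = fieldDeriv ξ (fun q => θ q (Z q)) p :=
  (sub_eq_zero.1 (hξ.lieD_eq_zero Z hZ p)).symm

include hθ in
theorem isGaugeFun_form {ξ : VField EP P} (hξ : IsSmoothField ξ) (hi : IsInvariantField G ξ) :
    IsGaugeFun EP EG T (fun q => θ q (ξ q)) where
  smooth := hθ.contMDiff_apply hξ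
  mem_repLie p := hθ.mem_repLie p _
  equivariant p g := by rw [hi p g, hθ.equivariant]

include hT hinj hθ in
theorem curv_hliftField_eq (X : VField EM M) (W : VField EP P) (p : P) :
    curv B θ (hliftField B θ X) W p = -θ p (mlieBracket 𝓘(ℝ, EP) (hliftField B θ X)
      (fun q => horPart B θ q (W q)) p) := by
  rw [curv_eq hθ]
  simp only [horPart_hliftField hT hinj hθ]

include hT hinj hθ in
theorem curv_hliftField_hliftField (X Y : VField EM M) (p : P) :
    curv B θ (hliftField B θ X) (hliftField B θ Y) p =
      -θ p (mlieBracket 𝓘(ℝ, EP) (hliftField B θ X) (hliftField B θ Y) p) := by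
  rw [curv_hliftField_eq hT hinj hθ]
  simp only [horPart_hliftField hT hinj hθ]

/-- The moment map identity: `Ω(X^*, W) = D(-θ(ξ))(W)` if `ξ ∈ 𝓔_G^0` projects to `X`. -/
theorem curv_eq_covDiff_form (hT : ContMDiff 𝓘(ℝ, EG) 𝓘(ℝ, V →L[ℂ] V) ∞ (repOp T))
    (hinj : Function.Injective T) (hθ : IsConnectionForm B T θ) {ξ : VField EP P}
    (hξ : IsInfAut G θ ξ) {X : VField EM M} (hX : IsSmoothField X)
    (hξX : ∀ p, mfderiv 𝓘(ℝ, EP) 𝓘(ℝ, EM) B.proj p (ξ p) = X (B.proj p)) {W : VField EP P}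
    (hW : IsSmoothField W) (p : P) :
    curv B θ (hliftField B θ X) W p = covDiff B θ (-fun q => θ q (ξ q)) W p := by
  have hXs := isSmoothField_hliftField hT hinj hθ hX
  have hWs := isSmoothField_horPart hT hinj hθ hW
  have hv : ∀ q, mfderiv 𝓘(ℝ, EP) 𝓘(ℝ, EM) B.proj q ((ξ - hliftField B θ X) q) = 0 := by
    intro q
    change mfderiv 𝓘(ℝ, EP) 𝓘(ℝ, EM) B.proj q (ξ q - hliftField B θ X q) = 0
    rw [map_sub, hξX, mfderiv_proj_hliftField hθ, sub_self]
  have h1 := form_mlieBracket_vertical_horizontal hT hinj hθ (hξ.smooth.sub hXs) hv hWs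
    (fun q => form_horPart hθ q _) p
  have h2 : (fun q => θ q ((ξ - hliftField B θ X) q)) = fun q => θ q (ξ q) := by
    funext q
    change θ q (ξ q - hliftField B θ X q) = _
    rw [map_sub, form_hliftField hθ, sub_zero]
  have h3 := hξ.form_mlieBracket hWs p
  have h4 : (fun q => θ q (horPart B θ q (W q))) = fun _ => 0 := funext fun q => form_horPart hθ q _
  rw [h4, fieldDeriv_const] at h3
  -- Invariance of `θ` gives `θ([ξ, hor W]) = 0`. Splitting `ξ = X^* + (ξ - X^*)` into horizontal
  -- and vertical parts turns this into `θ([X^*, hor W]) = (hor W) θ(ξ)`.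
  have h5 := mlieBracket_add_left (W := fun q => horPart B θ q (W q)) (hXs.mdifferentiableAt p)
    ((hξ.smooth.sub hXs).mdifferentiableAt p)
  rw [add_sub_cancel] at h5
  rw [h5, map_add, h1, h2] at h3
  rw [curv_hliftField_eq hT hinj hθ, covDiff, fieldDeriv_neg]
  exact congrArg Neg.neg (sub_eq_zero.1 ((sub_eq_add_neg _ _).trans h3))

end TestFunctions

/-! ### Infinitesimal automorphisms and the vector space of Hamiltonian pairs -/

section HamiltonianPairs

variable {EP EM EG P M G V : Type*}
  [NormedAddCommGroup EP] [NormedSpace ℝ EP] [FiniteDimensional ℝ EP]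
  [NormedAddCommGroup EM] [NormedSpace ℝ EM] [FiniteDimensional ℝ EM]
  [NormedAddCommGroup EG] [NormedSpace ℝ EG] [FiniteDimensional ℝ EG]
  [TopologicalSpace P] [T2Space P] [ChartedSpace EP P]
  [TopologicalSpace M] [T2Space M] [ChartedSpace EM M]
  [TopologicalSpace G] [ChartedSpace EG G] [Group G] [MulAction Gᵐᵒᵖ P]
  [NormedAddCommGroup V] [InnerProductSpace ℂ V] [FiniteDimensional ℂ V]
  [IsManifold 𝓘(ℝ, EP) ∞ P] [IsManifold 𝓘(ℝ, EM) ∞ M] [LieGroup 𝓘(ℝ, EG) ∞ G]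
  {B : PrincipalBundle EP EM EG P M G} {T : G →* (V ≃ₗᵢ[ℂ] V)} {θ : OneForm EP P V}

/-- The commutator of operators as a continuous bilinear map. -/
def lieCLM (V : Type*) [NormedAddCommGroup V] [InnerProductSpace ℂ V] :
    (V →L[ℂ] V) →L[ℝ] (V →L[ℂ] V) →L[ℝ] (V →L[ℂ] V) :=
  ContinuousLinearMap.mul ℝ (V →L[ℂ] V) - (ContinuousLinearMap.mul ℝ (V →L[ℂ] V)).flip

theorem IsGaugeFun.add_smul {F K : P → (V →L[ℂ] V)} (hF : IsGaugeFun EP EG T F) (c : ℝ)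
    (hK : IsGaugeFun EP EG T K) : IsGaugeFun EP EG T (F + c • K) where
  smooth := hF.smooth.add
    ((c • ContinuousLinearMap.id ℝ (V →L[ℂ] V)).contMDiff.comp hK.smooth)
  mem_repLie p := (repLie EG T).add_mem (hF.mem_repLie p) ((repLie EG T).smul_mem c (hK.mem_repLie p))
  equivariant p g := by
    change F _ + c • K _ = _ * (F p + c • K p) * _
    rw [hF.equivariant, hK.equivariant, mul_add, add_mul, mul_smul_comm, smul_mul_assoc]

theorem isGaugeFun_zero : IsGaugeFun EP EG T (0 : P → (V →L[ℂ] V)) where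
  smooth := contMDiff_const
  mem_repLie _ := (repLie EG T).zero_mem
  equivariant p g := by simp

theorem IsGaugeFun.lie (hT : ContMDiff 𝓘(ℝ, EG) 𝓘(ℝ, V →L[ℂ] V) ∞ (repOp T))
    {F K : P → (V →L[ℂ] V)} (hF : IsGaugeFun EP EG T F)
    (hK : IsGaugeFun EP EG T K) : IsGaugeFun EP EG T (fun p => ⁅F p, K p⁆) where
  smooth := ((lieCLM V).contMDiff.comp hF.smooth).clm_apply hK.smooth
  mem_repLie p := lie_mem_repLie hT (hF.mem_repLie p) (hK.mem_repLie p)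
  equivariant p g := by
    have h := repOp_mul_inv T g
    rw [hF.equivariant, hK.equivariant, Ring.lie_def, Ring.lie_def]
    have key : ∀ A C : V →L[ℂ] V, repOp T g⁻¹ * A * repOp T g * (repOp T g⁻¹ * C * repOp T g) =
        repOp T g⁻¹ * (A * C) * repOp T g := fun A C => by
      rw [show repOp T g⁻¹ * A * repOp T g * (repOp T g⁻¹ * C * repOp T g) =
        repOp T g⁻¹ * A * (repOp T g * repOp T g⁻¹) * C * repOp T g by noncomm_ring, h]
      noncomm_ring
    rw [key, key]
    noncomm_ring

theorem IsInfAut.zero : IsInfAut G θ (0 : VField EP P) where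
  smooth := isSmoothField_zero
  invariant p g := (map_zero (mfderiv 𝓘(ℝ, EP) 𝓘(ℝ, EP) (fun q : P => op g • q) p)).symm
  lieD_eq_zero Z hZ p := by
    have h1 : fieldDeriv (0 : VField EP P) (fun q => θ q (Z q)) p = 0 :=
      map_zero (mfderiv 𝓘(ℝ, EP) 𝓘(ℝ, V →L[ℂ] V) (fun q => θ q (Z q)) p)
    have h2 : θ p ((0 : VField EP P) p) = 0 := map_zero _
    rw [lieD, mlieBracket_zero_left, h1, h2, sub_zero]

theorem IsInfAut.add_smul {ξ η : VField EP P} (hξ : IsInfAut G θ ξ) (c : ℝ)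
    (hη : IsInfAut G θ η) : IsInfAut G θ (ξ + c • η) where
  smooth := hξ.smooth.add (hη.smooth.const_smul c)
  invariant p g := by
    change ξ _ + c • η _ = mfderiv 𝓘(ℝ, EP) 𝓘(ℝ, EP) (fun q : P => op g • q) p (ξ p + c • η p)
    rw [map_add, map_smul, hξ.invariant, hη.invariant]
  lieD_eq_zero Z hZ p := by
    rw [lieD, fieldDeriv_add_left, fieldDeriv_smul_left, mlieBracket_add_left
      (hξ.smooth.mdifferentiableAt p) ((hη.smooth.const_smul c).mdifferentiableAt p),
      mlieBracket_const_smul_left (hη.smooth.mdifferentiableAt p), map_add, map_smul,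
      hξ.form_mlieBracket hZ, hη.form_mlieBracket hZ, sub_self]

/-- With `𝓛_ξ θ = 0` read as `ξ θ(Z) = θ([ξ, Z])`, the statement for `[ξ, η]` is the Jacobi identity
under `θ`. -/
theorem IsInfAut.mlieBracket (hθ : IsConnectionForm B T θ) {ξ η : VField EP P}
    (hξ : IsInfAut G θ ξ) (hη : IsInfAut G θ η) :
    IsInfAut G θ (mlieBracket 𝓘(ℝ, EP) ξ η) where
  smooth := hξ.smooth.mlieBracket hη.smooth
  invariant := hξ.isInvariantField.mlieBracket B hη.isInvariantField hξ.smooth hη.smooth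
  lieD_eq_zero Z hZ p := by
    have h2 : ∀ {n : ℕ∞ω}, n = 2 → n ≤ ∞ := by rintro _ rfl; exact ENat.LEInfty.out
    have : IsManifold 𝓘(ℝ, EP) (minSmoothness ℝ 3) P := by
      simpa using inferInstanceAs (IsManifold 𝓘(ℝ, EP) 3 P)
    have hms : ∀ {X : VField EP P}, IsSmoothField X → ContMDiffAt 𝓘(ℝ, EP) 𝓘(ℝ, EP).tangent
        (minSmoothness ℝ 2) (fun q => (⟨q, X q⟩ : TangentBundle 𝓘(ℝ, EP) P)) p := fun hX =>
      (hX p).of_le (h2 (by simp))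
    have hL := leibniz_identity_mlieBracket_apply (hms hξ.smooth) (hms hη.smooth) (hms hZ)
    have h1 := fieldDeriv_mlieBracket ((hθ.contMDiff_apply hZ p).of_le ENat.LEInfty.out)
      (hξ.smooth.mdifferentiableAt p) (hη.smooth.mdifferentiableAt p)
    have hf : ∀ {ζ : VField EP P}, IsInfAut G θ ζ →
        fieldDeriv ζ (fun q => θ q (Z q)) = fun q => θ q (VectorField.mlieBracket 𝓘(ℝ, EP) ζ Z q) :=
      fun hζ => funext fun q => (hζ.form_mlieBracket hZ q).symm
    rw [hf hξ, hf hη, ← hξ.form_mlieBracket (hη.smooth.mlieBracket hZ),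
      ← hη.form_mlieBracket (hξ.smooth.mlieBracket hZ), hL, map_add, add_sub_cancel_right] at h1
    rw [lieD, h1, sub_self]

variable (hT : ContMDiff 𝓘(ℝ, EG) 𝓘(ℝ, V →L[ℂ] V) ∞ (repOp T)) (hinj : Function.Injective T)
  (hθ : IsConnectionForm B T θ)

theorem covDiff_add_smul {F K : P → (V →L[ℂ] V)} (hF : IsGaugeFun EP EG T F) (c : ℝ)
    (hK : IsGaugeFun EP EG T K) (W : VField EP P) (p : P) :
    covDiff B θ (F + c • K) W p = covDiff B θ F W p + c • covDiff B θ K W p := by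
  rw [covDiff, fieldDeriv_add (hF.mdifferentiableAt p) ((hK.mdifferentiableAt p).const_smul c)]
  congr 1
  exact fieldDeriv_clm (c • ContinuousLinearMap.id ℝ (V →L[ℂ] V)) (hK.mdifferentiableAt p)

include hT hinj hθ in
theorem curv_hliftField_add_smul {X Y : VField EM M} (hX : IsSmoothField X) (c : ℝ)
    (hY : IsSmoothField Y) {W : VField EP P} (p : P) :
    curv B θ (hliftField B θ (X + c • Y)) W p =
      curv B θ (hliftField B θ X) W p + c • curv B θ (hliftField B θ Y) W p := by
  have hXs := isSmoothField_hliftField hT hinj hθ hX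
  have hYs := isSmoothField_hliftField hT hinj hθ hY
  rw [curv_hliftField_eq hT hinj hθ, curv_hliftField_eq hT hinj hθ, curv_hliftField_eq hT hinj hθ,
    hliftField_add_smul hT hinj hθ, mlieBracket_add_left (hXs.mdifferentiableAt p)
      ((hYs.const_smul c).mdifferentiableAt p),
    mlieBracket_const_smul_left (hYs.mdifferentiableAt p), map_add, map_smul, smul_neg, neg_add]

include hT hinj hθ in
theorem hamPairs_add_smul {a b : (P → (V →L[ℂ] V)) × VField EM M} (ha : a ∈ hamPairs B T θ)
    (c : ℝ) (hb : b ∈ hamPairs B T θ) : a + c • b ∈ hamPairs B T θ := by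
  obtain ⟨hF, ⟨hX, ξ, hξ, hξX⟩, hFX⟩ := ha
  obtain ⟨hK, ⟨hY, η, hη, hηY⟩, hKY⟩ := hb
  refine ⟨hF.add_smul c hK, ⟨hX.add (hY.const_smul c), ξ + c • η, hξ.add_smul c hη, ?_⟩, ?_⟩
  · intro p
    change mfderiv 𝓘(ℝ, EP) 𝓘(ℝ, EM) B.proj p (ξ p + c • η p) = a.2 _ + c • b.2 _
    rw [map_add, map_smul, hξX, hηY]
  · intro W hW p
    refine (curv_hliftField_add_smul hT hinj hθ hX c hY p).trans ?_
    rw [hFX W hW, hKY W hW]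
    exact (covDiff_add_smul hF c hK W p).symm

include hT hinj hθ in
theorem zero_mem_hamPairs : (0 : (P → (V →L[ℂ] V)) × VField EM M) ∈ hamPairs B T θ := by
  refine ⟨isGaugeFun_zero, ⟨isSmoothField_zero, 0, IsInfAut.zero, fun p => map_zero _⟩, ?_⟩
  intro W hW p
  -- Linearity applied to `0 + (-1) • 0` yields the vanishing at the zero field.
  have h := curv_hliftField_add_smul hT hinj hθ (isSmoothField_zero (N := M)) (-1)
    (isSmoothField_zero (N := M)) (W := W) p
  rw [smul_zero, add_zero, neg_one_smul, add_neg_cancel] at h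
  refine h.trans ?_
  exact (fieldDeriv_const (0 : V →L[ℂ] V)).symm

/-- The real vector space `𝓕_G^0`. -/
def hamSubmodule (hT : ContMDiff 𝓘(ℝ, EG) 𝓘(ℝ, V →L[ℂ] V) ∞ (repOp T))
    (hinj : Function.Injective T) (hθ : IsConnectionForm B T θ) :
    Submodule ℝ ((P → (V →L[ℂ] V)) × VField EM M) where
  carrier := hamPairs B T θ
  zero_mem' := zero_mem_hamPairs hT hinj hθ
  add_mem' ha hb := by simpa using hamPairs_add_smul hT hinj hθ ha 1 hb
  smul_mem' c a ha := by
    simpa using hamPairs_add_smul hT hinj hθ (zero_mem_hamPairs hT hinj hθ) c ha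

include hT hinj hθ in
/-- Horizontally constant functions commute with the curvature. -/
theorem lie_form_mlieBracket_eq_zero {C : P → (V →L[ℂ] V)} (hC : IsGaugeFun EP EG T C)
    (hD : ∀ H : VField EP P, IsSmoothField H → (∀ q, θ q (H q) = 0) → ∀ p, fieldDeriv H C p = 0)
    {H K : VField EP P} (hH : IsSmoothField H) (hH0 : ∀ q, θ q (H q) = 0)
    (hK : IsSmoothField K) (hK0 : ∀ q, θ q (K q) = 0) (p : P) :
    ⁅θ p (mlieBracket 𝓘(ℝ, EP) H K p), C p⁆ = 0 := by
  have h1 := fieldDeriv_mlieBracket ((hC.smooth p).of_le ENat.LEInfty.out)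
    (hH.mdifferentiableAt p) (hK.mdifferentiableAt p)
  rw [funext (hD H hH hH0), funext (hD K hK hK0), fieldDeriv_const, fieldDeriv_const, sub_zero] at h1
  set u := mlieBracket 𝓘(ℝ, EP) H K p with hu
  -- The hypothesis on `C` concerns global horizontal fields, so the single vector `u` is extended
  -- before projecting. Both `u` and its horizontal part then kill `C`, hence so does the vertical
  -- part, which acts by `-[θ(u), C]`.
  obtain ⟨W, hW, hWp⟩ := exists_isSmoothField p u
  have h2 := hD _ (isSmoothField_horPart hT hinj hθ hW) (fun q => form_horPart hθ q _) p
  have hv : mfderiv 𝓘(ℝ, EP) 𝓘(ℝ, EM) B.proj p (u - horPart B θ p u) = 0 := by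
    rw [map_sub, mfderiv_proj_horPart hθ, sub_self]
  have h3 := mfderiv_vertical_conj hT hθ (hC.mdifferentiableAt p) (hC.equivariant p) hv
  rw [map_sub (θ p), form_horPart hθ, sub_zero] at h3
  have h4 : mfderiv 𝓘(ℝ, EP) 𝓘(ℝ, V →L[ℂ] V) C p (u - horPart B θ p u) = 0 := by
    rw [map_sub]
    simp only [fieldDeriv, hWp] at h1 h2
    rw [h2]
    exact (sub_zero _).trans h1
  exact neg_eq_zero.1 (h3.symm.trans h4)

include hT hinj hθ in
-- Both `F` and `-θ(ξ)` have covariant differential `Ω(X^*,·)`, so `C = F + θ(ξ)` has none: `F` is a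
-- moment function up to a horizontal constant.
theorem exists_infAut_sub_const {F : P → (V →L[ℂ] V)} {X : VField EM M}
    (h : (F, X) ∈ hamPairs B T θ) : ∃ (ξ : VField EP P) (C : P → (V →L[ℂ] V)),
      IsInfAut G θ ξ ∧ (∀ p, mfderiv 𝓘(ℝ, EP) 𝓘(ℝ, EM) B.proj p (ξ p) = X (B.proj p)) ∧
      IsGaugeFun EP EG T C ∧ (∀ p, F p = -θ p (ξ p) + C p) ∧
      ∀ H : VField EP P, IsSmoothField H → (∀ q, θ q (H q) = 0) → ∀ p, fieldDeriv H C p = 0 := by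
  obtain ⟨hF, ⟨hX, ξ, hξ, hξX⟩, hFX⟩ := h
  have hG := isGaugeFun_form hθ hξ.smooth hξ.isInvariantField
  refine ⟨ξ, F + (1 : ℝ) • fun q => θ q (ξ q), hξ, hξX, hF.add_smul 1 hG, fun p => by simp, ?_⟩
  intro H hH hH0 p
  have hHh : (fun q => horPart B θ q (H q)) = H := funext fun q => (eq_hlift hT hinj hθ (hH0 q)).symm
  have h1 := hFX H hH p
  have h2 := curv_eq_covDiff_form hT hinj hθ hξ hX hξX hH p
  have h3 := covDiff_add_smul (B := B) (θ := θ) hF 1 hG H p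
  have h4 : covDiff B θ (F + (1 : ℝ) • fun q => θ q (ξ q)) H p =
    fieldDeriv H (F + (1 : ℝ) • fun q => θ q (ξ q)) p := by rw [covDiff, hHh]
  have h5 : covDiff B θ (-fun q => θ q (ξ q)) H p = - covDiff B θ (fun q => θ q (ξ q)) H p :=
    fieldDeriv_neg _
  rw [← h4, h3, one_smul]
  dsimp only at h1
  rw [← h1, h2, h5, neg_add_cancel]

end HamiltonianPairs

/-! ### Closure under the bracket, and uniqueness of the Hamiltonian field -/

section Bracket

variable {EP EM EG P M G V : Type*}
  [NormedAddCommGroup EP] [NormedSpace ℝ EP] [FiniteDimensional ℝ EP]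
  [NormedAddCommGroup EM] [NormedSpace ℝ EM] [FiniteDimensional ℝ EM]
  [NormedAddCommGroup EG] [NormedSpace ℝ EG] [FiniteDimensional ℝ EG]
  [TopologicalSpace P] [T2Space P] [ChartedSpace EP P]
  [TopologicalSpace M] [T2Space M] [ChartedSpace EM M]
  [TopologicalSpace G] [ChartedSpace EG G] [Group G] [MulAction Gᵐᵒᵖ P]
  [NormedAddCommGroup V] [InnerProductSpace ℂ V] [FiniteDimensional ℂ V]
  [IsManifold 𝓘(ℝ, EP) ∞ P] [IsManifold 𝓘(ℝ, EM) ∞ M] [LieGroup 𝓘(ℝ, EG) ∞ G]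
  {B : PrincipalBundle EP EM EG P M G} {T : G →* (V ≃ₗᵢ[ℂ] V)} {θ : OneForm EP P V}

theorem opLie_add (A C D : V →L[ℂ] V) : ⁅A, C + D⁆ = ⁅A, C⁆ + ⁅A, D⁆ := map_add (lieCLM V A) C D

theorem opLie_neg (A C : V →L[ℂ] V) : ⁅A, -C⁆ = -⁅A, C⁆ := map_neg (lieCLM V A) C

theorem opLie_zero (A : V →L[ℂ] V) : ⁅A, (0 : V →L[ℂ] V)⁆ = 0 := map_zero (lieCLM V A)

theorem opLie_skew (A C : V →L[ℂ] V) : ⁅A, C⁆ = -⁅C, A⁆ := (neg_sub (C * A) (A * C)).symm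

theorem add_opLie (A C D : V →L[ℂ] V) : ⁅A + C, D⁆ = ⁅A, D⁆ + ⁅C, D⁆ := by
  rw [opLie_skew, opLie_add, neg_add, ← opLie_skew, ← opLie_skew]

theorem neg_opLie (A C : V →L[ℂ] V) : ⁅-A, C⁆ = -⁅A, C⁆ := by
  rw [opLie_skew, opLie_neg, neg_neg, opLie_skew A C, neg_neg]

theorem zero_opLie (A : V →L[ℂ] V) : ⁅(0 : V →L[ℂ] V), A⁆ = 0 := by
  rw [opLie_skew, opLie_zero, neg_zero]

theorem fieldDeriv_lie {F K : P → (V →L[ℂ] V)} {ξ : VField EP P} {p : P}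
    (hF : MDifferentiableAt 𝓘(ℝ, EP) 𝓘(ℝ, V →L[ℂ] V) F p)
    (hK : MDifferentiableAt 𝓘(ℝ, EP) 𝓘(ℝ, V →L[ℂ] V) K p) :
    fieldDeriv ξ (fun q => ⁅F q, K q⁆) p = ⁅fieldDeriv ξ F p, K p⁆ + ⁅F p, fieldDeriv ξ K p⁆ :=
  fieldDeriv_bilin (lieCLM V) hF hK

variable (hT : ContMDiff 𝓘(ℝ, EG) 𝓘(ℝ, V →L[ℂ] V) ∞ (repOp T)) (hinj : Function.Injective T)
  (hθ : IsConnectionForm B T θ)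

include hT hinj hθ in
theorem curv_hliftField_swap (X Y : VField EM M) (p : P) :
    curv B θ (hliftField B θ Y) (hliftField B θ X) p =
      -curv B θ (hliftField B θ X) (hliftField B θ Y) p := by
  rw [curv_hliftField_hliftField hT hinj hθ, curv_hliftField_hliftField hT hinj hθ,
    mlieBracket_swap_apply, map_neg]

include hT hinj hθ in
-- Here `-Ω(X^*, Y^*) = θ([X^*, Y^*])` is `θ` evaluated on an invariant smooth field, which makes it
-- a gauge function.
theorem isGaugeFun_hamBracket {a b : (P → (V →L[ℂ] V)) × VField EM M} (ha : a ∈ hamPairs B T θ)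
    (hb : b ∈ hamPairs B T θ) : IsGaugeFun EP EG T (hamBracket B θ a b).1 := by
  have hXs := isSmoothField_hliftField hT hinj hθ ha.2.1.1
  have hYs := isSmoothField_hliftField hT hinj hθ hb.2.1.1
  have h1 := isGaugeFun_form hθ (hXs.mlieBracket hYs)
    ((isInvariantField_hliftField hT hinj hθ a.2).mlieBracket B
      (isInvariantField_hliftField hT hinj hθ b.2) hXs hYs)
  have h2 := h1.add_smul 1 (ha.1.lie hT hb.1)
  have h3 : (hamBracket B θ a b).1 = (fun q => θ q (mlieBracket 𝓘(ℝ, EP) (hliftField B θ a.2)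
      (hliftField B θ b.2) q)) + (1 : ℝ) • fun q => ⁅a.1 q, b.1 q⁆ := by
    funext q
    simp only [hamBracket, curv_hliftField_hliftField hT hinj hθ, neg_neg, Pi.add_apply, one_smul]
  rw [h3]
  exact h2

include hT hinj hθ in
/-- The function of the bracket of two infinitesimal automorphisms. -/
theorem form_mlieBracket_infAut {ξ η : VField EP P} (hξ : IsInfAut G θ ξ) (hη : IsInfAut G θ η)
    {X Y : VField EM M} (hX : IsSmoothField X) (hY : IsSmoothField Y)
    (hξX : ∀ p, mfderiv 𝓘(ℝ, EP) 𝓘(ℝ, EM) B.proj p (ξ p) = X (B.proj p))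
    (hηY : ∀ p, mfderiv 𝓘(ℝ, EP) 𝓘(ℝ, EM) B.proj p (η p) = Y (B.proj p)) (p : P) :
    -θ p (mlieBracket 𝓘(ℝ, EP) ξ η p) =
      -curv B θ (hliftField B θ X) (hliftField B θ Y) p + ⁅θ p (ξ p), θ p (η p)⁆ := by
  have hG := isGaugeFun_form hθ hη.smooth hη.isInvariantField
  have hXs := isSmoothField_hliftField hT hinj hθ hX
  have hv : mfderiv 𝓘(ℝ, EP) 𝓘(ℝ, EM) B.proj p (ξ p - hliftField B θ X p) = 0 := by
    rw [map_sub, hξX, mfderiv_proj_hliftField hθ, sub_self]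
  have h1 := mfderiv_vertical_conj hT hθ (hG.mdifferentiableAt p) (hG.equivariant p) hv
  rw [map_sub (θ p), form_hliftField hθ, sub_zero] at h1
  have h2 : fieldDeriv (ξ - hliftField B θ X) (fun q => θ q (η q)) p = _ := h1
  rw [fieldDeriv_sub_left] at h2
  -- Since `θ([ξ,η]) = ξ θ(η)`, the two parts of `ξ` are treated apart: the vertical one gives
  -- `-[θ(ξ), θ(η)]`, and this identity gives `X^*θ(η) = Ω(X^*, Y^*)` for the horizontal one.
  have h3 := curv_eq_covDiff_form hT hinj hθ hη hY hηY hXs p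
  have h4 : covDiff B θ (-fun q => θ q (η q)) (hliftField B θ X) p =
      -fieldDeriv (hliftField B θ X) (fun q => θ q (η q)) p := by
    rw [covDiff, fieldDeriv_neg]
    exact congrArg Neg.neg (fieldDeriv_congr_left _ (horPart_hliftField hT hinj hθ X p))
  rw [h4, curv_hliftField_swap hT hinj hθ, neg_inj] at h3
  rw [hξ.form_mlieBracket hη.smooth, h3, sub_eq_iff_eq_add.1 h2]
  abel

include hT hinj hθ in
theorem lie_curv_eq_zero {C : P → (V →L[ℂ] V)} (hC : IsGaugeFun EP EG T C)
    (hD : ∀ H : VField EP P, IsSmoothField H → (∀ q, θ q (H q) = 0) → ∀ p, fieldDeriv H C p = 0)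
    {X : VField EM M} (hX : IsSmoothField X) {W : VField EP P} (hW : IsSmoothField W) (p : P) :
    ⁅curv B θ (hliftField B θ X) W p, C p⁆ = 0 := by
  rw [curv_hliftField_eq hT hinj hθ, neg_opLie, lie_form_mlieBracket_eq_zero hT hinj hθ hC hD
    (isSmoothField_hliftField hT hinj hθ hX) (form_hliftField hθ X)
    (isSmoothField_horPart hT hinj hθ hW) (fun q => form_horPart hθ q _), neg_zero]

include hT hinj hθ in
theorem hamBracket_mem {a b : (P → (V →L[ℂ] V)) × VField EM M} (ha : a ∈ hamPairs B T θ)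
    (hb : b ∈ hamPairs B T θ) : hamBracket B θ a b ∈ hamPairs B T θ := by
  obtain ⟨F, X⟩ := a
  obtain ⟨K, Y⟩ := b
  obtain ⟨ξ, C, hξ, hξX, hC, hFC, hCD⟩ := exists_infAut_sub_const hT hinj hθ ha
  obtain ⟨η, C', hη, hηY, hC', hKC, hCD'⟩ := exists_infAut_sub_const hT hinj hθ hb
  have hX : IsSmoothField X := ha.2.1.1
  have hY : IsSmoothField Y := hb.2.1.1
  have hXY : IsSmoothField (mlieBracket 𝓘(ℝ, EM) X Y) := hX.mlieBracket hY
  have hbr : IsInfAut G θ (mlieBracket 𝓘(ℝ, EP) ξ η) := hξ.mlieBracket hθ hη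
  have hbrX : ∀ p, mfderiv 𝓘(ℝ, EP) 𝓘(ℝ, EM) B.proj p (mlieBracket 𝓘(ℝ, EP) ξ η p) =
      mlieBracket 𝓘(ℝ, EM) X Y (B.proj p) :=
    mfderiv_mlieBracket_of_related B.contMDiff_proj hξ.smooth hη.smooth hX hY hξX hηY
  refine ⟨isGaugeFun_hamBracket hT hinj hθ ha hb, ⟨hXY, _, hbr, hbrX⟩, ?_⟩
  intro W hW p
  refine (curv_eq_covDiff_form hT hinj hθ hbr hXY hbrX hW p).trans ?_
  have hF : IsGaugeFun EP EG T F := ha.1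
  have hK : IsGaugeFun EP EG T K := hb.1
  have hGξ := isGaugeFun_form hθ hξ.smooth hξ.isInvariantField
  have hGb := isGaugeFun_form hθ hbr.smooth hbr.isInvariantField
  -- Write `[F,K] = [θ(ξ),θ(η)] - [θ(ξ),C'] + [C,K]`, leaving `K` whole in the last term. The first
  -- summand joins the curvature to form `-θ([ξ,η])`.
  have h1 : (hamBracket B θ (F, X) (K, Y)).1 = (-fun q => θ q (mlieBracket 𝓘(ℝ, EP) ξ η q)) +
      ((fun q => ⁅C q, K q⁆) - fun q => ⁅θ q (ξ q), C' q⁆) := by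
    funext q
    simp only [hamBracket, Pi.add_apply, Pi.neg_apply, Pi.sub_apply]
    rw [form_mlieBracket_infAut hT hinj hθ hξ hη hX hY hξX hηY, hFC, hKC]
    simp only [opLie_add, add_opLie, opLie_neg, neg_opLie, neg_neg]
    abel
  have hWs := isSmoothField_horPart hT hinj hθ hW
  have hFW : covDiff B θ (-fun q => θ q (ξ q)) W p = curv B θ (hliftField B θ X) W p :=
    (curv_eq_covDiff_form hT hinj hθ hξ hX hξX hW p).symm
  have hKW : curv B θ (hliftField B θ Y) W p = covDiff B θ K W p := hb.2.2 W hW p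
  rw [covDiff] at hFW hKW
  rw [fieldDeriv_neg] at hFW
  -- The correction terms are horizontally constant: the covariant differentials of `K` and `θ(ξ)`
  -- are curvatures up to sign, and `C`, `C'` commute with curvature.
  have hz1 : fieldDeriv (fun q => horPart B θ q (W q)) (fun q => ⁅C q, K q⁆) p = 0 := by
    rw [fieldDeriv_lie (hC.mdifferentiableAt p) (hK.mdifferentiableAt p),
      hCD _ hWs (fun q => form_horPart hθ q _), ← hKW, zero_opLie, zero_add, opLie_skew,
      lie_curv_eq_zero hT hinj hθ hC hCD hY hW, neg_zero]
  have hz2 : fieldDeriv (fun q => horPart B θ q (W q)) (fun q => ⁅θ q (ξ q), C' q⁆) p = 0 := by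
    rw [fieldDeriv_lie (hGξ.mdifferentiableAt p) (hC'.mdifferentiableAt p),
      hCD' _ hWs (fun q => form_horPart hθ q _), ← neg_neg (fieldDeriv _ (fun q => θ q (ξ q)) p),
      hFW, opLie_zero, add_zero, neg_opLie, lie_curv_eq_zero hT hinj hθ hC' hCD' hX hW, neg_zero]
  have hm1 := (hC.lie hT hK).mdifferentiableAt p
  have hm2 := (hGξ.lie hT hC').mdifferentiableAt p
  rw [h1, covDiff, covDiff, fieldDeriv_add (hGb.mdifferentiableAt p).neg (hm1.sub hm2),
    fieldDeriv_sub hm1 hm2, hz1, hz2, sub_zero, add_zero]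

include hT hinj hθ in
-- Two fields for the same `F` have the same contraction with `Ω`, so the lift of their difference
-- is annihilated.
theorem injOn_fst_hamPairs (hns : CurvNonsingular B θ) :
    Set.InjOn Prod.fst (hamPairs B T θ) := by
  rintro ⟨F, X⟩ ha ⟨F', Y⟩ hb (rfl : F = F')
  have hX : IsSmoothField X := ha.2.1.1
  have hY : IsSmoothField Y := hb.2.1.1
  refine Prod.ext rfl ?_
  funext m
  obtain ⟨p, rfl⟩ := B.proj_surjective m
  have h := hns (X + (-1 : ℝ) • Y) (hX.add (hY.const_smul (-1))) p fun Z hZ => by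
    have hZs := isSmoothField_hliftField hT hinj hθ hZ
    have h1 : curv B θ (hliftField B θ X) (hliftField B θ Z) p = _ := ha.2.2 _ hZs p
    have h2 : curv B θ (hliftField B θ Y) (hliftField B θ Z) p = _ := hb.2.2 _ hZs p
    rw [curv_hliftField_add_smul hT hinj hθ hX (-1) hY, h1, h2, neg_one_smul, add_neg_cancel]
  have h' : X (B.proj p) + (-1 : ℝ) • Y (B.proj p) = 0 := h
  rw [neg_one_smul] at h'
  exact eq_of_sub_eq_zero ((sub_eq_add_neg _ _).trans h')

end Bracket

/-! ### Separation of tangent vectors by functions -/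

section Separation

variable {E N : Type*} [NormedAddCommGroup E] [NormedSpace ℝ E] [FiniteDimensional ℝ E]
  [TopologicalSpace N] [T2Space N] [ChartedSpace E N] [IsManifold 𝓘(ℝ, E) ∞ N]

/-- Smooth functions separate tangent vectors. -/
theorem eq_zero_of_forall_mfderiv_eq_zero {x : N} {u : TangentSpace 𝓘(ℝ, E) x}
    (hu : ∀ h : N → ℝ, ContMDiff 𝓘(ℝ, E) 𝓘(ℝ, ℝ) ∞ h → mfderiv 𝓘(ℝ, E) 𝓘(ℝ, ℝ) h x u = 0) :
    u = 0 := by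
  obtain ⟨χ⟩ : Nonempty (SmoothBumpFunction 𝓘(ℝ, E) x) := inferInstance
  -- The cut-off chart is a global smooth map that agrees with the chart near `x`; composing it with
  -- linear functionals gives enough real test functions.
  have hg : ContMDiff 𝓘(ℝ, E) 𝓘(ℝ, E) ∞ (fun y => χ y • extChartAt 𝓘(ℝ, E) x y) :=
    χ.contMDiff_smul contMDiffOn_extChartAt
  have hge : (fun y => χ y • extChartAt 𝓘(ℝ, E) x y) =ᶠ[𝓝 x] extChartAt 𝓘(ℝ, E) x := by
    filter_upwards [χ.eventuallyEq_one] with y hy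
    rw [hy, Pi.one_apply, one_smul]
  have hgd : MDifferentiableAt 𝓘(ℝ, E) 𝓘(ℝ, E) (fun y => χ y • extChartAt 𝓘(ℝ, E) x y) x :=
    (hg x).mdifferentiableAt (by simp)
  have h0 : (mfderiv 𝓘(ℝ, E) 𝓘(ℝ, E) (fun y => χ y • extChartAt 𝓘(ℝ, E) x y) x u : E) = 0 := by
    have hsep : ∀ w : E, (∀ L : E →L[ℝ] ℝ, L w = 0) → w = 0 := fun w hw =>
      SeparatingDual.eq_zero_of_forall_dual_eq_zero hw
    refine hsep _ fun L => ?_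
    exact (mfderiv_clm_apply L hgd u).symm.trans (hu _ (L.contMDiff.comp hg))
  rw [hge.mfderiv_eq] at h0
  obtain ⟨e, he⟩ := isInvertible_mfderiv_extChartAt (I := 𝓘(ℝ, E)) (mem_extChartAt_source (I := 𝓘(ℝ, E)) x)
  refine e.injective ?_
  have h1 := congrArg (fun A => A u) he
  exact h1.trans (h0.trans (map_zero e).symm)

end Separation

/-! ### Sections of the associated bundle as equivariant functions -/

section Sections

variable {EP EM EG P M G V : Type*}
  [NormedAddCommGroup EP] [NormedSpace ℝ EP] [FiniteDimensional ℝ EP]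
  [NormedAddCommGroup EM] [NormedSpace ℝ EM] [FiniteDimensional ℝ EM]
  [NormedAddCommGroup EG] [NormedSpace ℝ EG] [FiniteDimensional ℝ EG]
  [TopologicalSpace P] [T2Space P] [ChartedSpace EP P]
  [TopologicalSpace M] [T2Space M] [ChartedSpace EM M]
  [TopologicalSpace G] [ChartedSpace EG G] [Group G] [MulAction Gᵐᵒᵖ P]
  [NormedAddCommGroup V] [InnerProductSpace ℂ V] [FiniteDimensional ℂ V]
  [IsManifold 𝓘(ℝ, EP) ∞ P] [IsManifold 𝓘(ℝ, EM) ∞ M] [LieGroup 𝓘(ℝ, EG) ∞ G]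
  {B : PrincipalBundle EP EM EG P M G} {T : G →* (V ≃ₗᵢ[ℂ] V)} {θ : OneForm EP P V}

theorem AssocSection.mk_toFun_of_proj_eq (s : AssocSection B T) {m : M} (q : P)
    (h : B.proj q = m) : AssocFiber.mk B T q h (s.toFun q) = s m := by
  subst h
  exact s.mk_toFun q

theorem AssocSection.toFun_act (s : AssocSection B T) (p : P) (g : G) :
    s.toFun (op g • p) = repOp T g⁻¹ (s.toFun p) := by
  apply (AssocFiber.mk_bijective B T (op g • p) (B.proj_act p g)).1
  rw [s.mk_toFun_of_proj_eq]
  exact (s.mk_toFun p).symm.trans (AssocFiber.mk_act B T p rfl g (s.toFun p)).symm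

/-- The linear map sending a section to its equivariant function. -/
def AssocSection.toFunLinear (B : PrincipalBundle EP EM EG P M G) (T : G →* (V ≃ₗᵢ[ℂ] V)) :
    AssocSection B T →ₗ[ℂ] (P → V) where
  toFun s := s.toFun
  map_add' s t := funext fun p => by simpa using s.toFun_add_smul t 1 p
  map_smul' c s := by
    have h0 : ∀ p, AssocSection.toFun (0 : AssocSection B T) p = 0 := fun p => by
      simpa using AssocSection.toFun_add_smul (0 : AssocSection B T) 0 (-1) p
    funext p
    simpa [h0] using AssocSection.toFun_add_smul (0 : AssocSection B T) s c p

theorem AssocSection.toFunLinear_injective :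
    Function.Injective (AssocSection.toFunLinear B T) := by
  intro s t h
  funext m
  rw [← s.mk_toFun_of_proj_eq _ (B.proj_pt m), ← t.mk_toFun_of_proj_eq _ (B.proj_pt m)]
  exact congrArg _ (congrFun h _)

/-- The section of the associated bundle given by a function on the total space. -/
def AssocSection.ofFun (B : PrincipalBundle EP EM EG P M G) (T : G →* (V ≃ₗᵢ[ℂ] V)) (f : P → V) :
    AssocSection B T :=
  fun m => AssocFiber.mk B T (B.pt m) (B.proj_pt m) (f (B.pt m))

/-- The section is defined through the chosen point `B.pt m`; equivariance makes the class
independent of that choice. -/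
theorem AssocSection.toFun_ofFun {f : P → V} (hf : ∀ p g, f (op g • p) = repOp T g⁻¹ (f p)) :
    (AssocSection.ofFun B T f).toFun = f := by
  funext p
  rw [AssocSection.toFun_eq_iff]
  have key : ∀ (q : P) (m : M) (hq : B.proj q = m) (hp : B.proj p = m),
      AssocFiber.mk B T q hq (f q) = AssocFiber.mk B T p hp (f p) := by
    intro q m hq hp
    obtain ⟨g, rfl, -⟩ := B.existsUnique_act (hp.trans hq.symm)
    rw [hf]
    exact AssocFiber.mk_act B T p hp g (f p)
  exact key _ _ _ _

theorem IsEquivFun.ofFun_mem {f : P → V} (hf : IsEquivFun EP T f) :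
    AssocSection.ofFun B T f ∈ SmoothSections B T := by
  intro U σ hU hσ hp
  rw [AssocSection.toFun_ofFun hf.act]
  exact hf.smooth.comp_contMDiffOn hσ

/-- Smoothness along local sections propagates over the fibres through `f(q) = T(γ(q)⁻¹)
f(σ(π(q)))`. -/
theorem isEquivFun_toFun (hT : ContMDiff 𝓘(ℝ, EG) 𝓘(ℝ, V →L[ℂ] V) ∞ (repOp T))
    {s : AssocSection B T} (hs : s ∈ SmoothSections B T) : IsEquivFun EP T s.toFun where
  act := s.toFun_act
  smooth := by
    intro p
    obtain ⟨U, σ, γ, h⟩ := B.exists_isLocalSection p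
    have h1 : ContMDiffAt 𝓘(ℝ, EP) 𝓘(ℝ, V) ∞ (fun q => s.toFun (σ (B.proj q))) p :=
      ((hs U σ h.isOpen h.smooth_section h.proj_section).contMDiffAt
        (h.isOpen.mem_nhds h.mem)).comp p (B.contMDiff_proj p)
    have h2 : ContMDiffAt 𝓘(ℝ, EP) 𝓘(ℝ, V →L[ℂ] V) ∞ (fun q => repOp T (γ q)⁻¹) p :=
      (hT.comp (contMDiff_inv 𝓘(ℝ, EG) ∞)).contMDiffAt.comp p (h.contMDiffAt_group h.mem)
    have h3 : ContMDiffAt 𝓘(ℝ, EP) 𝓘(ℝ, V) ∞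
        (fun q => repOp T (γ q)⁻¹ (s.toFun (σ (B.proj q)))) p :=
      ((ContinuousLinearMap.restrictScalarsL ℂ V V ℝ ℝ).contMDiff.contMDiffAt.comp p h2).clm_apply h1
    refine h3.congr_of_eventuallyEq ?_
    filter_upwards [h.isOpen_preimage.mem_nhds h.mem] with q hq
    rw [← s.toFun_act, h.act_section q hq]

theorem toFun_tildeOp {F : P → (V →L[ℂ] V)} (hF : IsGaugeFun EP EG T F) (s : AssocSection B T) :
    (tildeOp F s).toFun = fun p => F p (s.toFun p) := by
  funext p
  rw [AssocSection.toFun_eq_iff]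
  exact tildeOp_apply hF.equivariant s p _ (s.mk_toFun p).symm

variable (hT : ContMDiff 𝓘(ℝ, EG) 𝓘(ℝ, V →L[ℂ] V) ∞ (repOp T)) (hinj : Function.Injective T)
  (hθ : IsConnectionForm B T θ)

include hT hinj hθ in
theorem IsEquivFun.fieldDeriv_hliftField {X : VField EM M} (hX : IsSmoothField X) {f : P → V}
    (hf : IsEquivFun EP T f) : IsEquivFun EP T (GaugePrequantization.fieldDeriv (hliftField B θ X) f) :=
  hf.fieldDeriv B (isSmoothField_hliftField hT hinj hθ hX) (isInvariantField_hliftField hT hinj hθ X)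

include hT hinj hθ in
-- By definition `nabla θ X s` is `ofFun` of `X^*f`, and `X^*f` is equivariant because `X^*` is
-- invariant; this is the independence of the point over `m`.
theorem toFun_nabla {X : VField EM M} (hX : IsSmoothField X) {s : AssocSection B T}
    (hs : s ∈ SmoothSections B T) :
    (nabla θ X s).toFun = fieldDeriv (hliftField B θ X) s.toFun :=
  AssocSection.toFun_ofFun ((isEquivFun_toFun hT hs).fieldDeriv_hliftField hT hinj hθ hX).act

include hT hinj hθ in
theorem nabla_mem {X : VField EM M} (hX : IsSmoothField X) {s : AssocSection B T}
    (hs : s ∈ SmoothSections B T) : nabla θ X s ∈ SmoothSections B T :=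
  ((isEquivFun_toFun hT hs).fieldDeriv_hliftField hT hinj hθ hX).ofFun_mem

theorem IsEquivFun.gauge_apply {F : P → (V →L[ℂ] V)} (hF : IsGaugeFun EP EG T F) {f : P → V}
    (hf : IsEquivFun EP T f) : IsEquivFun EP T (fun p => F p (f p)) where
  smooth := ((ContinuousLinearMap.restrictScalarsL ℂ V V ℝ ℝ).contMDiff.comp hF.smooth).clm_apply
    hf.smooth
  act p g := by
    have h : repOp T g (repOp T g⁻¹ (f p)) = f p := by
      rw [← mul_apply_eq_comp, repOp_mul_inv]; rfl
    rw [hF.equivariant, hf.act]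
    exact congrArg (fun v => repOp T g⁻¹ (F p v)) h

include hT in
theorem tildeOp_mem {F : P → (V →L[ℂ] V)} (hF : IsGaugeFun EP EG T F) {s : AssocSection B T}
    (hs : s ∈ SmoothSections B T) : tildeOp F s ∈ SmoothSections B T :=
  ((isEquivFun_toFun hT hs).gauge_apply hF).ofFun_mem

end Sections

/-! ### The prequantization operators: linearity, injectivity, commutators -/

section Quantization

variable {EP EM EG P M G V : Type*}
  [NormedAddCommGroup EP] [NormedSpace ℝ EP] [FiniteDimensional ℝ EP]
  [NormedAddCommGroup EM] [NormedSpace ℝ EM] [FiniteDimensional ℝ EM]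
  [NormedAddCommGroup EG] [NormedSpace ℝ EG] [FiniteDimensional ℝ EG]
  [TopologicalSpace P] [T2Space P] [ChartedSpace EP P]
  [TopologicalSpace M] [T2Space M] [ChartedSpace EM M]
  [TopologicalSpace G] [ChartedSpace EG G] [Group G] [MulAction Gᵐᵒᵖ P]
  [NormedAddCommGroup V] [InnerProductSpace ℂ V] [FiniteDimensional ℂ V]
  [IsManifold 𝓘(ℝ, EP) ∞ P] [IsManifold 𝓘(ℝ, EM) ∞ M] [LieGroup 𝓘(ℝ, EG) ∞ G]
  {B : PrincipalBundle EP EM EG P M G} {T : G →* (V ≃ₗᵢ[ℂ] V)} {θ : OneForm EP P V}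

/-- The operator `f ↦ -(X^* f + F f)` on equivariant functions. -/
def quantFun (B : PrincipalBundle EP EM EG P M G) (θ : OneForm EP P V)
    (a : (P → (V →L[ℂ] V)) × VField EM M) (f : P → V) : P → V :=
  -(fieldDeriv (hliftField B θ a.2) f + fun p => a.1 p (f p))

theorem fieldDeriv_const_smul {ξ : VField EP P} {f : P → V} (c : ℂ) {p : P}
    (hf : MDifferentiableAt 𝓘(ℝ, EP) 𝓘(ℝ, V) f p) :
    fieldDeriv ξ (c • f) p = c • fieldDeriv ξ f p :=
  fieldDeriv_clm ((c • ContinuousLinearMap.id ℂ V).restrictScalars ℝ) hf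

theorem fieldDeriv_smul_fun {ξ : VField EP P} {h : P → ℝ} {f : P → V} {p : P}
    (hh : MDifferentiableAt 𝓘(ℝ, EP) 𝓘(ℝ, ℝ) h p)
    (hf : MDifferentiableAt 𝓘(ℝ, EP) 𝓘(ℝ, V) f p) :
    fieldDeriv ξ (fun q => h q • f q) p = fieldDeriv ξ h p • f p + h p • fieldDeriv ξ f p :=
  fieldDeriv_bilin (ContinuousLinearMap.lsmul ℝ ℝ) hh hf

theorem IsEquivFun.quantFun_add {f k : P → V} (hf : IsEquivFun EP T f) (hk : IsEquivFun EP T k)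
    (a : (P → (V →L[ℂ] V)) × VField EM M) :
    quantFun B θ a (f + k) = quantFun B θ a f + quantFun B θ a k := by
  funext p
  simp only [quantFun, Pi.neg_apply, Pi.add_apply, map_add,
    fieldDeriv_add (hf.mdifferentiableAt p) (hk.mdifferentiableAt p)]
  abel

theorem IsEquivFun.quantFun_smul {f : P → V} (hf : IsEquivFun EP T f) (c : ℂ)
    (a : (P → (V →L[ℂ] V)) × VField EM M) :
    quantFun B θ a (c • f) = c • quantFun B θ a f := by
  funext p
  simp only [quantFun, Pi.neg_apply, Pi.add_apply, Pi.smul_apply, map_smul, smul_neg, smul_add,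
    fieldDeriv_const_smul c (hf.mdifferentiableAt p)]

theorem IsEquivFun.base_smul (B : PrincipalBundle EP EM EG P M G) {f : P → V}
    (hf : IsEquivFun EP T f) {h : M → ℝ} (hh : ContMDiff 𝓘(ℝ, EM) 𝓘(ℝ, ℝ) ∞ h) :
    IsEquivFun EP T (fun p => h (B.proj p) • f p) where
  smooth := (hh.comp B.contMDiff_proj).smul hf.smooth
  act p g := by
    rw [B.proj_act, hf.act, ContinuousLinearMap.map_smul_of_tower]

variable (hT : ContMDiff 𝓘(ℝ, EG) 𝓘(ℝ, V →L[ℂ] V) ∞ (repOp T)) (hinj : Function.Injective T)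
  (hθ : IsConnectionForm B T θ)

include hT hinj hθ in
theorem quantFun_add_smul_left (c : ℝ) (a b : (P → (V →L[ℂ] V)) × VField EM M) (f : P → V) :
    quantFun B θ (a + c • b) f = quantFun B θ a f + c • quantFun B θ b f := by
  funext p
  have h1 : fieldDeriv (hliftField B θ (a + c • b).2) f p =
      fieldDeriv (hliftField B θ a.2) f p + c • fieldDeriv (hliftField B θ b.2) f p := by
    rw [show (a + c • b).2 = a.2 + c • b.2 from rfl, hliftField_add_smul hT hinj hθ,
      fieldDeriv_add_left, fieldDeriv_smul_left]
  have h2 : (a + c • b).1 p (f p) = a.1 p (f p) + c • b.1 p (f p) := rfl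
  simp only [quantFun, Pi.neg_apply, Pi.add_apply, Pi.smul_apply, h1, h2, smul_neg, smul_add]
  abel

include hT hinj hθ in
-- The first-order part is the only obstruction to linearity over functions on `M`, so it can be
-- read off separately from `F`. A nonzero value of `f` at `p` is needed, hence `V ≠ 0`.
theorem eq_zero_of_forall_quantFun_eq_zero [Nontrivial V] {F : P → (V →L[ℂ] V)} {X : VField EM M}
    (h : ∀ f : P → V, IsEquivFun EP T f → quantFun B θ (F, X) f = 0) : F = 0 ∧ X = 0 := by
  have h' : ∀ f : P → V, IsEquivFun EP T f → ∀ p,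
      fieldDeriv (hliftField B θ X) f p + F p (f p) = 0 := fun f hf p =>
    neg_eq_zero.1 (congrFun (h f hf) p)
  have hX : X = 0 := by
    funext m
    obtain ⟨p, rfl⟩ := B.proj_surjective m
    refine eq_zero_of_forall_mfderiv_eq_zero fun k hk => ?_
    obtain ⟨v, hv⟩ := exists_ne (0 : V)
    obtain ⟨f, hf, rfl⟩ := exists_isEquivFun B hT p v
    have h1 := h' _ (hf.base_smul B hk) p
    have hkd : MDifferentiableAt 𝓘(ℝ, EM) 𝓘(ℝ, ℝ) k (B.proj p) :=
      (hk (B.proj p)).mdifferentiableAt (by simp)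
    have h2 : fieldDeriv (hliftField B θ X) (k ∘ B.proj) p = fieldDeriv X k (B.proj p) :=
      fieldDeriv_comp hkd (B.mdifferentiableAt_proj p) (mfderiv_proj_hliftField hθ X p)
    have h3 := fieldDeriv_smul_fun (ξ := hliftField B θ X) (h := k ∘ B.proj)
      (hkd.comp p (B.mdifferentiableAt_proj p)) (hf.mdifferentiableAt p)
    rw [h2] at h3
    have h4 : F p (k (B.proj p) • f p) = k (B.proj p) • F p (f p) :=
      ContinuousLinearMap.map_smul_of_tower _ _ _
    -- Subtract `k` times the equation for `f` from the equation for `(k ∘ π) f`.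
    have h5 : fieldDeriv X k (B.proj p) • f p = 0 := by
      have h6 := h' f hf p
      have h7 := (congrArg₂ (· + ·) h3.symm h4.symm).trans h1
      simp only [Function.comp_apply] at h7
      rwa [add_assoc, ← smul_add, h6, smul_zero, add_zero] at h7
    exact (smul_eq_zero.1 h5).resolve_right hv
  refine ⟨?_, hX⟩
  funext p
  refine eq_zero_of_forall_isEquivFun B hT (p := p) fun f hf => ?_
  have h1 := h' f hf p
  have h2 : fieldDeriv (hliftField B θ X) f p = 0 := by
    have h3 : hliftField B θ X p = 0 := by
      subst hX
      exact (eq_hliftField hT hinj hθ (map_zero _) (map_zero _)).symm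
    exact (congrArg (mfderiv 𝓘(ℝ, EP) 𝓘(ℝ, V) f p) h3).trans (map_zero _)
  rwa [h2, zero_add] at h1

include hT hinj hθ in
/-- The curvature as the commutator of covariant derivatives. -/
theorem fieldDeriv_mlieBracket_hliftField {X Y : VField EM M} (hX : IsSmoothField X)
    (hY : IsSmoothField Y) {f : P → V} (hf : IsEquivFun EP T f) (p : P) :
    fieldDeriv (mlieBracket 𝓘(ℝ, EP) (hliftField B θ X) (hliftField B θ Y)) f p =
      fieldDeriv (hliftField B θ (mlieBracket 𝓘(ℝ, EM) X Y)) f p +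
        curv B θ (hliftField B θ X) (hliftField B θ Y) p (f p) := by
  have hXs := isSmoothField_hliftField hT hinj hθ hX
  have hYs := isSmoothField_hliftField hT hinj hθ hY
  have hv : mfderiv 𝓘(ℝ, EP) 𝓘(ℝ, EM) B.proj p
      (mlieBracket 𝓘(ℝ, EP) (hliftField B θ X) (hliftField B θ Y) p -
        hliftField B θ (mlieBracket 𝓘(ℝ, EM) X Y) p) = 0 := by
    rw [map_sub, mfderiv_mlieBracket_of_related B.contMDiff_proj hXs hYs hX hY
      (mfderiv_proj_hliftField hθ X) (mfderiv_proj_hliftField hθ Y), mfderiv_proj_hliftField hθ,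
      sub_self]
  have h1 := mfderiv_vertical_equivariant hT hθ (hf.mdifferentiableAt p) (hf.act p) hv
  rw [map_sub (θ p), form_hliftField hθ, sub_zero] at h1
  have h2 : fieldDeriv (mlieBracket 𝓘(ℝ, EP) (hliftField B θ X) (hliftField B θ Y) -
    hliftField B θ (mlieBracket 𝓘(ℝ, EM) X Y)) f p = _ := h1
  rw [fieldDeriv_sub_left] at h2
  rw [curv_hliftField_hliftField hT hinj hθ, ← sub_eq_iff_eq_add', h2]
  rfl

include hT hinj hθ in
theorem fieldDeriv_fst_of_mem_hamPairs {F : P → (V →L[ℂ] V)} {X Y : VField EM M}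
    (ha : (F, X) ∈ hamPairs B T θ) (hY : IsSmoothField Y) (p : P) :
    fieldDeriv (hliftField B θ Y) F p = curv B θ (hliftField B θ X) (hliftField B θ Y) p := by
  refine Eq.trans ?_ (ha.2.2 _ (isSmoothField_hliftField hT hinj hθ hY) p).symm
  exact fieldDeriv_congr_left _ (horPart_hliftField hT hinj hθ Y p).symm

include hT hinj hθ in
-- The product rule, with `X^*K` replaced by `Ω(Y^*, X^*)`; the mixed terms `K(X^*f) + F(Y^*f)` are
-- symmetric in the two pairs and drop out of the commutator.
theorem quantFun_quantFun {F K : P → (V →L[ℂ] V)} {X Y : VField EM M}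
    (ha : (F, X) ∈ hamPairs B T θ) (hb : (K, Y) ∈ hamPairs B T θ) {f : P → V}
    (hf : IsEquivFun EP T f) (p : P) :
    quantFun B θ (F, X) (quantFun B θ (K, Y) f) p =
      fieldDeriv (hliftField B θ X) (fieldDeriv (hliftField B θ Y) f) p +
        curv B θ (hliftField B θ Y) (hliftField B θ X) p (f p) +
        K p (fieldDeriv (hliftField B θ X) f p) + F p (fieldDeriv (hliftField B θ Y) f p) +
        F p (K p (f p)) := by
  have hK : IsGaugeFun EP EG T K := hb.1
  have h1 := (hf.fieldDeriv_hliftField hT hinj hθ hb.2.1.1).mdifferentiableAt p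
  have h2 := (hf.gauge_apply hK).mdifferentiableAt p
  have h3 := fieldDeriv_apply (ξ := hliftField B θ X) (hK.mdifferentiableAt p)
    (hf.mdifferentiableAt p)
  rw [fieldDeriv_fst_of_mem_hamPairs hT hinj hθ hb ha.2.1.1] at h3
  simp only [quantFun, Pi.neg_apply, Pi.add_apply, map_neg, map_add]
  rw [fieldDeriv_neg, fieldDeriv_add h1 h2, h3]
  abel

include hT hinj hθ in
-- Three curvature terms meet: `+Ω(X^*,Y^*)` from the commutator of the lifts and `-Ω(X^*,Y^*)` from
-- each of `X^*K` and `-Y^*F`. One negative copy survives.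
theorem quantFun_commutator {a b : (P → (V →L[ℂ] V)) × VField EM M} (ha : a ∈ hamPairs B T θ)
    (hb : b ∈ hamPairs B T θ) {f : P → V} (hf : IsEquivFun EP T f) :
    quantFun B θ a (quantFun B θ b f) - quantFun B θ b (quantFun B θ a f) =
      -quantFun B θ (hamBracket B θ a b) f := by
  obtain ⟨F, X⟩ := a
  obtain ⟨K, Y⟩ := b
  have hX : IsSmoothField X := ha.2.1.1
  have hY : IsSmoothField Y := hb.2.1.1
  funext p
  have h1 := fieldDeriv_mlieBracket ((hf.smooth p).of_le ENat.LEInfty.out)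
    ((isSmoothField_hliftField hT hinj hθ hX).mdifferentiableAt p)
    ((isSmoothField_hliftField hT hinj hθ hY).mdifferentiableAt p)
  rw [fieldDeriv_mlieBracket_hliftField hT hinj hθ hX hY hf] at h1
  have h2 : quantFun B θ (hamBracket B θ (F, X) (K, Y)) f p =
      -(fieldDeriv (hliftField B θ (mlieBracket 𝓘(ℝ, EM) X Y)) f p +
        (-curv B θ (hliftField B θ X) (hliftField B θ Y) p (f p) +
          (F p (K p (f p)) - K p (F p (f p))))) := rfl
  rw [Pi.sub_apply, quantFun_quantFun hT hinj hθ ha hb hf, quantFun_quantFun hT hinj hθ hb ha hf,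
    Pi.neg_apply, h2, eq_sub_of_add_eq h1, curv_hliftField_swap hT hinj hθ, neg_apply]
  abel

theorem toFun_neg_nabla_add_tildeOp (hT : ContMDiff 𝓘(ℝ, EG) 𝓘(ℝ, V →L[ℂ] V) ∞ (repOp T))
    (hinj : Function.Injective T) (hθ : IsConnectionForm B T θ)
    {a : (P → (V →L[ℂ] V)) × VField EM M} (ha : a ∈ hamPairs B T θ) {s : AssocSection B T}
    (hs : s ∈ SmoothSections B T) :
    AssocSection.toFun (-(nabla θ a.2 s + tildeOp a.1 s)) = quantFun B θ a s.toFun := by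
  refine (map_neg (AssocSection.toFunLinear B T) _).trans (congrArg Neg.neg ?_)
  refine (map_add (AssocSection.toFunLinear B T) _ _).trans (congrArg₂ (· + ·) ?_ ?_)
  · exact toFun_nabla hT hinj hθ ha.2.1.1 hs
  · exact toFun_tildeOp ha.1 s

/-- The prequantization map `Q_{(F,X)} = -(∇_X + F̃)`. -/
def quantization (hT : ContMDiff 𝓘(ℝ, EG) 𝓘(ℝ, V →L[ℂ] V) ∞ (repOp T))
    (hinj : Function.Injective T) (hθ : IsConnectionForm B T θ) :
    hamSubmodule hT hinj hθ →ₗ[ℝ] Module.End ℂ (SmoothSections B T) where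
  toFun a :=
    { toFun := fun s => ⟨-(nabla θ a.1.2 s.1 + tildeOp a.1.1 s.1), neg_mem (add_mem
        (nabla_mem hT hinj hθ a.2.2.1.1 s.2) (tildeOp_mem hT a.2.1 s.2))⟩
      map_add' := fun s t => by
        refine Subtype.ext (AssocSection.toFunLinear_injective ?_)
        refine Eq.trans ?_ (map_add (AssocSection.toFunLinear B T) _ _).symm
        refine (toFun_neg_nabla_add_tildeOp hT hinj hθ a.2 (s + t).2).trans ?_
        refine (congrArg (quantFun B θ a) (map_add (AssocSection.toFunLinear B T) s.1 t.1)).trans ?_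
        refine ((isEquivFun_toFun hT s.2).quantFun_add (isEquivFun_toFun hT t.2) _).trans ?_
        exact congrArg₂ (· + ·) (toFun_neg_nabla_add_tildeOp hT hinj hθ a.2 s.2).symm
          (toFun_neg_nabla_add_tildeOp hT hinj hθ a.2 t.2).symm
      map_smul' := fun c s => by
        refine Subtype.ext (AssocSection.toFunLinear_injective ?_)
        refine Eq.trans ?_ (map_smul (AssocSection.toFunLinear B T) _ _).symm
        refine (toFun_neg_nabla_add_tildeOp hT hinj hθ a.2 (c • s).2).trans ?_
        refine (congrArg (quantFun B θ a) (map_smul (AssocSection.toFunLinear B T) c s.1)).trans ?_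
        refine ((isEquivFun_toFun hT s.2).quantFun_smul c _).trans ?_
        exact congrArg (c • ·) (toFun_neg_nabla_add_tildeOp hT hinj hθ a.2 s.2).symm }
  map_add' a b := by
    refine LinearMap.ext fun s => Subtype.ext (AssocSection.toFunLinear_injective ?_)
    refine Eq.trans ?_ (map_add (AssocSection.toFunLinear B T) _ _).symm
    refine (toFun_neg_nabla_add_tildeOp hT hinj hθ (a + b).2 s.2).trans ?_
    have h := quantFun_add_smul_left hT hinj hθ 1 a.1 b.1 s.1.toFun
    rw [one_smul, one_smul] at h
    exact h.trans (congrArg₂ (· + ·) (toFun_neg_nabla_add_tildeOp hT hinj hθ a.2 s.2).symm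
      (toFun_neg_nabla_add_tildeOp hT hinj hθ b.2 s.2).symm)
  map_smul' c a := by
    refine LinearMap.ext fun s => Subtype.ext (AssocSection.toFunLinear_injective ?_)
    -- Sections form a complex space while pairs form a real one, so the real scalar is used as a
    -- complex number here and matched at the end.
    refine Eq.trans ?_ (map_smul (AssocSection.toFunLinear B T) (c : ℂ) _).symm
    refine (toFun_neg_nabla_add_tildeOp hT hinj hθ (c • a).2 s.2).trans ?_
    -- The pair `a - a` shows that the zero pair gives the zero operator; homogeneity is then the
    -- case `0 + c • a`.
    have h0 := quantFun_add_smul_left hT hinj hθ (-1) a.1 a.1 s.1.toFun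
    have h := quantFun_add_smul_left hT hinj hθ c 0 a.1 s.1.toFun
    rw [neg_one_smul, add_neg_cancel, neg_one_smul, add_neg_cancel] at h0
    rw [h0, zero_add, zero_add] at h
    refine h.trans (Eq.trans ?_ (congrArg ((c : ℂ) • ·)
      (toFun_neg_nabla_add_tildeOp hT hinj hθ a.2 s.2).symm))
    funext p
    exact (Complex.coe_smul c _).symm

theorem toFun_quantization (a : hamSubmodule hT hinj hθ) (s : SmoothSections B T) :
    AssocSection.toFun (quantization hT hinj hθ a s).1 = quantFun B θ a s.1.toFun :=
  toFun_neg_nabla_add_tildeOp hT hinj hθ a.2 s.2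

theorem quantization_injective [Nontrivial V] :
    Function.Injective (quantization hT hinj hθ) := by
  refine (injective_iff_map_eq_zero _).2 fun a ha => ?_
  have h := eq_zero_of_forall_quantFun_eq_zero hT hinj hθ (F := a.1.1) (X := a.1.2) fun f hf => by
    have h1 := toFun_quantization hT hinj hθ a ⟨_, hf.ofFun_mem (B := B)⟩
    rw [AssocSection.toFun_ofFun hf.act, ha] at h1
    exact h1.symm.trans (map_zero (AssocSection.toFunLinear B T))
  exact Subtype.ext (Prod.ext h.1 h.2)

theorem quantization_commutator (a b : hamSubmodule hT hinj hθ) :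
    ⁅quantization hT hinj hθ a, quantization hT hinj hθ b⁆ =
      -quantization hT hinj hθ ⟨hamBracket B θ a b, hamBracket_mem hT hinj hθ a.2 b.2⟩ := by
  refine LinearMap.ext fun s => Subtype.ext (AssocSection.toFunLinear_injective ?_)
  refine Eq.trans ?_ (map_neg (AssocSection.toFunLinear B T) _).symm
  refine (map_sub (AssocSection.toFunLinear B T)
    (quantization hT hinj hθ a (quantization hT hinj hθ b s)).1
    (quantization hT hinj hθ b (quantization hT hinj hθ a s)).1).trans ?_
  have key : ∀ c d : hamSubmodule hT hinj hθ,
      AssocSection.toFun (quantization hT hinj hθ c (quantization hT hinj hθ d s)).1 =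
        quantFun B θ c (quantFun B θ d s.1.toFun) := fun c d => by
    rw [toFun_quantization, toFun_quantization]
  refine (congrArg₂ (· - ·) (key a b) (key b a)).trans ?_
  refine (quantFun_commutator hT hinj hθ a.2 b.2 (isEquivFun_toFun hT s.2)).trans ?_
  exact congrArg Neg.neg (toFun_quantization hT hinj hθ
    ⟨hamBracket B θ a b, hamBracket_mem hT hinj hθ a.2 b.2⟩ s).symm

theorem hamField_spec {F : P → (V →L[ℂ] V)} (hF : F ∈ Prod.fst '' hamPairs B T θ) :
    (F, hamField B T θ F) ∈ hamPairs B T θ := by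
  obtain ⟨⟨F, X⟩, ha, rfl⟩ := hF
  have h : ∃ X, (F, X) ∈ hamPairs B T θ := ⟨X, ha⟩
  rw [hamField, dif_pos h]
  exact h.choose_spec

end Quantization

end GaugePrequantization

end

theorem mainTheorem4
    {EP EM EG P M G V : Type*}
    [NormedAddCommGroup EP] [NormedSpace ℝ EP] [FiniteDimensional ℝ EP]
    [NormedAddCommGroup EM] [NormedSpace ℝ EM] [FiniteDimensional ℝ EM]
    [NormedAddCommGroup EG] [NormedSpace ℝ EG] [FiniteDimensional ℝ EG]
    [TopologicalSpace P] [T2Space P] [ChartedSpace EP P] [IsManifold 𝓘(ℝ, EP) ∞ P]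
    [TopologicalSpace M] [T2Space M] [ChartedSpace EM M] [IsManifold 𝓘(ℝ, EM) ∞ M]
    [TopologicalSpace G] [T2Space G] [ChartedSpace EG G] [Group G] [LieGroup 𝓘(ℝ, EG) ∞ G]
    [MulAction Gᵐᵒᵖ P]
    [NormedAddCommGroup V] [InnerProductSpace ℂ V] [FiniteDimensional ℂ V] [Nontrivial V]
    (B : PrincipalBundle EP EM EG P M G)
    (T : G →* (V ≃ₗᵢ[ℂ] V))
    (hT : ContMDiff 𝓘(ℝ, EG) 𝓘(ℝ, V →L[ℂ] V) ∞ (repOp T))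
    (hTinj : Function.Injective T)
    (θ : OneForm EP P V) (hθ : IsConnectionForm B T θ) :
    (∀ (X : VField EM M) (s : SmoothSections B T), IsSmoothField X →
      nabla θ X s.1 ∈ SmoothSections B T ∧
      ∀ p : P, nabla θ X s.1 (B.proj p) =
        AssocFiber.mk B T p rfl (fieldDeriv (hliftField B θ X) (AssocSection.toFun s.1) p)) ∧
    ∃ 𝓕 : Submodule ℝ ((P → (V →L[ℂ] V)) × VField EM M),
      (𝓕 : Set ((P → (V →L[ℂ] V)) × VField EM M)) = hamPairs B T θ ∧
      ∃ hbr : ∀ a b : 𝓕, hamBracket B θ a b ∈ 𝓕,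
      ∃ Q : 𝓕 →ₗ[ℝ] Module.End ℂ (SmoothSections B T),
        (∀ (a : 𝓕) (s : SmoothSections B T),
          (Q a s : AssocSection B T) = -(nabla θ a.1.2 s.1 + tildeOp a.1.1 s.1)) ∧
        Function.Injective Q ∧
        (∀ a b : 𝓕, ⁅Q a, Q b⁆ = - Q ⟨hamBracket B θ a b, hbr a b⟩) ∧
        (CurvNonsingular B θ → Set.InjOn Prod.fst (hamPairs B T θ)) ∧
        (Set.InjOn Prod.fst (hamPairs B T θ) →
          ∀ F K : P → (V →L[ℂ] V),
            F ∈ Prod.fst '' hamPairs B T θ → K ∈ Prod.fst '' hamPairs B T θ →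
            ∃ (hF : (F, hamField B T θ F) ∈ 𝓕) (hK : (K, hamField B T θ K) ∈ 𝓕)
              (hFK : (funBracket B T θ F K, hamField B T θ (funBracket B T θ F K)) ∈ 𝓕),
              ⁅Q ⟨_, hF⟩, Q ⟨_, hK⟩⁆ = - Q ⟨_, hFK⟩) := by
  refine ⟨fun X s hX => ⟨nabla_mem hT hTinj hθ hX s.2, fun p => ?_⟩, hamSubmodule hT hTinj hθ, rfl,
    fun a b => hamBracket_mem hT hTinj hθ a.2 b.2, quantization hT hTinj hθ, fun a s => rfl,
    quantization_injective hT hTinj hθ, quantization_commutator hT hTinj hθ,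
    injOn_fst_hamPairs hT hTinj hθ, fun hdet F K hF hK => ?_⟩
  · rw [← AssocSection.toFun_eq_iff]
    exact congrFun (toFun_nabla hT hTinj hθ hX s.2) p
  · have hF' := hamField_spec hF
    have hK' := hamField_spec hK
    have hb := hamBracket_mem hT hTinj hθ hF' hK'
    -- The bracket of the two pairs has first component `{F, K}`, so this function has a Hamiltonian
    -- field. Since the field is determined by the function, it equals `[X_F, X_K]`, and the
    -- commutator formula for pairs applies.
    have hFK := hamField_spec (F := funBracket B T θ F K) ⟨_, hb, rfl⟩
    have h := hdet hb hFK rfl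
    refine ⟨hF', hK', hFK, ?_⟩
    refine (quantization_commutator hT hTinj hθ ⟨_, hF'⟩ ⟨_, hK'⟩).trans ?_
    exact congrArg (fun a => -quantization hT hTinj hθ a) (Subtype.ext h)
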